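/- Let $d\ge 0$, $N\ge 1$, $T>0$. Let $w:\mathbb R^d\to\mathbb R^d$ be odd (so $w(0)=0$) and $C^2$, with $w,\nabla w,\nabla^2 w$ bounded, let $\nu:\mathbb R^d\to\mathbb R$ be $C^2$, and let $X_{1,0},\dots,X_{N,0}\in\mathbb R^d$, $f_0=\frac1N\sum_{i=1}^N\delta_{X_{i,0}}$. For a kernel $v$, let $\mathsf J[v]=\frac1N\sum_i\nu(X_i(T))$, where $$\dot X_i=\frac1N\sum_{j\ne i}v(X_i-X_j),\qquad X_i(0)=X_{i,0},$$ and let $\mathcal J[v]=\int\nu\,\mathrm df(T)$, where $f$ is the measure-valued solution (a weakly continuous curve of probability measures on $[0,T]$, satisfying the equation in the distributional sense) of $$\partial_t f+\nabla\cdot((v*f)f)=0,\qquad f(0)=f_0 .$$ Let $V$ be the space of $C^1$ fields $\varphi:\mathbb R^d\to\mathbb R^d$, bounded with bounded derivative, with $\varphi(0)=0$. The first variation at $w$ of a functional $J$ is the linear functional $L$ on $V$ with $\frac{\mathrm d}{\mathrm d\varepsilon}J[w+\varepsilon\varphi]\big|_{\varepsilon=0}=L(\varphi)$ for all $\varphi\in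 V$. Write $\nabla w(r)u$ for the vector with components $\sum_i\partial_jw_i(r)u_i$. **Theorem.** For each kernel $v\in w+V$ both forward problems have exactly one solution on $[0,T]$, and $f(t)=\frac1N\sum_i\delta_{X_i(t)}$. Let $X$ be the solution for $v=w$ and $f_N(t)=\frac1N\sum_i\delta_{X_i(t)}$. Each of the following has exactly one classical ($C^1$) solution on $[0,T]$ (respectively on $[0,T]\times\mathbb R^d$): * the particle adjoint system $\dot Y_i+\frac1N\sum_{j\ne i}\nabla w(X_i-X_j)Y_i-\frac1N\sum_{j\ne i}\nabla w(X_j-X_i)Y_j=0$, $Y_i(T)=\nabla\nu(X_i(T))$; * the PDE adjoint $\partial_tg-w*(\nabla g\,f_N)+(w*f_N)\cdot\nabla g=0$, $g(T,\cdot)=\nu$, where $(w*(\nabla g\,f_N))(t,x)=\int w(x-y)\cdot\nabla g(t,y)\,f_N(t,\mathrm dy)$; * the equation $\partial_th_N+(w*f_N)\cdot\nabla h_N-\nabla w*(h_Nf_N)+(\nabla w*f_N)h_N=0$, $h_N(T,\cdot)=\nabla\nu$. Moreover $h_N=\nabla g$ and $Y_i(t)=h_N(t,X_i(t))$ for all $t\in[0,T]$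 and all $i$. The first variations of $\mathcal J$ and of $\mathsf J$ at $w$ exist and are equal, $\frac{\delta\mathcal J}{\delta w}=\frac{\delta\mathsf J}{\delta w}$, and their common value at $\varphi\in V$ is $$\int_0^T\!\!\iint\varphi(x-y)\cdot\nabla g(t,x)\,f_N(t,\mathrm dy)\,f_N(t,\mathrm dx)\,\mathrm dt=\frac1{N^2}\sum_{i=1}^N\sum_{j\ne i}\int_0^T\varphi(X_i(t)-X_j(t))\cdot Y_i(t)\,\mathrm dt .$$ -/

import Mathlib

open Set MeasureTheory
open scoped ENNReal Gradient RealInnerProductSpace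

noncomputable section

/-- The state space `ℝ^d` with its Euclidean norm. -/
abbrev Space (d : ℕ) := EuclideanSpace ℝ (Fin d)

/-- The standing assumption on the interaction kernel: odd, zero at the origin, and `C²` with
bounded derivatives up to order two. -/
structure IsAdmissibleKernel {d : ℕ} (w : Space d → Space d) : Prop where
  odd : ∀ r, w (-r) = -w r
  map_zero : w 0 = 0
  contDiff : ContDiff ℝ 2 w
  bounded : ∃ C : ℝ, ∀ r,
    ‖w r‖ ≤ C ∧ ‖fderiv ℝ w r‖ ≤ C ∧ ‖fderiv ℝ (fderiv ℝ w) r‖ ≤ C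

/-- The kernel perturbations: `C¹` fields, bounded with bounded derivative, that vanish at the
origin (a particle exerts no force on itself, before and after the perturbation). -/
def kernelVariations (d : ℕ) : Submodule ℝ (Space d → Space d) where
  carrier := {φ | ContDiff ℝ 1 φ ∧ (∃ C : ℝ, ∀ r, ‖φ r‖ ≤ C ∧ ‖fderiv ℝ φ r‖ ≤ C) ∧ φ 0 = 0}
  zero_mem' := by
    refine ⟨contDiff_const, ⟨0, fun r => ?_⟩, rfl⟩
    simp
  add_mem' := by
    rintro φ ψ ⟨h1, ⟨C, hC⟩, h0⟩ ⟨k1, ⟨D, hD⟩, k0⟩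
    refine ⟨h1.add k1, ⟨C + D, fun r => ⟨?_, ?_⟩⟩, ?_⟩
    · exact (norm_add_le _ _).trans (add_le_add (hC r).1 (hD r).1)
    · rw [fderiv_add (h1.differentiable one_ne_zero r) (k1.differentiable one_ne_zero r)]
      exact (norm_add_le _ _).trans (add_le_add (hC r).2 (hD r).2)
    · simp [h0, k0]
  smul_mem' := by
    rintro c φ ⟨h1, ⟨C, hC⟩, h0⟩
    refine ⟨contDiff_const.smul h1, ⟨‖c‖ * C, fun r => ⟨?_, ?_⟩⟩, ?_⟩
    · rw [Pi.smul_apply, norm_smul]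
      exact mul_le_mul_of_nonneg_left (hC r).1 (norm_nonneg c)
    · rw [fderiv_const_smul (h1.differentiable one_ne_zero r), norm_smul]
      exact mul_le_mul_of_nonneg_left (hC r).2 (norm_nonneg c)
    · simp [h0]

/-- The empirical measure `(1/N) ∑ i, δ_{x i}`. -/
def empiricalMeasure {d N : ℕ} [NeZero N] (x : Fin N → Space d) :
    ProbabilityMeasure (Space d) :=
  ⟨(N : ℝ≥0∞)⁻¹ • ∑ i, Measure.dirac (x i), ⟨by
    simp only [Measure.smul_apply, Measure.coe_finsetSum, Finset.sum_apply, measure_univ,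
      Finset.sum_const, Finset.card_univ, Fintype.card_fin, nsmul_eq_mul, mul_one, smul_eq_mul]
    exact ENNReal.inv_mul_cancel (by simpa using NeZero.ne N) (ENNReal.natCast_ne_top N)⟩⟩

/-- The mean-field velocity `(w * μ)(x) = ∫ w(x - y) μ(dy)`. -/
def meanFieldVelocity {d : ℕ} (w : Space d → Space d) (μ : ProbabilityMeasure (Space d))
    (x : Space d) : Space d :=
  ∫ y, w (x - y) ∂(μ : Measure (Space d))

/-- `∇w(r) u`: the vector with `j`-th component `∑ i, ∂_j w_i(r) u_i`, i.e. the transposed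
Jacobian matrix of `w` at `r` applied to `u`. -/
def gradKernel {d : ℕ} (w : Space d → Space d) (r u : Space d) : Space d :=
  ContinuousLinearMap.adjoint (fderiv ℝ w r) u

/-! ### Forward problems -/

/-- `X` solves `X_i' = (1/N) ∑_{j ≠ i} w(X_i - X_j)`, `X_i(0) = X_{i,0}`, on `[0, T]`. -/
def IsParticleSolution {d N : ℕ} (T : ℝ) (w : Space d → Space d) (X₀ : Fin N → Space d)
    (X : ℝ → Fin N → Space d) : Prop :=
  X 0 = X₀ ∧ ∀ t ∈ Icc 0 T, ∀ i, HasDerivWithinAt (fun s => X s i)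
    ((N : ℝ)⁻¹ • ∑ j ∈ Finset.univ.erase i, w (X t i - X t j)) (Icc 0 T) t

/-- `f` is a measure-valued (distributional) solution of `∂_t f + ∇·((w * f) f) = 0`,
`f(0) = f₀`, on `[0, T]`: a weakly continuous curve of probability measures that satisfies the
equation against compactly supported `C¹` test functions of time and space. -/
def IsMeanFieldSolution {d : ℕ} (T : ℝ) (w : Space d → Space d)
    (f₀ : ProbabilityMeasure (Space d)) (f : ℝ → ProbabilityMeasure (Space d)) : Prop :=
  ContinuousOn f (Icc 0 T) ∧ f 0 = f₀ ∧
  ∀ ψ : ℝ → Space d → ℝ, ContDiff ℝ 1 (Function.uncurry ψ) →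
    HasCompactSupport (Function.uncurry ψ) → ∀ t ∈ Icc 0 T,
      ∫ x, ψ t x ∂(f t : Measure (Space d)) - ∫ x, ψ 0 x ∂(f₀ : Measure (Space d)) =
        ∫ s in (0 : ℝ)..t, ∫ x, (deriv (fun r => ψ r x) s +
          ⟪meanFieldVelocity w (f s) x, ∇ (ψ s) x⟫) ∂(f s : Measure (Space d))

/-! ### Objectives as functionals of the kernel -/

open Classical in
/-- `𝒥[w] = ∫ ν f(T)`, where `f` solves the mean-field equation with kernel `w` and initial
datum `f₀` (and `0` if there is no solution). -/
def pdeObjective {d : ℕ} (T : ℝ) (ν : Space d → ℝ) (f₀ : ProbabilityMeasure (Space d))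
    (w : Space d → Space d) : ℝ :=
  if h : ∃ f, IsMeanFieldSolution T w f₀ f then ∫ x, ν x ∂(h.choose T : Measure (Space d)) else 0

open Classical in
/-- `J[w] = (1/N) ∑ i, ν(X_i(T))`, where `X` solves the particle system with kernel `w` and
initial datum `X₀` (and `0` if there is no solution). -/
def particleObjective {d N : ℕ} (T : ℝ) (ν : Space d → ℝ) (X₀ : Fin N → Space d)
    (w : Space d → Space d) : ℝ :=
  if h : ∃ X, IsParticleSolution T w X₀ X then (N : ℝ)⁻¹ * ∑ i, ν (h.choose T i) else 0

/-- The linear functional `L` is the first variation of `J` at `w`: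
`d/dε J[w + ε φ] = ⟨L, φ⟩` at `ε = 0` for every perturbation `φ`. -/
def HasFirstVariation {d : ℕ} (J : (Space d → Space d) → ℝ) (w : Space d → Space d)
    (L : kernelVariations d →ₗ[ℝ] ℝ) : Prop :=
  ∀ φ : kernelVariations d,
    HasDerivAt (fun ε : ℝ => J (w + ε • (φ : Space d → Space d))) (L φ) 0

/-! ### Adjoint problems -/

/-- `Y` solves the particle adjoint system on `[0, T]`:
`Y_i' + (1/N) ∑_{j ≠ i} ∇w(X_i - X_j) Y_i - (1/N) ∑_{j ≠ i} ∇w(X_j - X_i) Y_j = 0`,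
`Y_i(T) = ∇ν(X_i(T))`. -/
def IsParticleAdjoint {d N : ℕ} (T : ℝ) (w : Space d → Space d) (ν : Space d → ℝ)
    (X Y : ℝ → Fin N → Space d) : Prop :=
  (∀ i, Y T i = ∇ ν (X T i)) ∧
  ∀ t ∈ Icc 0 T, ∀ i, HasDerivWithinAt (fun s => Y s i)
    ((N : ℝ)⁻¹ • ∑ j ∈ Finset.univ.erase i, gradKernel w (X t j - X t i) (Y t j)
      - (N : ℝ)⁻¹ • ∑ j ∈ Finset.univ.erase i, gradKernel w (X t i - X t j) (Y t i))
    (Icc 0 T) t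

/-- `g` is a classical (`C¹`) solution on `[0, T] × ℝ^d` of the adjoint of the mean-field equation
along `f`: `∂_t g - w * (∇g f) + (w * f) · ∇g = 0`, `g(T) = ν`, where
`(w * (∇g f))(x) = ∫ w(x - y) · ∇g(y) f(dy)`. -/
def IsMeanFieldAdjoint {d : ℕ} (T : ℝ) (w : Space d → Space d) (ν : Space d → ℝ)
    (f : ℝ → ProbabilityMeasure (Space d)) (g : ℝ → Space d → ℝ) : Prop :=
  ContDiffOn ℝ 1 (Function.uncurry g) (Icc 0 T ×ˢ univ) ∧ g T = ν ∧
  ∀ t ∈ Icc 0 T, ∀ x, HasDerivWithinAt (fun s => g s x)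
    (∫ y, ⟪w (x - y), ∇ (g t) y⟫ ∂(f t : Measure (Space d))
      - ⟪meanFieldVelocity w (f t) x, ∇ (g t) x⟫) (Icc 0 T) t

/-- `h` is a classical (`C¹`) solution on `[0, T] × ℝ^d` of
`∂_t h + (w * f) · ∇h - ∇w * (h f) + (∇w * f) · h = 0`, `h(T) = ∇ν`. -/
def IsMeanFieldGradAdjoint {d : ℕ} (T : ℝ) (w : Space d → Space d) (ν : Space d → ℝ)
    (f : ℝ → ProbabilityMeasure (Space d)) (h : ℝ → Space d → Space d) : Prop :=
  ContDiffOn ℝ 1 (Function.uncurry h) (Icc 0 T ×ˢ univ) ∧ (∀ x, h T x = ∇ ν x) ∧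
  ∀ t ∈ Icc 0 T, ∀ x, HasDerivWithinAt (fun s => h s x)
    (∫ y, gradKernel w (x - y) (h t y) ∂(f t : Measure (Space d))
      - fderiv ℝ (h t) x (meanFieldVelocity w (f t) x)
      - ∫ y, gradKernel w (x - y) (h t x) ∂(f t : Measure (Space d))) (Icc 0 T) t

end

/-! The value function `G(t, X)` of the particle system is the sum of `ν` over the particles at time
`T`, when they sit at `X` at time `t`. It is constant along trajectories, so `DG(1, F) = 0` for the
particle field `F`. Differentiating this identity in `X` shows that the partial gradients `Y_i` of
`G` along the trajectory solve the particle adjoint system (`exists_particleAdjoint`). Along a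
trajectory for `w + εφ` only the perturbation changes `G`, so its increment is exactly `ε` times the
integral of `DG` applied to the field of `φ`. Dividing by `ε` and letting `ε → 0` gives the first
variation without differentiating trajectories in `ε` (`hasDerivAt_terminalValue`).

For the mean-field adjoint, the nonlocal term is first replaced by a source built from the known
`Y`; the resulting linear transport equation is solved by characteristics
(`exists_transport_solution`). Since `∇w` is even, `∇g` along `X_i` and `Y_i` solve the same linear
terminal value problem, so they agree (`gradient_transport_solution_eqOn`). Hence the source is the
nonlocal term, and `h = ∇g` solves the differentiated equation. As equations are differentiated, `G`
and `g` must be `C²`; this rests on the `C²` flow of a `C²` field (`exists_contDiff_flow`).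

The objectives agree because the mean-field equation has only the empirical solution. For a given
solution `f` the velocity `v * f` is a Lipschitz field. Test functions that vanish on the
characteristics of the initial atoms, combined with Grönwall, show that `f` is carried by these
curves; bumps that follow one curve show that masses are conserved. Thus `f` is the empirical
measure of its own characteristics, which therefore solve the particle system
(`IsMeanFieldSolution.eq_empiricalMeasure`). -/

noncomputable section ParticleMeanField

open Filter Topology
open scoped unitInterval NNReal

/-! ### Calculus on the Banach space of continuous curves. -/

/-- The pointwise application of a bounded bilinear map to two continuous curves. -/
def pointwiseBilin (K : Type*) [TopologicalSpace K] [CompactSpace K]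
    {E F G : Type*} [NormedAddCommGroup E] [NormedSpace ℝ E] [NormedAddCommGroup F]
    [NormedSpace ℝ F] [NormedAddCommGroup G] [NormedSpace ℝ G] (B : G →L[ℝ] E →L[ℝ] F) :
    C(K, G) →L[ℝ] C(K, E) →L[ℝ] C(K, F) :=
  LinearMap.mkContinuous₂
    (LinearMap.mk₂ ℝ (fun (A : C(K, G)) (z : C(K, E)) =>
        (⟨fun s => B (A s) (z s), by fun_prop⟩ : C(K, F)))
      (fun _ _ _ => by ext; simp) (fun _ _ _ => by ext; simp)
      (fun _ _ _ => by ext; simp) (fun _ _ _ => by ext; simp)) ‖B‖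
    (fun A z => by
      rw [ContinuousMap.norm_le _ (by positivity)]
      intro s
      refine (B.le_opNorm₂ (A s) (z s)).trans ?_
      gcongr
      · exact A.norm_coe_le_norm s
      · exact z.norm_coe_le_norm s)

theorem contDiff_pointwiseBilin_postcomp {K : Type*} [TopologicalSpace K] [CompactSpace K]
    {E F G : Type*} [NormedAddCommGroup E] [NormedSpace ℝ E] [NormedAddCommGroup F]
    [NormedSpace ℝ F] [NormedAddCommGroup G] [NormedSpace ℝ G] (B : G →L[ℝ] E →L[ℝ] F)
    {n : WithTop ℕ∞} {g : C(E, G)} (hg : ContDiff ℝ n fun z : C(K, E) => g.comp z) :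
    ContDiff ℝ n fun z : C(K, E) => pointwiseBilin K B (g.comp z) :=
  (pointwiseBilin K B).contDiff.comp hg

/-- Pointwise application of a continuous family of continuous linear maps to a continuous curve. -/
def pointwiseApply (K : Type*) [TopologicalSpace K] [CompactSpace K]
    (E F : Type*) [NormedAddCommGroup E] [NormedSpace ℝ E] [NormedAddCommGroup F]
    [NormedSpace ℝ F] (A : C(K, E →L[ℝ] F)) : C(K, E) →L[ℝ] C(K, F) :=
  pointwiseBilin K (ContinuousLinearMap.id ℝ (E →L[ℝ] F)) A

@[simp] theorem pointwiseApply_apply {K : Type*} [TopologicalSpace K] [CompactSpace K]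
    {E F : Type*} [NormedAddCommGroup E] [NormedSpace ℝ E] [NormedAddCommGroup F]
    [NormedSpace ℝ F] (A : C(K, E →L[ℝ] F)) (z : C(K, E)) (s : K) :
    pointwiseApply K E F A z s = A s (z s) := rfl

theorem hasFDerivAt_postcomp {K : Type*} [TopologicalSpace K] [CompactSpace K]
    {E F : Type*} [NormedAddCommGroup E] [NormedSpace ℝ E] [NormedAddCommGroup F]
    [NormedSpace ℝ F] {f : C(E, F)} (hf : ContDiff ℝ 1 f) (z : C(K, E)) :
    HasFDerivAt (fun z : C(K, E) => f.comp z)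
      (pointwiseApply K E F
        ((⟨fderiv ℝ f, hf.continuous_fderiv one_ne_zero⟩ : C(E, E →L[ℝ] F)).comp z)) z := by
  set Df : C(E, E →L[ℝ] F) := ⟨fderiv ℝ f, hf.continuous_fderiv one_ne_zero⟩
  have hcont : Continuous fun z : C(K, E) => Df.comp z := ContinuousMap.continuous_postcomp Df
  rw [hasFDerivAt_iff_isLittleO_nhds_zero, Asymptotics.isLittleO_iff]
  intro c hc
  obtain ⟨δ, hδ, hball⟩ := (Metric.continuousAt_iff (f := fun z : C(K, E) => Df.comp z)
    (a := z)).1 hcont.continuousAt c hc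
  filter_upwards [Metric.ball_mem_nhds (0 : C(K, E)) hδ] with h hh
  rw [ContinuousMap.norm_le _ (by positivity)]
  intro s
  have key := (convex_segment (z s) (z s + h s)).norm_image_sub_le_of_norm_hasFDerivWithin_le'
    (f := f) (f' := fderiv ℝ f) (φ := fderiv ℝ f (z s)) (C := c)
    (fun y _ => (hf.differentiable one_ne_zero y).hasFDerivAt.hasFDerivWithinAt) ?_
    (left_mem_segment ℝ _ _) (right_mem_segment ℝ _ _)
  · refine le_trans ?_ (key.trans (mul_le_mul_of_nonneg_left ?_ hc.le))
    · simp [Df]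
    · simpa using h.norm_coe_le_norm s
  · intro y hy
    rw [segment_eq_image'] at hy
    -- A point of the segment is the value at `s` of the curve `z + θ h`, which lies in the `δ`-ball
    -- around `z`; the bound is therefore uniform in `s`.
    obtain ⟨θ, hθ, rfl⟩ := hy
    have h1 : dist (z + θ • h) z < δ := by
      rw [dist_eq_norm, add_sub_cancel_left, norm_smul, Real.norm_eq_abs, abs_of_nonneg hθ.1]
      exact (mul_le_of_le_one_left (norm_nonneg _) hθ.2).trans_lt (by simpa using hh)
    have h2 := (ContinuousMap.dist_apply_le_dist s).trans (hball h1).le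
    rw [dist_eq_norm] at h2
    simpa [Df] using h2

/-- Induction on `n`: the derivative at `z` is pointwise application of `Df ∘ z`, and `z ↦ Df ∘ z`
is again a postcomposition, with values in `E →L[ℝ] F`. The induction thus changes the target space,
which is why `E` and `F` share a universe. -/
theorem contDiff_postcomp {K : Type*} [TopologicalSpace K] [CompactSpace K] (n : ℕ)
    {E F : Type u} [NormedAddCommGroup E] [NormedSpace ℝ E] [NormedAddCommGroup F]
    [NormedSpace ℝ F] {f : C(E, F)} (hf : ContDiff ℝ n f) :
    ContDiff ℝ n (fun z : C(K, E) => f.comp z) := by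
  induction n generalizing F with
  | zero =>
    rw [Nat.cast_zero, contDiff_zero]
    exact ContinuousMap.continuous_postcomp _
  | succ n ih =>
    have hf1 : ContDiff ℝ 1 f := hf.of_le (by norm_cast; omega)
    have hf' : ContDiff ℝ n (fderiv ℝ f) := hf.fderiv_right (by norm_cast)
    rw [Nat.cast_add, Nat.cast_one, contDiff_succ_iff_hasFDerivAt]
    exact ⟨_, contDiff_pointwiseBilin_postcomp (ContinuousLinearMap.id ℝ (E →L[ℝ] F))
      (ih (f := ⟨_, hf'.continuous⟩) hf'), fun z => hasFDerivAt_postcomp hf1 z⟩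

/-- The primitive vanishing at `0` of a continuous curve on the unit interval. -/
def unitPrimitive (E : Type*) [NormedAddCommGroup E] [NormedSpace ℝ E] : C(I, E) →L[ℝ] C(I, E) :=
  LinearMap.mkContinuous
    { toFun := fun (z : C(I, E)) => ⟨fun s : I => ∫ r in (0 : ℝ)..s, IccExtend zero_le_one z r,
        (intervalIntegral.continuous_primitive
          (fun _ _ => z.continuous.Icc_extend'.intervalIntegrable _ _) 0).comp
          continuous_subtype_val⟩
      map_add' := fun z z' => by
        ext s
        exact intervalIntegral.integral_add (z.continuous.Icc_extend'.intervalIntegrable _ _)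
          (z'.continuous.Icc_extend'.intervalIntegrable _ _)
      map_smul' := fun c z => by
        ext s
        exact intervalIntegral.integral_smul c _ } 1
    (fun z => by
      rw [one_mul, ContinuousMap.norm_le _ (norm_nonneg z)]
      intro s
      refine (intervalIntegral.norm_integral_le_of_norm_le_const (C := ‖z‖)
        fun r _ => z.norm_coe_le_norm _).trans ?_
      rw [sub_zero, abs_of_nonneg s.2.1]
      exact mul_le_of_le_one_right (norm_nonneg z) s.2.2)

theorem unitPrimitive_apply {E : Type*} [NormedAddCommGroup E] [NormedSpace ℝ E]
    (z : C(I, E)) (s : I) :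
    unitPrimitive E z s = ∫ r in (0 : ℝ)..s, IccExtend zero_le_one z r := rfl

theorem norm_unitPrimitive_le {E : Type*} [NormedAddCommGroup E] [NormedSpace ℝ E] :
    ‖unitPrimitive E‖ ≤ 1 :=
  LinearMap.mkContinuous_norm_le _ zero_le_one _

/-! ### Existence and uniqueness for Lipschitz differential equations. -/

/-- A bounded Lipschitz time-dependent field has a solution on any interval. -/
theorem exists_solution_of_bounded_lipschitz {E : Type*} [NormedAddCommGroup E] [NormedSpace ℝ E]
    [CompleteSpace E] {v : ℝ → E → E} {K : ℝ≥0} {C a b t₀ : ℝ} (ht₀ : t₀ ∈ Icc a b)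
    (hlip : ∀ t ∈ Icc a b, LipschitzWith K (v t)) (hcont : ∀ x, ContinuousOn (v · x) (Icc a b))
    (hbound : ∀ t ∈ Icc a b, ∀ x, ‖v t x‖ ≤ C) (x₀ : E) :
    ∃ γ : ℝ → E, γ t₀ = x₀ ∧
      ∀ t ∈ Icc a b, HasDerivWithinAt γ (v t (γ t)) (Icc a b) t := by
  have hC : 0 ≤ C := (norm_nonneg _).trans (hbound t₀ ht₀ 0)
  -- The radius is the farthest that a curve of speed at most `C` can travel from time `t₀`; since
  -- the bounds on `v` are global, no smallness of the interval is needed.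
  have hP : IsPicardLindelof v (⟨t₀, ht₀⟩ : Icc a b) x₀
      (C.toNNReal * (max (b - t₀) (t₀ - a)).toNNReal) 0 C.toNNReal K :=
    { lipschitzOnWith := fun t ht => (hlip t ht).lipschitzOnWith
      continuousOn := fun x _ => hcont x
      norm_le := fun t ht x _ => by simpa [hC] using hbound t ht x
      mul_max_le := by
        have : 0 ≤ max (b - t₀) (t₀ - a) := le_max_of_le_left (by linarith [ht₀.2])
        simp [this] }
  exact hP.exists_eq_forall_mem_Icc_hasDerivWithinAt₀

/-- Two solutions of a Lipschitz differential equation on `[a, b]` that agree at some time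
agree. -/
theorem solution_unique {E : Type*} [NormedAddCommGroup E] [NormedSpace ℝ E]
    {v : ℝ → E → E} {K : ℝ≥0} {a b t₀ : ℝ} (ht₀ : t₀ ∈ Icc a b)
    (hlip : ∀ t ∈ Icc a b, LipschitzWith K (v t)) {f g : ℝ → E}
    (hf : ∀ t ∈ Icc a b, HasDerivWithinAt f (v t (f t)) (Icc a b) t)
    (hg : ∀ t ∈ Icc a b, HasDerivWithinAt g (v t (g t)) (Icc a b) t)
    (h₀ : f t₀ = g t₀) : EqOn f g (Icc a b) := by
  have hfc : ContinuousOn f (Icc a b) := fun t ht => (hf t ht).continuousWithinAt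
  have hgc : ContinuousOn g (Icc a b) := fun t ht => (hg t ht).continuousWithinAt
  have hl : Icc a t₀ ⊆ Icc a b := Icc_subset_Icc_right ht₀.2
  have hr : Icc t₀ b ⊆ Icc a b := Icc_subset_Icc_left ht₀.1
  intro t ht
  rcases le_total t t₀ with h | h
  · refine ODE_solution_unique_of_mem_Icc_left (v := v) (s := fun _ => univ) (K := K)
      (fun s hs => (hlip s (hl (Ioc_subset_Icc_self hs))).lipschitzOnWith) (hfc.mono hl) ?_
      (fun _ _ => trivial) (hgc.mono hl) ?_ (fun _ _ => trivial) h₀ ⟨ht.1, h⟩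
    · intro s hs
      exact (hf s (hl (Ioc_subset_Icc_self hs))).mono_of_mem_nhdsWithin
        (mem_of_superset (Icc_mem_nhdsLE hs.1) (Icc_subset_Icc_right (hs.2.trans ht₀.2)))
    · intro s hs
      exact (hg s (hl (Ioc_subset_Icc_self hs))).mono_of_mem_nhdsWithin
        (mem_of_superset (Icc_mem_nhdsLE hs.1) (Icc_subset_Icc_right (hs.2.trans ht₀.2)))
  · refine ODE_solution_unique_of_mem_Icc_right (v := v) (s := fun _ => univ) (K := K)
      (fun s hs => (hlip s (hr (Ico_subset_Icc_self hs))).lipschitzOnWith) (hfc.mono hr) ?_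
      (fun _ _ => trivial) (hgc.mono hr) ?_ (fun _ _ => trivial) h₀ ⟨h, ht.2⟩
    · intro s hs
      exact (hf s (hr (Ico_subset_Icc_self hs))).mono_of_mem_nhdsWithin
        (mem_of_superset (Icc_mem_nhdsGE hs.2) (Icc_subset_Icc_left (ht₀.1.trans hs.1)))
    · intro s hs
      exact (hg s (hr (Ico_subset_Icc_self hs))).mono_of_mem_nhdsWithin
        (mem_of_superset (Icc_mem_nhdsGE hs.2) (Icc_subset_Icc_left (ht₀.1.trans hs.1)))

/-- An autonomous bounded Lipschitz field has a global integral curve from each point. -/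
theorem exists_integralCurve {E : Type*} [NormedAddCommGroup E] [NormedSpace ℝ E]
    [CompleteSpace E] {F : E → E} {K : ℝ≥0} {C : ℝ} (hlip : LipschitzWith K F)
    (hbound : ∀ x, ‖F x‖ ≤ C) (x : E) :
    ∃ γ : ℝ → E, γ 0 = x ∧ ∀ t, HasDerivAt γ (F (γ t)) t := by
  have h0 : ∀ n : ℕ, (0 : ℝ) ∈ Icc (-(n : ℝ)) n := fun n => by simp
  have hex : ∀ n : ℕ, ∃ γ : ℝ → E, γ 0 = x ∧
      ∀ t ∈ Icc (-(n : ℝ)) n, HasDerivWithinAt γ (F (γ t)) (Icc (-(n : ℝ)) n) t := fun n =>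
    exists_solution_of_bounded_lipschitz (v := fun _ => F) (h0 n) (fun _ _ => hlip)
      (fun _ => continuousOn_const) (fun _ _ => hbound) x
  choose α hα0 hα using hex
  have hmono : ∀ m n : ℕ, m ≤ n → EqOn (α m) (α n) (Icc (-(m : ℝ)) m) := fun m n hmn => by
    have hmn' : (m : ℝ) ≤ n := by exact_mod_cast hmn
    have hsub : Icc (-(m : ℝ)) m ⊆ Icc (-(n : ℝ)) n := Icc_subset_Icc (by linarith) hmn'
    exact solution_unique (v := fun _ => F) (h0 m) (fun _ _ => hlip) (hα m)
      (fun t ht => (hα n t (hsub ht)).mono hsub) ((hα0 m).trans (hα0 n).symm)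
  -- The solutions on the intervals `[-n, n]` are compatible, so each time may use its own interval.
  refine ⟨fun t => α ⌈|t|⌉₊ t, by simpa using hα0 0, fun t => ?_⟩
  -- The extra `1` puts `t` in the interior of `[-n, n]`, where the derivative is two-sided.
  set n : ℕ := ⌈|t|⌉₊ + 1
  have ht : |t| < n := (Nat.le_ceil |t|).trans_lt (by simp [n])
  have heq : ∀ s : ℝ, |s| < n → α ⌈|s|⌉₊ s = α n s := fun s hs =>
    hmono _ _ (Nat.ceil_le.2 hs.le) (abs_le.1 (Nat.le_ceil |s|))
  have hnhds : Icc (-(n : ℝ)) n ∈ 𝓝 t := Icc_mem_nhds (abs_lt.1 ht).1 (abs_lt.1 ht).2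
  have h1 := (hα n t (abs_le.1 ht.le)).hasDerivAt hnhds
  change HasDerivAt _ (F (α ⌈|t|⌉₊ t)) t
  rw [heq t ht]
  refine h1.congr_of_eventuallyEq ?_
  filter_upwards [(isOpen_lt continuous_abs continuous_const).mem_nhds ht] with s hs
  exact heq s hs

/-! ### Smooth dependence of flows on time and initial point. -/

/-- The equation satisfied on the unit interval by the rescaled integral curve
`s ↦ γ (τ s)` starting at `x`, for `p = ((τ, x), γ (τ ·))`. -/
def scaledPicardDefect {E : Type*} [NormedAddCommGroup E] [NormedSpace ℝ E] (F : C(E, E))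
    (p : (ℝ × E) × C(I, E)) : C(I, E) :=
  p.2 - (ContinuousLinearMap.const ℝ I p.1.2 + p.1.1 • unitPrimitive E (F.comp p.2))

theorem contDiff_scaledPicardDefect {E : Type*} [NormedAddCommGroup E] [NormedSpace ℝ E]
    {F : C(E, E)} {n : ℕ} (hF : ContDiff ℝ n F) : ContDiff ℝ n (scaledPicardDefect F) := by
  have h1 : ContDiff ℝ n fun p : (ℝ × E) × C(I, E) => unitPrimitive E (F.comp p.2) :=
    (unitPrimitive E).contDiff.comp ((contDiff_postcomp n hF).comp contDiff_snd)
  have h2 : ContDiff ℝ n fun p : (ℝ × E) × C(I, E) =>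
      (ContinuousLinearMap.const ℝ I p.1.2 : C(I, E)) :=
    (ContinuousLinearMap.const ℝ (M := E) I).contDiff.comp (contDiff_snd.comp contDiff_fst)
  exact contDiff_snd.sub (h2.add ((contDiff_fst.comp contDiff_fst).smul h1))

theorem ContinuousLinearMap.isInvertible_one_sub {E : Type*} [NormedAddCommGroup E]
    [NormedSpace ℝ E] [CompleteSpace E] {V : E →L[ℝ] E} (hV : ‖V‖ < 1) :
    (1 - V).IsInvertible := by
  obtain ⟨U, hU⟩ := isUnit_one_sub_of_norm_lt_one hV
  exact ⟨ContinuousLinearEquiv.unitsEquiv ℝ E U, by rw [← hU]; rfl⟩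

/-- The partial derivative in the curve is `1 - τ P DF` with `P` the primitive operator. As `‖P‖ ≤
1` and `‖DF‖ ≤ K`, it is inverted by a Neumann series for short times. -/
theorem isInvertible_fderiv_scaledPicardDefect {E : Type*} [NormedAddCommGroup E]
    [NormedSpace ℝ E] [CompleteSpace E] {F : C(E, E)} (hF : ContDiff ℝ 1 F) {K : ℝ≥0}
    (hlip : LipschitzWith K F) {p : (ℝ × E) × C(I, E)} (hp : |p.1.1| * K < 1) :
    (fderiv ℝ (scaledPicardDefect F) p ∘L .inr ℝ (ℝ × E) C(I, E)).IsInvertible := by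
  set DF : C(E, E →L[ℝ] E) := ⟨fderiv ℝ F, hF.continuous_fderiv one_ne_zero⟩
  set V : C(I, E) →L[ℝ] C(I, E) := p.1.1 • unitPrimitive E ∘L pointwiseApply I E E (DF.comp p.2)
  have hd : HasFDerivAt (fun z => scaledPicardDefect F (p.1, z)) (1 - V) p.2 := by
    have h := (((unitPrimitive E).hasFDerivAt.comp p.2
      (hasFDerivAt_postcomp hF p.2)).const_smul p.1.1).const_add
        (ContinuousLinearMap.const ℝ I p.1.2)
    exact (hasFDerivAt_id p.2).sub h
  have heq : fderiv ℝ (scaledPicardDefect F) p ∘L .inr ℝ (ℝ × E) C(I, E) = 1 - V := by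
    have h := ((contDiff_scaledPicardDefect (n := 1) (by simpa using hF)).differentiable
      (by simp) p).hasFDerivAt
    have h' := HasFDerivAt.comp (g := scaledPicardDefect F) (f := fun z => (p.1, z)) p.2 h
      (hasFDerivAt_prodMk_right p.1 p.2)
    exact HasFDerivAt.unique h' hd
  have hV : ‖V‖ < 1 := by
    refine lt_of_le_of_lt ?_ hp
    have h1 : ‖pointwiseApply I E E (DF.comp p.2)‖ ≤ K := by
      refine ContinuousLinearMap.opNorm_le_bound _ K.2 fun z => ?_
      rw [ContinuousMap.norm_le _ (by positivity)]
      intro s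
      refine ((DF.comp p.2 s).le_opNorm (z s)).trans
        (mul_le_mul ?_ (z.norm_coe_le_norm s) (norm_nonneg _) K.2)
      exact norm_fderiv_le_of_lipschitz ℝ hlip
    refine V.opNorm_le_bound (by positivity) fun z => ?_
    calc ‖V z‖ ≤ |p.1.1| * (1 * (K * ‖z‖)) := by
          change ‖p.1.1 • unitPrimitive E (pointwiseApply I E E (DF.comp p.2) z)‖ ≤ _
          rw [norm_smul, Real.norm_eq_abs]
          refine mul_le_mul_of_nonneg_left ?_ (abs_nonneg _)
          refine ((unitPrimitive E).le_opNorm _).trans ?_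
          exact mul_le_mul norm_unitPrimitive_le (ContinuousLinearMap.le_of_opNorm_le _ h1 z)
            (norm_nonneg (pointwiseApply I E E (DF.comp p.2) z)) zero_le_one
      _ = |p.1.1| * K * ‖z‖ := by ring
  rw [heq]
  exact ContinuousLinearMap.isInvertible_one_sub hV

theorem scaledPicardDefect_eq_zero_iff {E : Type*} [NormedAddCommGroup E]
    [NormedSpace ℝ E] {F : C(E, E)} {p : (ℝ × E) × C(I, E)} :
    scaledPicardDefect F p = 0 ↔ ∀ s : I, p.2 s =
      p.1.2 + p.1.1 • ∫ r in (0 : ℝ)..s, F (IccExtend zero_le_one p.2 r) := by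
  rw [scaledPicardDefect, sub_eq_zero, ContinuousMap.ext_iff]
  rfl

/-- A solution of the rescaled integral equation is the rescaled integral curve. -/
theorem eq_of_scaledPicardDefect_eq_zero {E : Type*} [NormedAddCommGroup E]
    [NormedSpace ℝ E] [CompleteSpace E] {F : C(E, E)} {K : ℝ≥0} (hlip : LipschitzWith K F)
    {γ : ℝ → E} (hγ : ∀ t, HasDerivAt γ (F (γ t)) t) {τ : ℝ} {z : C(I, E)}
    (hz : scaledPicardDefect F ((τ, γ 0), z) = 0) : z 1 = γ τ := by
  rw [scaledPicardDefect_eq_zero_iff] at hz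
  set Z : ℝ → E := fun s => γ 0 + τ • ∫ r in (0 : ℝ)..s, F (IccExtend zero_le_one z r)
  have hcont : Continuous fun r => F (IccExtend zero_le_one z r) :=
    F.continuous.comp z.continuous.Icc_extend'
  have hZz : ∀ s (hs : s ∈ Icc (0 : ℝ) 1), Z s = z ⟨s, hs⟩ := fun s hs => (hz ⟨s, hs⟩).symm
  have hlip' : LipschitzWith (‖τ‖₊ * K) fun x => τ • F x := (lipschitzWith_smul τ).comp hlip
  have hZd : ∀ s ∈ Icc (0 : ℝ) 1, HasDerivWithinAt Z (τ • F (Z s)) (Icc 0 1) s := fun s hs => by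
    have h := (((hcont.integral_hasStrictDerivAt 0 s).hasDerivAt.const_smul τ).const_add
      (γ 0)).hasDerivWithinAt (s := Icc (0 : ℝ) 1)
    rwa [hZz s hs, ← IccExtend_of_mem zero_le_one z hs]
  have hγd : ∀ s ∈ Icc (0 : ℝ) 1,
      HasDerivWithinAt (fun s => γ (τ * s)) (τ • F (γ (τ * s))) (Icc 0 1) s := fun s _ => by
    have h := (hγ (τ * s)).scomp s ((hasDerivAt_id s).const_mul τ)
    rw [mul_one] at h
    exact h.hasDerivWithinAt
  have h := solution_unique (v := fun _ x => τ • F x) (left_mem_Icc.2 zero_le_one)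
    (fun _ _ => hlip') hZd hγd (by simp [Z]) (right_mem_Icc.2 zero_le_one)
  rw [hZz 1 (right_mem_Icc.2 zero_le_one)] at h
  simpa using h

theorem scaledPicardDefect_integralCurve {E : Type*} [NormedAddCommGroup E]
    [NormedSpace ℝ E] [CompleteSpace E] {F : C(E, E)}
    {γ : ℝ → E} (hγ : ∀ t, HasDerivAt γ (F (γ t)) t) (τ : ℝ) :
    ∃ z : C(I, E), scaledPicardDefect F ((τ, γ 0), z) = 0 := by
  have hc : Continuous γ := continuous_iff_continuousAt.2 fun t => (hγ t).continuousAt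
  refine ⟨⟨fun s => γ (τ * s), by fun_prop⟩, scaledPicardDefect_eq_zero_iff.2 fun s => ?_⟩
  have hd : ∀ r : ℝ, HasDerivAt (fun s => γ (τ * s)) (τ • F (γ (τ * r))) r := fun r => by
    have h := (hγ (τ * r)).scomp r ((hasDerivAt_id r).const_mul τ)
    rwa [mul_one] at h
  have hint : ∫ r in (0 : ℝ)..s, τ • F (γ (τ * r)) = γ (τ * s) - γ (τ * 0) :=
    intervalIntegral.integral_eq_sub_of_hasDerivAt (fun r _ => hd r)
      ((by fun_prop : Continuous fun r : ℝ => τ • F (γ (τ * r))).intervalIntegrable _ _)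
  rw [← intervalIntegral.integral_smul]
  have hcongr : ∫ r in (0 : ℝ)..s, τ • F (IccExtend zero_le_one
      (⟨fun s : I => γ (τ * s), by fun_prop⟩ : C(I, E)) r) =
      ∫ r in (0 : ℝ)..s, τ • F (γ (τ * r)) := by
    refine intervalIntegral.integral_congr fun r hr => ?_
    rw [uIcc_of_le s.2.1] at hr
    have hr' : r ∈ Icc (0 : ℝ) 1 := ⟨hr.1, hr.2.trans s.2.2⟩
    simp only [IccExtend_of_mem zero_le_one _ hr', ContinuousMap.coe_mk]
  simp only [hcongr, hint]
  simp

/-- The integral curves of a bounded Lipschitz `C^n` field form a `C^n` flow. -/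
theorem exists_contDiff_flow {E : Type*} [NormedAddCommGroup E] [NormedSpace ℝ E]
    [CompleteSpace E] {F : E → E} {n : ℕ} (hn : n ≠ 0) (hF : ContDiff ℝ n F) {K : ℝ≥0} {C : ℝ}
    (hlip : LipschitzWith K F) (hbound : ∀ x, ‖F x‖ ≤ C) :
    ∃ φ : ℝ → E → E, ContDiff ℝ n (Function.uncurry φ) ∧ (∀ x, φ 0 x = x) ∧
      (∀ s t x, φ (s + t) x = φ s (φ t x)) ∧ ∀ t x, HasDerivAt (fun s => φ s x) (F (φ t x)) t := by
  choose γ hγ0 hγ using exists_integralCurve hlip hbound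
  set Fc : C(E, E) := ⟨F, hlip.continuous⟩
  have hn1 : (n : WithTop ℕ∞) ≠ 0 := by exact_mod_cast hn
  have hF1 : ContDiff ℝ 1 F := hF.of_le (by exact_mod_cast Nat.one_le_iff_ne_zero.2 hn)
  have hadd : ∀ s t x, γ x (s + t) = γ (γ x t) s := fun s t x => by
    have h := ODE_solution_unique_univ (v := fun _ => F) (s := fun _ => univ) (t₀ := 0)
      (f := fun s => γ x (s + t)) (g := γ (γ x t)) (fun _ => hlip.lipschitzOnWith)
      (fun s => ⟨(hγ x (s + t)).comp_add_const s t, trivial⟩) (fun s => ⟨hγ _ s, trivial⟩)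
      (by simp [hγ0])
    exact congrFun h s
  -- Short times: after rescaling to the unit interval, time is a mere parameter of an equation in
  -- one Banach space, and the implicit function theorem applies. Uniqueness for the integral
  -- equation identifies the implicit solution with the integral curve, and evaluation at `1` is
  -- linear.
  have hloc : ∀ p : ℝ × E, |p.1| * K < 1 → ContDiffAt ℝ n (fun p : ℝ × E => γ p.2 p.1) p := by
    intro p hp
    obtain ⟨z, hz⟩ := scaledPicardDefect_integralCurve (F := Fc) (hγ p.2) p.1
    rw [hγ0] at hz
    have hcd : ContDiffAt ℝ n (scaledPicardDefect Fc) (p, z) :=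
      (contDiff_scaledPicardDefect hF).contDiffAt
    have hinv := isInvertible_fderiv_scaledPicardDefect (F := Fc) hF1 hlip (p := (p, z)) hp
    have hψ := hcd.contDiffAt_implicitFunction hn1 hinv
    have hev1 : ContDiff ℝ n fun z : C(I, E) => z 1 :=
      ContinuousLinearMap.contDiff (E := C(I, E)) (ContinuousMap.evalCLM ℝ (1 : I))
    have hev : ContDiffAt ℝ n (fun q => hcd.implicitFunction hn1 hinv q 1) p :=
      hev1.contDiffAt.comp p hψ
    refine hev.congr_of_eventuallyEq ?_
    filter_upwards [hcd.eventually_apply_implicitFunction hn1 hinv] with q hq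
    refine (eq_of_scaledPicardDefect_eq_zero (F := Fc) hlip (hγ q.2) ?_).symm
    rw [hγ0]
    exact hq.trans hz
  -- The group law writes the flow at time `m τ` as `m` successive flows at time `τ`, so only `τ`
  -- has to be small.
  have hmul : ∀ (m : ℕ) (p : ℝ × E), |p.1| * K < 1 →
      ContDiffAt ℝ n (fun p : ℝ × E => γ p.2 (m * p.1)) p := by
    intro m
    induction m with
    | zero =>
      intro p _
      simpa [hγ0] using contDiffAt_snd
    | succ m ih =>
      intro p hp
      have h := ContDiffAt.comp p (hloc (p.1, γ p.2 (m * p.1)) hp) (contDiffAt_fst.prodMk (ih p hp))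
      refine h.congr_of_eventuallyEq (Eventually.of_forall fun q => ?_)
      simp only [Function.comp_apply]
      rw [← hadd]
      push_cast
      ring_nf
  refine ⟨fun t x => γ x t, contDiff_iff_contDiffAt.2 fun p => ?_, hγ0, hadd, fun t x => hγ x t⟩
  -- With this `m`, the `m`-th part of the time is in the short-time regime.
  obtain ⟨m, hm⟩ := exists_nat_gt (|p.1| * K)
  have hm0 : (0 : ℝ) < m := lt_of_le_of_lt (by positivity) hm
  have hsc : ContDiff ℝ n fun q : ℝ × E => ((m : ℝ)⁻¹ * q.1, q.2) := by fun_prop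
  have h := ContDiffAt.comp p (hmul m ((m : ℝ)⁻¹ * p.1, p.2) (by
    rw [abs_mul, abs_of_pos (inv_pos.2 hm0), mul_assoc, inv_mul_lt_iff₀ hm0, mul_one]
    exact hm)) hsc.contDiffAt
  refine h.congr_of_eventuallyEq (Eventually.of_forall fun q => ?_)
  simp [Function.uncurry, mul_inv_cancel_left₀ hm0.ne']

/-! ### Regularity of parametric integrals and the differentiated transport equation. -/

/-- Integrating a `C^n` function over a segment from the origin in its first variable gives a
`C^n` function. -/
theorem contDiff_scaledIntegral {E F : Type} [NormedAddCommGroup E] [NormedSpace ℝ E]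
    [NormedAddCommGroup F] [NormedSpace ℝ F] [CompleteSpace F] {n : ℕ} {q : ℝ × E → F}
    (hq : ContDiff ℝ n q) :
    ContDiff ℝ n fun p : ℝ × E => ∫ θ in (0 : ℝ)..1, q (θ * p.1, p.2) := by
  set qc : C(ℝ × E, F) := ⟨q, hq.continuous⟩
  -- The curve `θ ↦ (θ t, x)` depends linearly on `(t, x)`. The integral is thus a linear map,
  -- followed by postcomposition with `q` and by a linear functional of the resulting curve.
  let L : ℝ × E →L[ℝ] C(I, ℝ × E) := LinearMap.mkContinuous
    { toFun := fun p => (⟨fun θ => ((θ : ℝ) * p.1, p.2), by fun_prop⟩ : C(I, ℝ × E))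
      map_add' := fun p p' => by ext <;> simp [mul_add]
      map_smul' := fun c p => by ext <;> simp [mul_left_comm] } 1 (fun p => by
        rw [one_mul, ContinuousMap.norm_le _ (norm_nonneg p)]
        intro θ
        refine norm_prod_le_iff.2 ⟨?_, norm_snd_le p⟩
        refine (norm_mul_le _ _).trans ((mul_le_of_le_one_left (norm_nonneg _) ?_).trans
          (norm_fst_le p))
        exact (Real.norm_of_nonneg θ.2.1).trans_le θ.2.2)
  have h1 : ContDiff ℝ n fun p : ℝ × E => qc.comp (L p) := (contDiff_postcomp n hq).comp L.contDiff
  have h2 : ContDiff ℝ n fun z : C(I, F) => unitPrimitive F z 1 :=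
    (ContinuousLinearMap.contDiff (E := C(I, F)) (ContinuousMap.evalCLM ℝ (1 : I))).comp
      (unitPrimitive F).contDiff
  convert h2.comp h1 using 2 with p
  rw [Function.comp_apply, unitPrimitive_apply]
  refine intervalIntegral.integral_congr fun r hr => ?_
  rw [uIcc_of_le zero_le_one] at hr
  simp only [IccExtend_of_mem zero_le_one _ hr]
  rfl

theorem integral_eq_smul_scaledIntegral {F : Type*} [NormedAddCommGroup F]
    [NormedSpace ℝ F] (q : ℝ → F) (t : ℝ) :
    ∫ s in (0 : ℝ)..t, q s = t • ∫ θ in (0 : ℝ)..1, q (θ * t) := by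
  rw [intervalIntegral.smul_integral_comp_mul_right]
  simp

/-- The substitution `s = θ t` moves the variable endpoint into the integrand. -/
theorem contDiff_parametricPrimitive {E F : Type} [NormedAddCommGroup E] [NormedSpace ℝ E]
    [NormedAddCommGroup F] [NormedSpace ℝ F] [CompleteSpace F] {n : ℕ} {q : ℝ × E → F}
    (hq : ContDiff ℝ n q) :
    ContDiff ℝ n fun p : ℝ × E => ∫ s in (0 : ℝ)..p.1, q (s, p.2) := by
  simp_rw [fun p : ℝ × E => integral_eq_smul_scaledIntegral (fun s => q (s, p.2)) p.1]
  exact contDiff_fst.smul (contDiff_scaledIntegral hq)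

theorem hasFDerivAt_parametricIntegral {E F : Type} [NormedAddCommGroup E] [NormedSpace ℝ E]
    [NormedAddCommGroup F] [NormedSpace ℝ F] [CompleteSpace F] [ProperSpace E] {q : ℝ × E → F}
    (hq : ContDiff ℝ 1 q) (a b : ℝ) (x : E) :
    HasFDerivAt (fun x => ∫ s in a..b, q (s, x))
      (∫ s in a..b, fderiv ℝ q (s, x) ∘L .inr ℝ ℝ E) x := by
  have hc : Continuous fun p : ℝ × E => fderiv ℝ q p ∘L .inr ℝ ℝ E :=
    (hq.continuous_fderiv one_ne_zero).clm_comp continuous_const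
  obtain ⟨M, hM⟩ := (isCompact_uIcc (a := a) (b := b)).prod (isCompact_closedBall x 1)
    |>.exists_bound_of_continuousOn hc.continuousOn
  refine intervalIntegral.hasFDerivAt_integral_of_dominated_of_fderiv_le
    (F' := fun y s => fderiv ℝ q (s, y) ∘L .inr ℝ ℝ E) (bound := fun _ => M)
    (Metric.closedBall_mem_nhds x one_pos) (Eventually.of_forall fun y => ?_) ?_ ?_
    (Eventually.of_forall fun s hs y hy => hM (s, y) ⟨uIoc_subset_uIcc hs, hy⟩)
    intervalIntegrable_const (Eventually.of_forall fun s _ y _ => ?_)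
  · exact (hq.continuous.comp (by fun_prop : Continuous fun s : ℝ => (s, y))).aestronglyMeasurable
  · exact (hq.continuous.comp (by fun_prop : Continuous fun s : ℝ => (s, x))).intervalIntegrable _ _
  · exact (hc.comp (by fun_prop : Continuous fun s : ℝ => (s, x))).aestronglyMeasurable
  · exact ((hq.differentiable one_ne_zero (s, y)).hasFDerivAt).comp y (hasFDerivAt_prodMk_right s y)

/-- If `q` and its derivative in the second variable are `C¹`, then the primitive of `q` in the
first variable is `C²`. -/
theorem contDiff_two_parametricPrimitive {E F : Type} [NormedAddCommGroup E] [NormedSpace ℝ E]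
    [NormedAddCommGroup F] [NormedSpace ℝ F] [CompleteSpace F] [ProperSpace E] {q : ℝ × E → F}
    (hq : ContDiff ℝ 1 q)
    (hq' : ContDiff ℝ 1 fun p : ℝ × E => fderiv ℝ q p ∘L .inr ℝ ℝ E) :
    ContDiff ℝ 2 fun p : ℝ × E => ∫ s in (0 : ℝ)..p.1, q (s, p.2) := by
  have hk1 : ContDiff ℝ 1 fun p : ℝ × E => ∫ s in (0 : ℝ)..p.1, q (s, p.2) := by
    simpa using contDiff_parametricPrimitive (n := 1) (by simpa using hq)
  have hk2 : ContDiff ℝ 1 fun p : ℝ × E =>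
      ∫ s in (0 : ℝ)..p.1, fderiv ℝ q (s, p.2) ∘L .inr ℝ ℝ E := by
    simpa using contDiff_parametricPrimitive (n := 1) (by simpa using hq')
  rw [show (2 : WithTop ℕ∞) = 1 + 1 by norm_num]
  -- The time derivative of the primitive is `q` itself, and its space derivative is the primitive
  -- of the space derivative of `q`. Both are `C¹`, although `q` need not be `C²` in time.
  have key : ∀ p : ℝ × E, fderiv ℝ (fun p : ℝ × E => ∫ s in (0 : ℝ)..p.1, q (s, p.2)) p =
      (ContinuousLinearMap.fst ℝ ℝ E).smulRight (q p) +
        (∫ s in (0 : ℝ)..p.1, fderiv ℝ q (s, p.2) ∘L .inr ℝ ℝ E) ∘L .snd ℝ ℝ E := by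
    intro p
    have h := (hk1.differentiable one_ne_zero p).hasFDerivAt
    have ht : HasDerivAt (fun t => ∫ s in (0 : ℝ)..t, q (s, p.2)) (q p) p.1 :=
      ((hq.continuous.comp (by fun_prop : Continuous fun s : ℝ => (s, p.2))).integral_hasStrictDerivAt
        0 p.1).hasDerivAt
    have ht' := HasFDerivAt.comp (f := fun t : ℝ => (t, p.2)) p.1 h (hasFDerivAt_prodMk_left p.1 p.2)
    have hx' := HasFDerivAt.comp (f := fun x : E => (p.1, x)) p.2 h (hasFDerivAt_prodMk_right p.1 p.2)
    have e1 := ht'.unique ht.hasFDerivAt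
    have e2 := hx'.unique (hasFDerivAt_parametricIntegral hq 0 p.1 p.2)
    refine ContinuousLinearMap.ext fun v => ?_
    have e1' := DFunLike.congr_fun e1 v.1
    have e2' := DFunLike.congr_fun e2 v.2
    simp only [ContinuousLinearMap.comp_apply, ContinuousLinearMap.inl_apply,
      ContinuousLinearMap.inr_apply] at e1' e2'
    have hv : v = (v.1, 0) + (0, v.2) := by simp
    rw [hv, map_add, e1', e2']
    simp
  refine contDiff_succ_iff_hasFDerivAt.2 ⟨_, ?_, fun p => (hk1.differentiable one_ne_zero p).hasFDerivAt⟩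
  rw [funext key]
  exact (contDiff_const.smulRight hq).add (hk2.clm_comp contDiff_const)

/-- Differentiating the transport equation `∂_t g + Dg u = S` in space, for `g` of class `C²`. -/
theorem fderiv_fderiv_of_transport {E : Type*} [NormedAddCommGroup E] [NormedSpace ℝ E]
    {g S : ℝ × E → ℝ} {u : ℝ × E → E} (hg : ContDiff ℝ 2 g) {t : ℝ} {x : E}
    (heq : ∀ y, fderiv ℝ g (t, y) (1, u (t, y)) = S (t, y))
    {S' : E →L[ℝ] ℝ} {u' : E →L[ℝ] E}
    (hS : HasFDerivAt (fun y => S (t, y)) S' x) (hu : HasFDerivAt (fun y => u (t, y)) u' x)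
    (η : E) :
    fderiv ℝ (fderiv ℝ g) (t, x) (1, u (t, x)) (0, η) =
      S' η - fderiv ℝ g (t, x) (0, u' η) := by
  have hg' : HasFDerivAt (fun y => fderiv ℝ g (t, y))
      (fderiv ℝ (fderiv ℝ g) (t, x) ∘L .inr ℝ ℝ E) x :=
    (((hg.fderiv_right (m := 1) (by norm_num)).differentiable one_ne_zero (t, x)).hasFDerivAt).comp x
      (hasFDerivAt_prodMk_right t x)
  have h1 := hg'.clm_apply ((hasFDerivAt_const (1 : ℝ) x).prodMk hu)
  have h2 := h1.unique (hS.congr_of_eventuallyEq (Eventually.of_forall heq))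
  have h3 := DFunLike.congr_fun h2 η
  -- By symmetry of the second derivative, the space derivative of the equation becomes the
  -- derivative of `Dg` in the transport direction, that is, along characteristics.
  have hsymm : fderiv ℝ (fderiv ℝ g) (t, x) (1, u (t, x)) (0, η) =
      fderiv ℝ (fderiv ℝ g) (t, x) (0, η) (1, u (t, x)) :=
    (hg.contDiffAt.isSymmSndFDerivAt (by simp)).eq _ _
  rw [hsymm, ← h3]
  simp

/-! ### Estimates for averages and kernels. -/

theorem norm_average_le {ι E : Type*} [Fintype ι] [NormedAddCommGroup E] [NormedSpace ℝ E]
    {N : ℕ} (hN : Fintype.card ι = N) {a : ι → E} {C : ℝ} (hC : 0 ≤ C) (ha : ∀ i, ‖a i‖ ≤ C) :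
    ‖(N : ℝ)⁻¹ • ∑ i, a i‖ ≤ C := by
  rw [norm_smul, norm_inv, RCLike.norm_natCast]
  have h : ‖∑ i, a i‖ ≤ N * C := by
    refine (norm_sum_le_of_le _ fun i _ => ha i).trans ?_
    simp [hN]
  rcases Nat.eq_zero_or_pos N with h0 | h0
  · simpa [h0] using hC
  · rw [inv_mul_le_iff₀ (by exact_mod_cast h0)]
    exact h

theorem exists_lipschitz_bound {d : ℕ} {v : Space d → Space d} (hv : v ∈ kernelVariations d) :
    ∃ (K : ℝ≥0) (C : ℝ), 0 ≤ C ∧ LipschitzWith K v ∧ ∀ r, ‖v r‖ ≤ C := by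
  obtain ⟨h1, ⟨C, hC⟩, -⟩ := hv
  have hC0 : 0 ≤ C := (norm_nonneg _).trans (hC 0).1
  refine ⟨C.toNNReal, C, hC0, lipschitzWith_of_nnnorm_fderiv_le (h1.differentiable one_ne_zero)
    fun r => ?_, fun r => (hC r).1⟩
  rw [← NNReal.coe_le_coe, coe_nnnorm, Real.coe_toNNReal _ hC0]
  exact (hC r).2

theorem IsAdmissibleKernel.mem_kernelVariations {d : ℕ} {w : Space d → Space d}
    (hw : IsAdmissibleKernel w) : w ∈ kernelVariations d := by
  obtain ⟨C, hC⟩ := hw.bounded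
  exact ⟨hw.contDiff.of_le one_le_two, ⟨C, fun r => ⟨(hC r).1, (hC r).2.1⟩⟩, hw.map_zero⟩

/-! ### The velocity field of a particle configuration -/

/-- The velocity `(1/N) ∑ j, v (x - X j)` induced at `x` by the particles `X`. -/
def particleVelocity {d N : ℕ} (v : Space d → Space d) (X : Fin N → Space d) (x : Space d) :
    Space d :=
  (N : ℝ)⁻¹ • ∑ j, v (x - X j)

/-- The vector field of the particle system. -/
def particleField {d N : ℕ} (v : Space d → Space d) (X : Fin N → Space d) : Fin N → Space d :=
  fun i => particleVelocity v X (X i)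

section
variable {d N : ℕ} {v : Space d → Space d}

theorem contDiff_particleVelocity {n : WithTop ℕ∞} (hv : ContDiff ℝ n v) :
    ContDiff ℝ n fun p : (Fin N → Space d) × Space d => particleVelocity v p.1 p.2 := by
  unfold particleVelocity
  fun_prop

theorem contDiff_particleField {n : WithTop ℕ∞} (hv : ContDiff ℝ n v) :
    ContDiff ℝ n (particleField (N := N) v) := by
  unfold particleField particleVelocity
  fun_prop

theorem norm_particleVelocity_le {C : ℝ} (hC : ∀ r, ‖v r‖ ≤ C) (X : Fin N → Space d)
    (x : Space d) : ‖particleVelocity v X x‖ ≤ C :=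
  norm_average_le (Fintype.card_fin N) ((norm_nonneg _).trans (hC 0)) fun _ => hC _

theorem norm_particleField_le {C : ℝ} (hC : ∀ r, ‖v r‖ ≤ C) (X : Fin N → Space d) :
    ‖particleField v X‖ ≤ C :=
  (pi_norm_le_iff_of_nonneg ((norm_nonneg _).trans (hC 0))).2
    fun _ => norm_particleVelocity_le hC _ _

theorem dist_particleVelocity_le {K : ℝ≥0} (hK : LipschitzWith K v) (X X' : Fin N → Space d)
    (x x' : Space d) :
    dist (particleVelocity v X x) (particleVelocity v X' x') ≤ K * (dist x x' + dist X X') := by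
  rw [dist_eq_norm, particleVelocity, particleVelocity, ← smul_sub, ← Finset.sum_sub_distrib]
  refine norm_average_le (Fintype.card_fin N) (by positivity) fun j => ?_
  rw [← dist_eq_norm]
  refine (hK.dist_le_mul _ _).trans (mul_le_mul_of_nonneg_left ?_ K.2)
  exact (dist_sub_sub_le _ _ _ _).trans (add_le_add le_rfl (dist_le_pi_dist X X' j))

theorem lipschitzWith_particleVelocity {K : ℝ≥0} (hK : LipschitzWith K v)
    (X : Fin N → Space d) : LipschitzWith K (particleVelocity v X) :=
  LipschitzWith.of_dist_le_mul fun x x' => by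
    simpa using dist_particleVelocity_le hK X X x x'

theorem lipschitzWith_particleField {K : ℝ≥0} (hK : LipschitzWith K v) :
    LipschitzWith (K * 2) (particleField (N := N) v) :=
  LipschitzWith.of_dist_le_mul fun X X' => by
    refine (dist_pi_le_iff (by positivity)).2 fun i => ?_
    refine (dist_particleVelocity_le hK X X' (X i) (X' i)).trans ?_
    have h := mul_le_mul_of_nonneg_left (dist_le_pi_dist X X' i) K.coe_nonneg
    rw [NNReal.coe_mul, NNReal.coe_ofNat]
    linarith

theorem sum_erase_interaction {E : Type*} [AddCommMonoid E] {a : Fin N → Fin N → E}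
    (i : Fin N) (h : a i i = 0) : ∑ j ∈ Finset.univ.erase i, a i j = ∑ j, a i j :=
  Finset.sum_erase _ h

/-- Since `v 0 = 0`, the self-interaction can be included: the system becomes an autonomous equation
for the whole configuration, and its field is the mean-field velocity of the empirical measure. -/
theorem isParticleSolution_iff (hv : v 0 = 0) {T : ℝ} {X₀ : Fin N → Space d}
    {X : ℝ → Fin N → Space d} :
    IsParticleSolution T v X₀ X ↔ X 0 = X₀ ∧
      ∀ t ∈ Icc 0 T, HasDerivWithinAt X (particleField v (X t)) (Icc 0 T) t := by
  refine and_congr Iff.rfl (forall₂_congr fun t _ => ?_)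
  rw [hasDerivWithinAt_pi]
  refine forall_congr' fun i => ?_
  rw [sum_erase_interaction (a := fun i j => v (X t i - X t j)) i (by simp [hv])]
  rfl

theorem IsParticleSolution.continuousOn {T : ℝ} {X₀ : Fin N → Space d}
    {X : ℝ → Fin N → Space d} (hX : IsParticleSolution T v X₀ X) : ContinuousOn X (Icc 0 T) :=
  continuousOn_pi.2 fun i t ht => (hX.2 t ht i).continuousWithinAt

theorem exists_isParticleSolution (hv : v ∈ kernelVariations d) {T : ℝ} (hT : 0 ≤ T)
    (X₀ : Fin N → Space d) : ∃ X, IsParticleSolution T v X₀ X := by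
  obtain ⟨K, C, -, hK, hC⟩ := exists_lipschitz_bound hv
  obtain ⟨X, h0, hX⟩ := exists_solution_of_bounded_lipschitz (v := fun _ => particleField v)
    (left_mem_Icc.2 hT) (fun _ _ => lipschitzWith_particleField hK)
    (fun _ => continuousOn_const) (fun _ _ => norm_particleField_le hC) X₀
  exact ⟨X, (isParticleSolution_iff hv.2.2).2 ⟨h0, hX⟩⟩

theorem IsParticleSolution.eqOn (hv : v ∈ kernelVariations d) {T : ℝ} (hT : 0 ≤ T)
    {X₀ : Fin N → Space d} {X X' : ℝ → Fin N → Space d} (hX : IsParticleSolution T v X₀ X)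
    (hX' : IsParticleSolution T v X₀ X') : EqOn X' X (Icc 0 T) := by
  obtain ⟨K, C, -, hK, hC⟩ := exists_lipschitz_bound hv
  rw [isParticleSolution_iff hv.2.2] at hX hX'
  exact solution_unique (v := fun _ => particleField v) (left_mem_Icc.2 hT)
    (fun _ _ => lipschitzWith_particleField hK) hX'.2 hX.2 (hX'.1.trans hX.1.symm)

end

/-! ### Empirical measures -/

section
variable {d N : ℕ} [NeZero N]

theorem integral_empiricalMeasure {E : Type*} [NormedAddCommGroup E] [NormedSpace ℝ E]
    [CompleteSpace E] (X : Fin N → Space d) (ψ : Space d → E) :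
    ∫ x, ψ x ∂(empiricalMeasure X : Measure (Space d)) = (N : ℝ)⁻¹ • ∑ i, ψ (X i) := by
  change ∫ x, ψ x ∂((N : ℝ≥0∞)⁻¹ • ∑ i, Measure.dirac (X i)) = _
  rw [integral_smul_measure, integral_finsetSum_measure fun i _ => integrable_dirac (by simp)]
  simp

theorem meanFieldVelocity_empiricalMeasure (v : Space d → Space d) (X : Fin N → Space d)
    (x : Space d) : meanFieldVelocity v (empiricalMeasure X) x = particleVelocity v X x :=
  integral_empiricalMeasure X fun y => v (x - y)

theorem continuous_empiricalMeasure :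
    Continuous (empiricalMeasure : (Fin N → Space d) → ProbabilityMeasure (Space d)) := by
  rw [continuous_iff_continuousAt]
  intro X
  refine ProbabilityMeasure.tendsto_iff_forall_integral_tendsto.2 fun ψ => ?_
  simp_rw [integral_empiricalMeasure]
  have h : Continuous fun X : Fin N → Space d => (N : ℝ)⁻¹ • ∑ i, ψ (X i) := by fun_prop
  exact h.continuousAt

end

/-! ### The empirical measure of the particles solves the mean-field equation -/

theorem HasFDerivAt.curry_fst {E F G : Type*} [NormedAddCommGroup E] [NormedSpace ℝ E]
    [NormedAddCommGroup F] [NormedSpace ℝ F] [NormedAddCommGroup G] [NormedSpace ℝ G]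
    {ψ : E → F → G} {L : E × F →L[ℝ] G} {s : E} {x : F}
    (h : HasFDerivAt (Function.uncurry ψ) L (s, x)) :
    HasFDerivAt (fun r => ψ r x) (L ∘L .inl ℝ E F) s :=
  HasFDerivAt.comp (f := fun r : E => (r, x)) s h (hasFDerivAt_prodMk_left s x)

theorem HasFDerivAt.curry_snd {E F G : Type*} [NormedAddCommGroup E] [NormedSpace ℝ E]
    [NormedAddCommGroup F] [NormedSpace ℝ F] [NormedAddCommGroup G] [NormedSpace ℝ G]
    {ψ : E → F → G} {L : E × F →L[ℝ] G} {s : E} {x : F}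
    (h : HasFDerivAt (Function.uncurry ψ) L (s, x)) :
    HasFDerivAt (ψ s) (L ∘L .inr ℝ E F) x :=
  HasFDerivAt.comp (f := fun y : F => (s, y)) x h (hasFDerivAt_prodMk_right s x)

/-- The integrand of the weak formulation is a single space-time derivative, along the direction
`(1, u)` of the characteristics. -/
theorem deriv_add_inner_gradient {d : ℕ} {ψ : ℝ → Space d → ℝ}
    (hψ : ContDiff ℝ 1 (Function.uncurry ψ)) (s : ℝ) (x u : Space d) :
    deriv (fun r => ψ r x) s + ⟪u, ∇ (ψ s) x⟫ = fderiv ℝ (Function.uncurry ψ) (s, x) (1, u) := by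
  have h := (hψ.differentiable one_ne_zero (s, x)).hasFDerivAt
  rw [inner_gradient_right, h.curry_fst.hasDerivAt.deriv, h.curry_snd.fderiv]
  simp only [ContinuousLinearMap.comp_apply, ContinuousLinearMap.inl_apply,
    ContinuousLinearMap.inr_apply, conj_trivial]
  rw [← map_add]
  simp

/-- The weak formulation is the fundamental theorem of calculus for the average of `ψ(s, X_i(s))`.
-/
theorem IsParticleSolution.isMeanFieldSolution {d N : ℕ} [NeZero N] {v : Space d → Space d}
    (hv : v ∈ kernelVariations d) {T : ℝ} {X₀ : Fin N → Space d} {X : ℝ → Fin N → Space d}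
    (hX : IsParticleSolution T v X₀ X) :
    IsMeanFieldSolution T v (empiricalMeasure X₀) (fun t => empiricalMeasure (X t)) := by
  have hXc := hX.continuousOn
  refine ⟨continuous_empiricalMeasure.comp_continuousOn hXc, congrArg _ hX.1, ?_⟩
  intro ψ hψ _ t ht
  have hX' := ((isParticleSolution_iff hv.2.2).1 hX).2
  have h0t : Icc 0 t ⊆ Icc 0 T := Icc_subset_Icc_right ht.2
  simp_rw [deriv_add_inner_gradient hψ, integral_empiricalMeasure,
    meanFieldVelocity_empiricalMeasure]
  have hvel : ∀ i, ContinuousOn (fun s => particleVelocity v (X s) (X s i)) (Icc 0 t) := fun i =>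
    (continuous_pi_iff.1 (contDiff_particleField (N := N) hv.1).continuous i).comp_continuousOn
      (hXc.mono h0t)
  have hXi : ∀ i, ContinuousOn (fun s => X s i) (Icc 0 t) := fun i =>
    (continuousOn_pi.1 hXc i).mono h0t
  have hint : ContinuousOn (fun s => (N : ℝ)⁻¹ • ∑ i, fderiv ℝ (Function.uncurry ψ) (s, X s i)
      (1, particleVelocity v (X s) (X s i))) (Icc 0 t) := by
    refine ContinuousOn.fun_const_smul (continuousOn_finsetSum _ fun i _ => ?_) _
    exact ((hψ.continuous_fderiv one_ne_zero).comp_continuousOn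
      (continuousOn_id.prodMk (hXi i))).clm_apply (continuousOn_const.prodMk (hvel i))
  have hcont : ContinuousOn (fun s => (N : ℝ)⁻¹ • ∑ i, ψ s (X s i)) (Icc 0 t) := by
    refine ContinuousOn.fun_const_smul (continuousOn_finsetSum _ fun i _ => ?_) _
    exact hψ.continuous.comp_continuousOn (continuousOn_id.prodMk (hXi i))
  rw [intervalIntegral.integral_eq_sub_of_hasDerivAt_of_le ht.1 hcont (fun s hs => ?_)
    (hint.intervalIntegrable_of_Icc ht.1), hX.1]
  refine HasDerivAt.fun_const_smul _ (HasDerivAt.fun_sum fun i _ => ?_)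
  have hs' : s ∈ Ioo 0 T := ⟨hs.1, hs.2.trans_le ht.2⟩
  have hXs := hasDerivAt_pi.1
    ((hX' s (Ioo_subset_Icc_self hs')).hasDerivAt (Icc_mem_nhds hs'.1 hs'.2)) i
  exact (hψ.differentiable one_ne_zero (s, X s i)).hasFDerivAt.comp_hasDerivAt s
    ((hasDerivAt_id s).prodMk hXs)

/-! ### Uniqueness for the mean-field equation -/

theorem measure_eq_of_finite_support {α : Type*} [MeasurableSpace α] [MeasurableSingletonClass α]
    {μ ν : Measure α} {S : Set α} (hS : S.Finite) (hμ : μ Sᶜ = 0) (hν : ν Sᶜ = 0)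
    (h : ∀ x ∈ S, μ {x} = ν {x}) : μ = ν := by
  have key : ∀ m : Measure α, m Sᶜ = 0 → ∀ B, m B = ∑ x ∈ (hS.inter_of_right B).toFinset, m {x} := by
    intro m hm B
    rw [sum_measure_singleton, Finite.coe_toFinset]
    refine le_antisymm ?_ (measure_mono inter_subset_left)
    calc m B ≤ m (B ∩ S ∪ Sᶜ) := measure_mono fun x hx => by
          by_cases hxS : x ∈ S
          · exact Or.inl ⟨hx, hxS⟩
          · exact Or.inr hxS
      _ ≤ m (B ∩ S) + m Sᶜ := measure_union_le _ _
      _ = m (B ∩ S) := by rw [hm, add_zero]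
  refine Measure.ext fun B _ => ?_
  rw [key μ hμ B, key ν hν B]
  exact Finset.sum_congr rfl fun x hx => h x ((Finite.mem_toFinset _).1 hx).2

/-- A continuous nonnegative function dominated by a multiple of its primitive vanishes. -/
theorem eq_zero_of_le_mul_primitive {a : ℝ → ℝ} {C T : ℝ} (hT : 0 ≤ T)
    (ha : ContinuousOn a (Icc 0 T)) (h0 : ∀ s ∈ Icc 0 T, 0 ≤ a s)
    (hle : ∀ s ∈ Icc 0 T, a s ≤ C * ∫ r in (0 : ℝ)..s, a r) : ∀ s ∈ Icc 0 T, a s = 0 := by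
  set a' : ℝ → ℝ := IccExtend hT (Icc 0 T |>.domRestrict a)
  have ha' : Continuous a' := (continuousOn_iff_continuous_domRestrict.1 ha).Icc_extend'
  have heq : ∀ s ∈ Icc 0 T, a' s = a s := fun s hs => by simp [a', IccExtend_of_mem hT _ hs]
  have hA : ∀ s ∈ Icc 0 T, ∫ r in (0 : ℝ)..s, a r = ∫ r in (0 : ℝ)..s, a' r := fun s hs => by
    refine intervalIntegral.integral_congr fun r hr => ?_
    rw [uIcc_of_le hs.1] at hr
    exact (heq r ⟨hr.1, hr.2.trans hs.2⟩).symm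
  have hd : ∀ s, HasDerivAt (fun s => ∫ r in (0 : ℝ)..s, a' r) (a' s) s := fun s =>
    (ha'.integral_hasStrictDerivAt 0 s).hasDerivAt
  have hz := eq_zero_of_abs_deriv_le_mul_abs_self_of_eq_zero_right (K := |C|) (a := 0) (b := T)
    (f := fun s => ∫ r in (0 : ℝ)..s, a' r) (f' := a')
    (fun s _ => (hd s).continuousAt.continuousWithinAt) (fun s _ => (hd s).hasDerivWithinAt)
    intervalIntegral.integral_same (fun s hs => ?_)
  · intro s hs
    refine le_antisymm ?_ (h0 s hs)
    simpa [hA s hs, hz s hs] using hle s hs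
  · have hs' := Ico_subset_Icc_self hs
    rw [heq s hs', Real.norm_of_nonneg (h0 s hs')]
    refine (hle s hs').trans ?_
    rw [hA s hs', Real.norm_eq_abs, ← abs_mul]
    exact le_abs_self _

/-- Integral form of Grönwall's inequality for a nonnegative function that is the indefinite
integral of a function it controls. -/
theorem eq_zero_of_eq_integral {a b : ℝ → ℝ} {C T : ℝ}
    (h0 : ∀ s ∈ Icc 0 T, 0 ≤ a s) (hab : ∀ s ∈ Icc 0 T, a s = ∫ r in (0 : ℝ)..s, b r)
    (hle : ∀ s ∈ Icc 0 T, b s ≤ C * a s) : ∀ t ∈ Icc 0 T, a t = 0 := by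
  intro t ht
  by_cases hb : IntervalIntegrable b volume 0 t
  swap
  -- Integrability of `b` is not assumed: if it fails, the integral has the default value `0`, which
  -- is already the claim at `t`.
  · rw [hab t ht, intervalIntegral.integral_undef hb]
  have hsub : Icc 0 t ⊆ Icc 0 T := Icc_subset_Icc_right ht.2
  have hac : ContinuousOn a (Icc 0 t) := by
    have h := intervalIntegral.continuousOn_primitive_interval' hb left_mem_uIcc
    rw [uIcc_of_le ht.1] at h
    exact h.congr fun s hs => hab s (hsub hs)
  refine eq_zero_of_le_mul_primitive ht.1 hac (fun s hs => h0 s (hsub hs)) (C := C)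
    (fun s hs => ?_) t (right_mem_Icc.2 ht.1)
  have hs0 : Icc 0 s ⊆ Icc 0 t := Icc_subset_Icc_right hs.2
  rw [hab s (hsub hs), ← intervalIntegral.integral_const_mul]
  refine intervalIntegral.integral_mono_on hs.1 (hb.mono_set ?_)
    (((hac.mono hs0).intervalIntegrable_of_Icc hs.1).const_mul C)
    (fun r hr => hle r (hsub (hs0 hr)))
  rw [uIcc_of_le hs.1, uIcc_of_le ht.1]
  exact hs0

/-- A `C¹` curve on an interval extends to a `C¹` curve on the line. -/
theorem exists_contDiff_extension {E : Type*} [NormedAddCommGroup E] [NormedSpace ℝ E]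
    [CompleteSpace E] {T : ℝ} (hT : 0 ≤ T) {z p : ℝ → E} (hp : ContinuousOn p (Icc 0 T))
    (hz : ∀ t ∈ Icc 0 T, HasDerivWithinAt z (p t) (Icc 0 T) t) :
    ∃ y : ℝ → E, ContDiff ℝ 1 y ∧ EqOn y z (Icc 0 T) ∧ ∀ t ∈ Icc 0 T, HasDerivAt y (p t) t := by
  -- The velocity is frozen at its endpoint values outside `[0, T]`; the extension of the curve is
  -- the primitive of this.
  set p' : ℝ → E := IccExtend hT (Icc 0 T |>.domRestrict p)
  have hp' : Continuous p' := (continuousOn_iff_continuous_domRestrict.1 hp).Icc_extend'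
  have hd : ∀ t, HasDerivAt (fun t => z 0 + ∫ s in (0 : ℝ)..t, p' s) (p' t) t := fun t =>
    ((hp'.integral_hasStrictDerivAt 0 t).hasDerivAt).const_add _
  have hpeq : ∀ t ∈ Icc 0 T, p' t = p t := fun t ht => by simp [p', IccExtend_of_mem hT _ ht]
  have hd' : ∀ t ∈ Icc 0 T, HasDerivAt (fun t => z 0 + ∫ s in (0 : ℝ)..t, p' s) (p t) t :=
    fun t ht => hpeq t ht ▸ hd t
  refine ⟨_, contDiff_one_iff_deriv.2 ⟨fun t => (hd t).differentiableAt, ?_⟩, ?_, hd'⟩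
  · rwa [funext fun t => (hd t).deriv]
  · exact solution_unique (v := fun t _ => p t) (K := 0) (left_mem_Icc.2 hT)
      (fun _ _ => LipschitzWith.const _) (fun t ht => (hd' t ht).hasDerivWithinAt) hz (by simp)

/-- Squaring removes the kink at `0`. This is the `C¹` profile of the spatial cutoffs and bumps used
as test functions below; it vanishes together with its derivative for `r ≤ 0`. -/
theorem hasDerivAt_max_zero_sq (r : ℝ) : HasDerivAt (fun r : ℝ => max r 0 ^ 2) (2 * max r 0) r := by
  rcases lt_trichotomy r 0 with h | rfl | h
  · have h1 : (fun r : ℝ => max r 0 ^ 2) =ᶠ[𝓝 r] fun _ => 0 := by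
      filter_upwards [Iio_mem_nhds h] with s hs
      simp [max_eq_right (mem_Iio.1 hs).le]
    simpa [max_eq_right h.le] using (hasDerivAt_const r (0 : ℝ)).congr_of_eventuallyEq h1
  · rw [hasDerivAt_iff_isLittleO_nhds_zero]
    refine Asymptotics.IsBigO.trans_isLittleO (g := fun h : ℝ => h ^ 2) ?_
      (by simpa using Asymptotics.isLittleO_pow_pow (𝕜 := ℝ) one_lt_two)
    refine Asymptotics.IsBigO.of_bound 1 (Eventually.of_forall fun h => ?_)
    simp only [zero_add, max_self, mul_zero, smul_zero, sub_zero, one_mul, norm_pow,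
      Real.norm_eq_abs]
    norm_num
    rw [← sq_abs h]
    exact pow_le_pow_left₀ (le_max_right _ _) (max_le (le_abs_self h) (abs_nonneg h)) 2
  · have h1 : (fun r : ℝ => max r 0 ^ 2) =ᶠ[𝓝 r] fun r => r ^ 2 := by
      filter_upwards [Ioi_mem_nhds h] with s hs
      rw [max_eq_left (mem_Ioi.1 hs).le]
    simpa [max_eq_left h.le] using (hasDerivAt_pow 2 r).congr_of_eventuallyEq h1

theorem contDiff_max_zero_sq : ContDiff ℝ 1 fun r : ℝ => max r 0 ^ 2 := by
  refine contDiff_one_iff_deriv.2 ⟨fun r => (hasDerivAt_max_zero_sq r).differentiableAt, ?_⟩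
  rw [funext fun r => (hasDerivAt_max_zero_sq r).deriv]
  fun_prop

theorem fderiv_apply_eq_of_hasDerivAt {E F : Type*} [NormedAddCommGroup E] [NormedSpace ℝ E]
    [NormedAddCommGroup F] [NormedSpace ℝ F] {Φ : ℝ × E → F} {s : ℝ} {x u : E} {c : F}
    (hΦ : DifferentiableAt ℝ Φ (s, x))
    (h : HasDerivAt (fun τ : ℝ => Φ (s + τ, x + τ • u)) c 0) : fderiv ℝ Φ (s, x) (1, u) = c := by
  have h1 : HasDerivAt (fun τ : ℝ => (s + τ, x + τ • u)) ((1 : ℝ), u) 0 := by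
    refine ((hasDerivAt_id (0 : ℝ)).const_add s).prodMk ?_
    simpa using ((hasDerivAt_id (0 : ℝ)).smul_const u).const_add x
  have h2 : HasFDerivAt Φ (fderiv ℝ Φ (s, x)) (s + 0, x + (0 : ℝ) • u) := by
    simpa using hΦ.hasFDerivAt
  exact (h2.comp_hasDerivAt 0 h1).unique h

section
variable {d : ℕ} {v : Space d → Space d}

theorem integrable_kernel (hv : v ∈ kernelVariations d) (μ : ProbabilityMeasure (Space d))
    (x : Space d) : Integrable (fun y => v (x - y)) (μ : Measure (Space d)) := by
  obtain ⟨K, C, -, hK, hC⟩ := exists_lipschitz_bound hv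
  exact Integrable.of_bound (hK.continuous.comp (by fun_prop)).aestronglyMeasurable C
    (Eventually.of_forall fun y => hC _)

theorem norm_meanFieldVelocity_le {C : ℝ} (hC : ∀ r, ‖v r‖ ≤ C)
    (μ : ProbabilityMeasure (Space d)) (x : Space d) : ‖meanFieldVelocity v μ x‖ ≤ C := by
  have h := norm_integral_le_of_norm_le_const (μ := (μ : Measure (Space d)))
    (Eventually.of_forall fun y => hC (x - y))
  simpa [meanFieldVelocity] using h

theorem lipschitzWith_meanFieldVelocity (hv : v ∈ kernelVariations d) {K : ℝ≥0}
    (hK : LipschitzWith K v) (μ : ProbabilityMeasure (Space d)) :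
    LipschitzWith K (meanFieldVelocity v μ) :=
  LipschitzWith.of_dist_le_mul fun x x' => by
    rw [dist_eq_norm, meanFieldVelocity, meanFieldVelocity,
      ← integral_sub (integrable_kernel hv μ x) (integrable_kernel hv μ x')]
    have h := norm_integral_le_of_norm_le_const (μ := (μ : Measure (Space d)))
      (f := fun y => v (x - y) - v (x' - y)) (C := K * dist x x')
      (Eventually.of_forall fun y => by
        rw [← dist_eq_norm]
        simpa using hK.dist_le_mul (x - y) (x' - y))
    simpa using h

/-- Weak convergence tests against real bounded continuous functions, so the argument goes
coordinate by coordinate. -/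
theorem continuous_meanFieldVelocity (hv : v ∈ kernelVariations d) (x : Space d) :
    Continuous fun μ : ProbabilityMeasure (Space d) => meanFieldVelocity v μ x := by
  obtain ⟨K, C, -, hK, hC⟩ := exists_lipschitz_bound hv
  have hcoord : ∀ i : Fin d, Continuous fun μ : ProbabilityMeasure (Space d) =>
      meanFieldVelocity v μ x i := by
    intro i
    have hc : Continuous fun y => v (x - y) i := by
      have := hK.continuous
      fun_prop
    let ψ : BoundedContinuousFunction (Space d) ℝ := BoundedContinuousFunction.ofNormedAddCommGroup
      (fun y => v (x - y) i) hc C fun y => (PiLp.norm_apply_le (v (x - y)) i).trans (hC _)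
    have heq : ∀ μ : ProbabilityMeasure (Space d), meanFieldVelocity v μ x i =
        ∫ y, ψ y ∂(μ : Measure (Space d)) := fun μ =>
      ((EuclideanSpace.proj (𝕜 := ℝ) i).integral_comp_comm (integrable_kernel hv μ x)).symm
    rw [funext heq, continuous_iff_continuousAt]
    exact fun μ => ProbabilityMeasure.tendsto_iff_forall_integral_tendsto.1 tendsto_id ψ
  have h : Continuous fun μ : ProbabilityMeasure (Space d) =>
      WithLp.toLp 2 fun i => meanFieldVelocity v μ x i :=
    (PiLp.continuous_toLp 2 _).comp (continuous_pi hcoord)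
  exact h

end

section
variable {d : ℕ} {v : Space d → Space d} {T : ℝ}

/-- Cutting off in time a function whose support is bounded in space, locally uniformly in time. -/
theorem exists_time_cutoff {E : Type*} [NormedAddCommGroup E] [NormedSpace ℝ E]
    [ProperSpace E] {T : ℝ} (hT : 0 ≤ T) {ψ : ℝ × E → ℝ} (hψ : ContDiff ℝ 1 ψ)
    (hsupp : ∀ A : ℝ, ∃ R : ℝ, ∀ t x, |t| ≤ A → R < ‖x‖ → ψ (t, x) = 0) :
    ∃ χ : ℝ × E → ℝ, ContDiff ℝ 1 χ ∧ HasCompactSupport χ ∧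
      ∀ t ∈ Icc 0 T, ∀ x, χ =ᶠ[𝓝 (t, x)] ψ := by
  -- The inner radius exceeds `T`, so that the cutoff is `1` near every time of `[0, T]`, endpoints
  -- included, and derivatives agree there as well.
  let θ : ContDiffBump (0 : ℝ) := ⟨T + 1, T + 2, by linarith, by linarith⟩
  obtain ⟨R, hR⟩ := hsupp (T + 2)
  refine ⟨fun p => θ p.1 * ψ p, (θ.contDiff.comp contDiff_fst).mul hψ, ?_, fun t ht x => ?_⟩
  · refine HasCompactSupport.intro ((isCompact_closedBall (0 : ℝ) (T + 2)).prod
      (isCompact_closedBall (0 : E) R)) fun p hp => ?_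
    by_cases h1 : |p.1| ≤ T + 2
    · have h2 : R < ‖p.2‖ := by
        by_contra h2
        exact hp ⟨by simpa using h1, by simpa using not_lt.1 h2⟩
      rw [hR p.1 p.2 h1 h2, mul_zero]
    · rw [θ.zero_of_le_dist (by simpa [θ] using (not_le.1 h1).le), zero_mul]
  · have h1 : (θ : ℝ → ℝ) =ᶠ[𝓝 t] 1 := θ.eventuallyEq_one_of_mem_ball (by
      rw [mem_ball_zero_iff, Real.norm_eq_abs, abs_of_nonneg ht.1]
      change t < T + 1
      linarith [ht.2])
    have h2 := (continuousAt_fst (p := (t, x))).eventually h1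
    filter_upwards [h2] with p hp
    rw [hp, Pi.one_apply, one_mul]

/-- A cutoff in time that is invisible on `[0, T]` extends the weak formulation to test functions
whose support is bounded in space only, such as those that follow characteristics. -/
theorem IsMeanFieldSolution.integral_sub_eq (hT : 0 ≤ T) {f₀ : ProbabilityMeasure (Space d)}
    {f : ℝ → ProbabilityMeasure (Space d)} (hf : IsMeanFieldSolution T v f₀ f)
    {ψ : ℝ × Space d → ℝ} (hψ : ContDiff ℝ 1 ψ)
    (hsupp : ∀ A : ℝ, ∃ R : ℝ, ∀ t x, |t| ≤ A → R < ‖x‖ → ψ (t, x) = 0) {t : ℝ}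
    (ht : t ∈ Icc 0 T) :
    ∫ x, ψ (t, x) ∂(f t : Measure (Space d)) - ∫ x, ψ (0, x) ∂(f₀ : Measure (Space d)) =
      ∫ s in (0 : ℝ)..t, ∫ x, fderiv ℝ ψ (s, x) (1, meanFieldVelocity v (f s) x)
        ∂(f s : Measure (Space d)) := by
  obtain ⟨χ, hχ, hχc, heq⟩ := exists_time_cutoff hT hψ hsupp
  have h := hf.2.2 (fun s x => χ (s, x)) hχ hχc t ht
  simp_rw [deriv_add_inner_gradient (ψ := fun s x => χ (s, x)) hχ] at h
  simp_rw [fun x => (heq t ht x).eq_of_nhds,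
    fun x => (heq 0 (left_mem_Icc.2 hT) x).eq_of_nhds] at h
  rw [h]
  refine intervalIntegral.integral_congr fun s hs => ?_
  rw [uIcc_of_le ht.1] at hs
  refine integral_congr_ae (Eventually.of_forall fun x => ?_)
  exact congrArg (fun L : ℝ × Space d →L[ℝ] ℝ => L (1, meanFieldVelocity v (f s) x))
    (heq s ⟨hs.1, hs.2.trans ht.2⟩ x).fderiv_eq

theorem exists_bound_of_spatial_support (hT : 0 ≤ T) {ψ : ℝ × Space d → ℝ}
    (hψ : ContDiff ℝ 1 ψ)
    (hsupp : ∀ A : ℝ, ∃ R : ℝ, ∀ t x, |t| ≤ A → R < ‖x‖ → ψ (t, x) = 0) :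
    ∃ M, ∀ t ∈ Icc 0 T, ∀ x, ‖ψ (t, x)‖ ≤ M ∧ ‖fderiv ℝ ψ (t, x)‖ ≤ M := by
  obtain ⟨χ, hχ, hχc, heq⟩ := exists_time_cutoff hT hψ hsupp
  obtain ⟨M₁, h₁⟩ := hχ.continuous.bounded_above_of_compact_support hχc
  obtain ⟨M₂, h₂⟩ := (hχ.continuous_fderiv one_ne_zero).bounded_above_of_compact_support
    (hχc.fderiv ℝ)
  refine ⟨max M₁ M₂, fun t ht x => ⟨?_, ?_⟩⟩
  · rw [← (heq t ht x).eq_of_nhds]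
    exact (h₁ _).trans (le_max_left _ _)
  · rw [← (heq t ht x).fderiv_eq]
    exact (h₂ _).trans (le_max_right _ _)

/-- If a nonnegative test function grows at most exponentially along the flow of a solution of
the mean-field equation and its integral vanishes initially, then its integral vanishes. -/
theorem IsMeanFieldSolution.integral_eq_zero (hv : v ∈ kernelVariations d) (hT : 0 ≤ T)
    {f₀ : ProbabilityMeasure (Space d)} {f : ℝ → ProbabilityMeasure (Space d)}
    (hf : IsMeanFieldSolution T v f₀ f)
    {ψ : ℝ × Space d → ℝ} (hψ : ContDiff ℝ 1 ψ)
    (hsupp : ∀ A : ℝ, ∃ R : ℝ, ∀ t x, |t| ≤ A → R < ‖x‖ → ψ (t, x) = 0)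
    (h0 : ∀ p, 0 ≤ ψ p) (hinit : ∫ x, ψ (0, x) ∂(f₀ : Measure (Space d)) = 0) {c : ℝ}
    (hle : ∀ t ∈ Icc 0 T, ∀ x,
      fderiv ℝ ψ (t, x) (1, meanFieldVelocity v (f t) x) ≤ c * ψ (t, x)) :
    ∀ t ∈ Icc 0 T, ∫ x, ψ (t, x) ∂(f t : Measure (Space d)) = 0 := by
  obtain ⟨M, hM⟩ := exists_bound_of_spatial_support hT hψ hsupp
  obtain ⟨K, C, hC0, hK, hC⟩ := exists_lipschitz_bound hv
  have hM0 : 0 ≤ M := (norm_nonneg _).trans (hM 0 (left_mem_Icc.2 hT) 0).1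
  refine eq_zero_of_eq_integral (C := c) (b := fun s => ∫ x,
    fderiv ℝ ψ (s, x) (1, meanFieldVelocity v (f s) x) ∂(f s : Measure (Space d))) (fun t _ => integral_nonneg fun x => h0 _)
    (fun t ht => ?_) (fun t ht => ?_)
  · have h := hf.integral_sub_eq hT hψ hsupp ht
    rwa [hinit, sub_zero] at h
  · rw [← integral_const_mul]
    refine integral_mono ?_ ?_ (hle t ht)
    · have hc : Continuous fun x => fderiv ℝ ψ (t, x) (1, meanFieldVelocity v (f t) x) :=
        ((hψ.continuous_fderiv one_ne_zero).comp (by fun_prop)).clm_apply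
          (continuous_const.prodMk (lipschitzWith_meanFieldVelocity hv hK (f t)).continuous)
      refine Integrable.of_bound hc.aestronglyMeasurable (M * max 1 C)
        (Eventually.of_forall fun x => ?_)
      refine ((fderiv ℝ ψ (t, x)).le_opNorm _).trans
        (mul_le_mul (hM t ht x).2 ?_ (norm_nonneg _) hM0)
      exact max_le_max (by simp) (norm_meanFieldVelocity_le hC _ _)
    · refine Integrable.const_mul (Integrable.of_bound ?_ M
        (Eventually.of_forall fun x => (hM t ht x).1)) c
      exact (hψ.continuous.comp (by fun_prop)).aestronglyMeasurable

theorem hasDerivAt_sub_curve {Z : ℝ → Space d} {t : ℝ} {Z' : Space d} (hZ : HasDerivAt Z Z' t)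
    (x u : Space d) :
    HasDerivAt (fun τ : ℝ => x + τ • u - Z (t + τ)) (u - Z') 0 := by
  have h1 : HasDerivAt (fun τ : ℝ => x + τ • u) u 0 := by
    simpa using ((hasDerivAt_id (0 : ℝ)).smul_const u).const_add x
  have h2 : HasDerivAt (fun τ : ℝ => Z (t + τ)) Z' 0 :=
    HasDerivAt.comp_const_add t 0 (by simpa using hZ)
  exact h1.sub h2

/-- A solution of the mean-field equation that starts at finitely many atoms stays on the
characteristics of these atoms. -/
theorem IsMeanFieldSolution.measure_compl_range {N : ℕ} [NeZero N] (hv : v ∈ kernelVariations d)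
    (hT : 0 ≤ T) {X₀ : Fin N → Space d} {f : ℝ → ProbabilityMeasure (Space d)}
    (hf : IsMeanFieldSolution T v (empiricalMeasure X₀) f) {Z : ℝ → Fin N → Space d}
    (hZ : ContDiff ℝ 1 Z) (hZ0 : Z 0 = X₀)
    (hZ' : ∀ t ∈ Icc 0 T, ∀ i,
      HasDerivAt (fun s => Z s i) (meanFieldVelocity v (f t) (Z t i)) t)
    {t : ℝ} (ht : t ∈ Icc 0 T) : (f t : Measure (Space d)) (range (Z t))ᶜ = 0 := by
  obtain ⟨K, C, hC0, hK, hC⟩ := exists_lipschitz_bound hv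
  have hZi : ∀ i, ContDiff ℝ 1 fun t => Z t i := contDiff_pi.1 hZ
  -- For each time, `D` vanishes exactly on the characteristics, so its integral against `f` is
  -- initially zero.
  set D : ℝ × Space d → ℝ := fun p => ∏ i, ‖p.2 - Z p.1 i‖ ^ 2
  have hDc : ContDiff ℝ 1 D := by
    refine contDiff_prod fun i _ => ContDiff.norm_sq ℝ ?_
    exact contDiff_snd.sub ((hZi i).comp contDiff_fst)
  have hD0 : ∀ p, 0 ≤ D p := fun p => Finset.prod_nonneg fun i _ => by positivity
  -- `max ρ 0 ^ 2` cuts `D` off in space. The decay rate is the speed bound `C`, which makes the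
  -- cutoff nonincreasing along the flow on `[0, T]`.
  let ρ : ℝ → ℝ × Space d → ℝ := fun R p => R * Real.exp (-C * p.1) - (1 + ‖p.2‖ ^ 2)
  have hρc : ∀ R, ContDiff ℝ 1 (ρ R) := fun R => by
    have h1 : ContDiff ℝ 1 fun p : ℝ × Space d => ‖p.2‖ ^ 2 := contDiff_snd.norm_sq ℝ
    have h2 : ContDiff ℝ 1 fun p : ℝ × Space d => R * Real.exp (-C * p.1) := by fun_prop
    exact h2.sub (contDiff_const.add h1)
  have hψc : ∀ R, ContDiff ℝ 1 fun p => D p * max (ρ R p) 0 ^ 2 := fun R =>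
    hDc.mul (contDiff_max_zero_sq.comp (hρc R))
  have hsupp : ∀ R : ℝ, 0 ≤ R → ∀ A : ℝ, ∃ R' : ℝ, ∀ t x, |t| ≤ A → R' < ‖x‖ →
      D (t, x) * max (ρ R (t, x)) 0 ^ 2 = 0 := by
    intro R hR A
    refine ⟨R * Real.exp (C * A), fun t x ht hx => ?_⟩
    have h1 : Real.exp (-C * t) ≤ Real.exp (C * A) := by
      refine Real.exp_le_exp.2 ?_
      nlinarith [neg_abs_le t]
    have h2 : ρ R (t, x) ≤ 0 := by
      have h3 := mul_le_mul_of_nonneg_left h1 hR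
      have h4 : ‖x‖ ≤ 1 + ‖x‖ ^ 2 := by nlinarith [sq_nonneg (‖x‖ - 1), norm_nonneg x]
      simp only [ρ]
      linarith
    rw [max_eq_right h2]
    simp
  have hderiv : ∀ R : ℝ, 0 ≤ R → ∀ t ∈ Icc 0 T, ∀ x,
      fderiv ℝ (fun p => D p * max (ρ R p) 0 ^ 2) (t, x) (1, meanFieldVelocity v (f t) x) ≤
        (N * (2 * K)) * (D (t, x) * max (ρ R (t, x)) 0 ^ 2) := by
    intro R hR t ht x
    set u := meanFieldVelocity v (f t) x
    have hq : ∀ i, HasDerivAt (fun τ : ℝ => ‖x + τ • u - Z (t + τ) i‖ ^ 2)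
        (2 * ⟪x - Z t i, u - meanFieldVelocity v (f t) (Z t i)⟫) 0 := fun i => by
      simpa using (hasDerivAt_sub_curve (hZ' t ht i) x u).norm_sq
    have hD : HasDerivAt (fun τ : ℝ => D (t + τ, x + τ • u))
        (∑ i, (∏ j ∈ Finset.univ.erase i, ‖x - Z t j‖ ^ 2) *
          (2 * ⟪x - Z t i, u - meanFieldVelocity v (f t) (Z t i)⟫)) 0 := by
      simpa using HasDerivAt.fun_finsetProd (u := Finset.univ) fun i _ => hq i
    have hρ : HasDerivAt (fun τ : ℝ => ρ R (t + τ, x + τ • u))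
        (R * (Real.exp (-C * t) * -C) - 2 * ⟪x, u⟫) 0 := by
      have h1 : HasDerivAt (fun τ : ℝ => -C * (t + τ)) (-C) 0 := by
        simpa using ((hasDerivAt_id (0 : ℝ)).const_add t).const_mul (-C)
      have h2 : HasDerivAt (fun τ : ℝ => x + τ • u) u 0 := by
        simpa using ((hasDerivAt_id (0 : ℝ)).smul_const u).const_add x
      simpa [ρ] using (h1.exp.const_mul R).fun_sub (h2.norm_sq.const_add 1)
    have hmax := HasDerivAt.comp (h₂ := fun r : ℝ => max r 0 ^ 2) 0
      (hasDerivAt_max_zero_sq _) hρ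
    rw [fderiv_apply_eq_of_hasDerivAt ((hψc R).differentiable one_ne_zero _) (hD.mul hmax)]
    simp only [add_zero, zero_smul]
    -- Each factor of `D` grows at rate at most `2K` along the flow, because the velocity is
    -- `K`-Lipschitz; there are `N` factors.
    have hDle : (∑ i, (∏ j ∈ Finset.univ.erase i, ‖x - Z t j‖ ^ 2) *
        (2 * ⟪x - Z t i, u - meanFieldVelocity v (f t) (Z t i)⟫)) ≤ N * (2 * K) * D (t, x) := by
      have : ∀ i ∈ (Finset.univ : Finset (Fin N)), (∏ j ∈ Finset.univ.erase i, ‖x - Z t j‖ ^ 2) *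
          (2 * ⟪x - Z t i, u - meanFieldVelocity v (f t) (Z t i)⟫) ≤ 2 * K * D (t, x) := by
        intro i _
        have h1 : ⟪x - Z t i, u - meanFieldVelocity v (f t) (Z t i)⟫ ≤ K * ‖x - Z t i‖ ^ 2 := by
          refine (real_inner_le_norm _ _).trans ?_
          have h2 := (lipschitzWith_meanFieldVelocity hv hK (f t)).dist_le_mul x (Z t i)
          rw [dist_eq_norm, dist_eq_norm] at h2
          calc _ ≤ ‖x - Z t i‖ * (K * ‖x - Z t i‖) :=
                mul_le_mul_of_nonneg_left h2 (norm_nonneg _)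
            _ = _ := by ring
        have h3 : D (t, x) = (∏ j ∈ Finset.univ.erase i, ‖x - Z t j‖ ^ 2) * ‖x - Z t i‖ ^ 2 :=
          (Finset.prod_erase_mul _ _ (Finset.mem_univ i)).symm
        have h4 : 0 ≤ ∏ j ∈ Finset.univ.erase i, ‖x - Z t j‖ ^ 2 :=
          Finset.prod_nonneg fun j _ => by positivity
        rw [h3]
        calc _ ≤ (∏ j ∈ Finset.univ.erase i, ‖x - Z t j‖ ^ 2) * (2 * (K * ‖x - Z t i‖ ^ 2)) := by
              gcongr
          _ = _ := by ring
      refine (Finset.sum_le_sum this).trans (le_of_eq ?_)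
      simp
      ring
    -- Where `ρ > 0`, `C R exp(-C t) ≥ C (1 + ‖x‖²) ≥ 2 C ‖x‖ ≥ -2⟪x, u⟫`: the shrinking of the
    -- cutoff outweighs the transport.
    have hmaxle : 2 * max (ρ R (t, x)) 0 * (R * (Real.exp (-C * t) * -C) - 2 * ⟪x, u⟫) ≤ 0 := by
      rcases le_or_gt (ρ R (t, x)) 0 with h | h
      · rw [max_eq_right h]
        simp
      · rw [max_eq_left h.le]
        refine mul_nonpos_of_nonneg_of_nonpos (by positivity) ?_
        have h1 : -⟪x, u⟫ ≤ ‖x‖ * C := by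
          rw [← inner_neg_right]
          refine (real_inner_le_norm _ _).trans ?_
          rw [norm_neg]
          exact mul_le_mul_of_nonneg_left (norm_meanFieldVelocity_le hC _ _) (norm_nonneg _)
        have h2 : 1 + ‖x‖ ^ 2 ≤ R * Real.exp (-C * t) := by
          simp only [ρ] at h
          linarith
        nlinarith [mul_le_mul_of_nonneg_left h2 hC0, mul_nonneg hC0 (sq_nonneg (‖x‖ - 1))]
    have h5 := mul_le_mul_of_nonneg_right hDle (sq_nonneg (max (ρ R (t, x)) 0))
    have h6 := mul_nonpos_of_nonneg_of_nonpos (hD0 (t, x)) hmaxle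
    linarith
  have hnull : ∀ n : ℕ, (f t : Measure (Space d))
      {x | D (t, x) * max (ρ n (t, x)) 0 ^ 2 ≠ 0} = 0 := by
    intro n
    have hn : (0 : ℝ) ≤ n := n.cast_nonneg
    have hpos : ∀ p, 0 ≤ D p * max (ρ n p) 0 ^ 2 := fun p => mul_nonneg (hD0 p) (sq_nonneg _)
    have h := hf.integral_eq_zero hv hT (hψc n) (hsupp n hn) hpos (by
      rw [integral_empiricalMeasure]
      have : ∀ i, D (0, X₀ i) = 0 := fun i =>
        Finset.prod_eq_zero (Finset.mem_univ i) (by simp [hZ0])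
      simp [this]) (hderiv n hn) t ht
    obtain ⟨M, hM⟩ := exists_bound_of_spatial_support hT (hψc n) (hsupp n hn)
    have hint : Integrable (fun x => D (t, x) * max (ρ n (t, x)) 0 ^ 2)
        (f t : Measure (Space d)) :=
      Integrable.of_bound (((hψc n).continuous.comp (by fun_prop :
        Continuous fun x : Space d => (t, x))).aestronglyMeasurable) M
        (Eventually.of_forall fun x => (hM t ht x).1)
    exact (integral_eq_zero_iff_of_nonneg (fun x => hpos (t, x)) hint).1 h
  -- Off the curves `D > 0`, and the cutoff is positive at the point once `n` is large: the null
  -- sets cover the complement of the range.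
  refine measure_mono_null (fun x hx => mem_iUnion.2 ?_) (measure_iUnion_null hnull)
  obtain ⟨n, hn⟩ := exists_nat_gt ((1 + ‖x‖ ^ 2) * Real.exp (C * t))
  refine ⟨n, mul_ne_zero ?_ ?_⟩
  · refine Finset.prod_ne_zero_iff.2 fun i _ => ?_
    have : x - Z t i ≠ 0 := sub_ne_zero.2 fun h => hx ⟨i, h.symm⟩
    positivity
  · have h1 : 0 < ρ n (t, x) := by
      have h2 : 1 + ‖x‖ ^ 2 < n * Real.exp (-C * t) := by
        rw [neg_mul, Real.exp_neg, ← div_eq_mul_inv, lt_div_iff₀ (Real.exp_pos _)]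
        exact hn
      simp only [ρ]
      linarith
    rw [max_eq_left h1.le]
    positivity

end

section
variable {d N : ℕ} {v : Space d → Space d} {T : ℝ}

theorem measure_empiricalMeasure_compl_range [NeZero N] (X : Fin N → Space d) :
    (empiricalMeasure X : Measure (Space d)) (range X)ᶜ = 0 := by
  change ((N : ℝ≥0∞)⁻¹ • ∑ i, Measure.dirac (X i)) (range X)ᶜ = 0
  have hm : MeasurableSet (range X)ᶜ := (finite_range X).measurableSet.compl
  simp [Measure.dirac_apply' _ hm]

/-- Along curves that either coincide or never meet on `[0, T]`, distinct curves stay uniformly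
separated. -/
theorem exists_separation {Z : ℝ → Fin N → Space d} (hZ : ContinuousOn Z (Icc 0 T)) (a : Fin N)
    (hinj : ∀ t ∈ Icc 0 T, ∀ j, Z t j = Z t a ↔ Z 0 j = Z 0 a) :
    ∃ δ > 0, ∀ t ∈ Icc 0 T, ∀ j, Z t j ≠ Z t a → δ ≤ ‖Z t j - Z t a‖ ^ 2 := by
  have hj : ∀ j, ∃ δ > 0, ∀ t ∈ Icc 0 T, Z t j ≠ Z t a → δ ≤ ‖Z t j - Z t a‖ ^ 2 := by
    intro j
    by_cases h0 : Z 0 j = Z 0 a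
    · exact ⟨1, one_pos, fun t ht h => absurd ((hinj t ht j).2 h0) h⟩
    rcases (Icc (0 : ℝ) T).eq_empty_or_nonempty with he | hne
    · exact ⟨1, one_pos, fun t ht => by simp [he] at ht⟩
    have hc : ContinuousOn (fun t => ‖Z t j - Z t a‖ ^ 2) (Icc 0 T) :=
      (((continuousOn_pi.1 hZ j).sub (continuousOn_pi.1 hZ a)).norm).pow 2
    obtain ⟨s, hs, hmin⟩ := isCompact_Icc.exists_isMinOn hne hc
    have hne' : Z s j - Z s a ≠ 0 := sub_ne_zero.2 fun h => h0 ((hinj s hs j).1 h)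
    exact ⟨_, by positivity, fun t ht _ => hmin ht⟩
  choose δ hδ h using hj
  have hne : (Finset.univ : Finset (Fin N)).Nonempty := ⟨a, Finset.mem_univ a⟩
  exact ⟨Finset.univ.inf' hne δ, (Finset.lt_inf'_iff hne).2 fun j _ => hδ j,
    fun t ht j hne' => (Finset.inf'_le δ (Finset.mem_univ j)).trans (h j t ht hne')⟩

/-- The measure sits on the points `Z j`, and the bump, of squared radius `δ`, sees only the one at
`Z a`, where its height is `δ ^ 2`. The integral therefore reads off the mass of this point. -/
theorem integral_bump_eq {m : Measure (Space d)} [IsFiniteMeasure m] {Z : Fin N → Space d}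
    (hm : m (range Z)ᶜ = 0) {a : Fin N} {δ : ℝ} (hδ : 0 < δ)
    (hsep : ∀ j, Z j ≠ Z a → δ ≤ ‖Z j - Z a‖ ^ 2) :
    ∫ x, max (δ - ‖x - Z a‖ ^ 2) 0 ^ 2 ∂m = m.real {Z a} * δ ^ 2 := by
  have hae : (fun x => max (δ - ‖x - Z a‖ ^ 2) 0 ^ 2) =ᵐ[m]
      ({Z a} : Set (Space d)).indicator fun _ => δ ^ 2 := by
    have hr : ∀ᵐ x ∂m, x ∈ range Z := hm
    filter_upwards [hr] with x hx
    obtain ⟨j, rfl⟩ := hx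
    by_cases h : Z j = Z a
    · simp [h, hδ.le]
    · rw [indicator_of_notMem (by simpa using h), max_eq_right (by linarith [hsep j h])]
      simp
  rw [integral_congr_ae hae, integral_indicator_const _ (measurableSet_singleton _), smul_eq_mul]

/-- A solution of the mean-field equation that starts at an empirical measure is the empirical
measure of the characteristics. -/
theorem IsMeanFieldSolution.eq_empiricalMeasure_characteristics [NeZero N]
    (hv : v ∈ kernelVariations d) (hT : 0 ≤ T) {X₀ : Fin N → Space d}
    {f : ℝ → ProbabilityMeasure (Space d)}
    (hf : IsMeanFieldSolution T v (empiricalMeasure X₀) f) {Z : ℝ → Fin N → Space d}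
    (hZ : ContDiff ℝ 1 Z) (hZ0 : Z 0 = X₀)
    (hZ' : ∀ t ∈ Icc 0 T, ∀ i,
      HasDerivAt (fun s => Z s i) (meanFieldVelocity v (f t) (Z t i)) t)
    {t : ℝ} (ht : t ∈ Icc 0 T) : f t = empiricalMeasure (Z t) := by
  obtain ⟨K, C, hC0, hK, hC⟩ := exists_lipschitz_bound hv
  have hZi : ∀ i, ContDiff ℝ 1 fun t => Z t i := contDiff_pi.1 hZ
  have h0 : (0 : ℝ) ∈ Icc 0 T := left_mem_Icc.2 hT
  -- Characteristics that meet once coincide throughout. Coinciding initial points are allowed, so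
  -- the curves need not be distinct.
  have huniq : ∀ s ∈ Icc 0 T, ∀ i j, Z s i = Z s j →
      EqOn (fun s => Z s i) (fun s => Z s j) (Icc 0 T) := fun s hs i j h =>
    solution_unique (v := fun t => meanFieldVelocity v (f t)) hs
      (fun t _ => lipschitzWith_meanFieldVelocity hv hK (f t))
      (fun t ht => (hZ' t ht i).hasDerivWithinAt) (fun t ht => (hZ' t ht j).hasDerivWithinAt) h
  have hsupp : ∀ s ∈ Icc 0 T, (f s : Measure (Space d)) (range (Z s))ᶜ = 0 := fun s hs =>
    hf.measure_compl_range hv hT hZ hZ0 hZ' hs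
  refine Subtype.ext (measure_eq_of_finite_support (finite_range (Z t)) (hsupp t ht)
    (measure_empiricalMeasure_compl_range (Z t)) ?_)
  rintro _ ⟨a, rfl⟩
  obtain ⟨δ, hδ, hsep⟩ := exists_separation (T := T) hZ.continuous.continuousOn a
    fun s hs j => ⟨fun h => huniq s hs j a h h0, fun h => huniq 0 h0 j a h hs⟩
  -- A bump that moves with the `a`-th curve and misses all curves different from it.
  set ψ : ℝ × Space d → ℝ := fun p => max (δ - ‖p.2 - Z p.1 a‖ ^ 2) 0 ^ 2
  have hψ : ContDiff ℝ 1 ψ := contDiff_max_zero_sq.comp (contDiff_const.sub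
    ((contDiff_snd.sub ((hZi a).comp contDiff_fst)).norm_sq ℝ))
  have hbd : ∀ A : ℝ, ∃ R : ℝ, ∀ t x, |t| ≤ A → R < ‖x‖ → ψ (t, x) = 0 := by
    intro A
    obtain ⟨M, hM⟩ := (isCompact_Icc (a := -A) (b := A)).exists_bound_of_continuousOn
      (hZi a).continuous.continuousOn
    refine ⟨M + δ + 1, fun t x ht hx => ?_⟩
    have h1 : δ + 1 ≤ ‖x - Z t a‖ := by
      linarith [norm_sub_norm_le x (Z t a), hM t (abs_le.1 ht)]
    simp only [ψ]
    rw [max_eq_right (by nlinarith)]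
    simp
  -- On the moving curve the squared distance has zero derivative; on the other curves the profile
  -- `max r 0 ^ 2` has zero derivative. As `f` is carried by the curves, the integral of the bump is
  -- conserved.
  have hflow : ∀ s ∈ Icc 0 T, ∀ x ∈ range (Z s),
      fderiv ℝ ψ (s, x) (1, meanFieldVelocity v (f s) x) = 0 := by
    rintro s hs _ ⟨j, rfl⟩
    set u := meanFieldVelocity v (f s) (Z s j)
    have hr : HasDerivAt (fun τ : ℝ => δ - ‖Z s j + τ • u - Z (s + τ) a‖ ^ 2)
        (-(2 * ⟪Z s j - Z s a, u - meanFieldVelocity v (f s) (Z s a)⟫)) 0 := by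
      simpa using ((hasDerivAt_sub_curve (hZ' s hs a) (Z s j) u).norm_sq).const_sub δ
    have hmax := HasDerivAt.comp (h₂ := fun r : ℝ => max r 0 ^ 2) 0
      (hasDerivAt_max_zero_sq _) hr
    rw [fderiv_apply_eq_of_hasDerivAt (hψ.differentiable one_ne_zero _) hmax]
    by_cases h : Z s j = Z s a
    · simp [h]
    · have := hsep s hs j h
      simp only [zero_smul, add_zero]
      rw [max_eq_right (by linarith)]
      simp
  have hconst := hf.integral_sub_eq hT hψ hbd ht
  have hzero : ∫ s in (0 : ℝ)..t, ∫ x, fderiv ℝ ψ (s, x) (1, meanFieldVelocity v (f s) x)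
      ∂(f s : Measure (Space d)) = ∫ s in (0 : ℝ)..t, (0 : ℝ) := by
    refine intervalIntegral.integral_congr fun s hs => ?_
    rw [uIcc_of_le ht.1] at hs
    have hs' : s ∈ Icc 0 T := ⟨hs.1, hs.2.trans ht.2⟩
    have hr : ∀ᵐ x ∂(f s : Measure (Space d)), x ∈ range (Z s) := hsupp s hs'
    refine integral_eq_zero_of_ae ?_
    filter_upwards [hr] with x hx
    exact hflow s hs' x hx
  rw [hzero, intervalIntegral.integral_zero, sub_eq_zero, integral_empiricalMeasure] at hconst
  have hψeq : ∀ j, ψ (0, X₀ j) = ψ (t, Z t j) := by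
    intro j
    rw [← hZ0]
    simp only [ψ]
    by_cases h : Z 0 j = Z 0 a
    · have h' : Z t j = Z t a := huniq 0 h0 j a h ht
      simp [h, h']
    · have h' : Z t j ≠ Z t a := fun h' => h (huniq t ht j a h' h0)
      rw [max_eq_right (by linarith [hsep 0 h0 j h]), max_eq_right (by linarith [hsep t ht j h'])]
  rw [Finset.sum_congr rfl fun j _ => hψeq j,
    ← integral_empiricalMeasure (Z t) fun x => ψ (t, x)] at hconst
  have e1 := integral_bump_eq (hsupp t ht) hδ (hsep t ht)
  have e2 := integral_bump_eq (measure_empiricalMeasure_compl_range (Z t)) hδ (hsep t ht)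
  have e3 : (f t : Measure (Space d)).real {Z t a} =
      (empiricalMeasure (Z t) : Measure (Space d)).real {Z t a} :=
    mul_right_cancel₀ (pow_pos hδ 2).ne' ((e1.symm.trans hconst).trans e2)
  have e4 : (f t : Measure (Space d)) {Z t a} =
      (empiricalMeasure (Z t) : Measure (Space d)) {Z t a} :=
    (measureReal_eq_measureReal_iff (measure_ne_top _ _) (measure_ne_top _ _)).1 e3
  exact e4

/-- The mean-field equation with an empirical initial measure has no solution other than the
empirical measure of the particles. -/
theorem IsMeanFieldSolution.eq_empiricalMeasure [NeZero N]
    (hv : v ∈ kernelVariations d) (hT : 0 ≤ T) {X₀ : Fin N → Space d}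
    {f : ℝ → ProbabilityMeasure (Space d)}
    (hf : IsMeanFieldSolution T v (empiricalMeasure X₀) f) {X : ℝ → Fin N → Space d}
    (hX : IsParticleSolution T v X₀ X) :
    ∀ t ∈ Icc 0 T, f t = empiricalMeasure (X t) := by
  obtain ⟨K, C, hC0, hK, hC⟩ := exists_lipschitz_bound hv
  have hlip := lipschitzWith_meanFieldVelocity hv hK
  -- With `f` given, `v * f` is a known field, continuous in time and Lipschitz in space, which has
  -- its own characteristics.
  have hucont : ∀ x, ContinuousOn (fun t => meanFieldVelocity v (f t) x) (Icc 0 T) := fun x =>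
    (continuous_meanFieldVelocity hv x).comp_continuousOn hf.1
  have hex : ∀ i, ∃ γ : ℝ → Space d, γ 0 = X₀ i ∧ ∀ t ∈ Icc 0 T,
      HasDerivWithinAt γ (meanFieldVelocity v (f t) (γ t)) (Icc 0 T) t := fun i =>
    exists_solution_of_bounded_lipschitz (v := fun t => meanFieldVelocity v (f t))
      (left_mem_Icc.2 hT) (fun t _ => hlip (f t)) hucont
      (fun t _ x => norm_meanFieldVelocity_le hC (f t) x) (X₀ i)
  choose γ hγ0 hγ using hex
  have hjoint : ContinuousOn (fun p : ℝ × Space d => meanFieldVelocity v (f p.1) p.2)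
      (Icc 0 T ×ˢ univ) :=
    continuousOn_prod_of_continuousOn_lipschitzOnWith' _ K
      (fun t _ => (hlip (f t)).lipschitzOnWith) (fun x _ => hucont x)
  have hext : ∀ i, ∃ y : ℝ → Space d, ContDiff ℝ 1 y ∧ EqOn y (γ i) (Icc 0 T) ∧
      ∀ t ∈ Icc 0 T, HasDerivAt y (meanFieldVelocity v (f t) (γ i t)) t := fun i =>
    exists_contDiff_extension hT (hjoint.comp (continuousOn_id.prodMk
      fun t ht => (hγ i t ht).continuousWithinAt) fun t ht => ⟨ht, trivial⟩) (hγ i)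
  choose y hyc hyeq hy using hext
  set Z : ℝ → Fin N → Space d := fun t i => y i t
  have hZ0 : Z 0 = X₀ := funext fun i => (hyeq i (left_mem_Icc.2 hT)).trans (hγ0 i)
  have key : ∀ t ∈ Icc 0 T, f t = empiricalMeasure (Z t) := fun t ht =>
    hf.eq_empiricalMeasure_characteristics hv hT (contDiff_pi.2 hyc) hZ0
      (fun s hs i => by
        have h := hy i s hs
        rwa [← hyeq i hs] at h) ht
  -- Once `f` is the empirical measure of `Z`, the velocity that drives `Z` is the one induced by
  -- `Z` itself, and the nonlinear system is recovered.
  have hZ : IsParticleSolution T v X₀ Z := by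
    refine (isParticleSolution_iff hv.2.2).2 ⟨hZ0, fun t ht => hasDerivWithinAt_pi.2 fun i => ?_⟩
    have h := (hy i t ht).hasDerivWithinAt (s := Icc 0 T)
    rwa [← hyeq i ht, key t ht, meanFieldVelocity_empiricalMeasure] at h
  intro t ht
  rw [key t ht, hX.eqOn hv hT hZ ht]

end

/-! ### Flows of the particle system -/

section
variable {d N : ℕ} {w : Space d → Space d}

/-- The value function of the particle system: it is constant along trajectories. -/
theorem exists_valueFunction (hw : IsAdmissibleKernel w) {ν : Space d → ℝ} (hν : ContDiff ℝ 2 ν)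
    (T : ℝ) : ∃ G : ℝ × (Fin N → Space d) → ℝ, ContDiff ℝ 2 G ∧
      (∀ X, G (T, X) = ∑ i, ν (X i)) ∧
      ∀ t X, fderiv ℝ G (t, X) (1, particleField w X) = 0 := by
  obtain ⟨K, C, hC0, hK, hC⟩ := exists_lipschitz_bound hw.mem_kernelVariations
  obtain ⟨φ, hφ, hφ0, hadd, hφ'⟩ := exists_contDiff_flow (n := 2) two_ne_zero
    (contDiff_particleField (N := N) hw.contDiff) (lipschitzWith_particleField hK)
    (norm_particleField_le hC)
  have hφ2 : ContDiff ℝ 2 (Function.uncurry φ) := hφ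
  -- The terminal cost is not divided by `N` here; this makes the partial gradients of `G` equal to
  -- `Y_i` with no factor.
  have hG : ContDiff ℝ 2 fun p : ℝ × (Fin N → Space d) => ∑ i, ν (φ (T - p.1) p.2 i) := by
    refine ContDiff.sum fun i _ => hν.comp ?_
    exact (contDiff_pi.1 (hφ2.comp ((contDiff_const.sub contDiff_fst).prodMk contDiff_snd))) i
  refine ⟨_, hG, fun X => by simp [hφ0], fun t X => ?_⟩
  have h1 := (hG.differentiable two_ne_zero (t, X)).hasFDerivAt
  -- By the group law `G` is constant along this curve, whose velocity at `0` is the direction in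
  -- question.
  have h2 : HasDerivAt (fun τ : ℝ => (t + τ, φ τ X)) ((1 : ℝ), particleField w X) 0 := by
    have h := hφ' 0 X
    rw [hφ0] at h
    exact ((hasDerivAt_id (0 : ℝ)).const_add t).prodMk h
  have h1' : HasFDerivAt (fun p : ℝ × (Fin N → Space d) => ∑ i, ν (φ (T - p.1) p.2 i))
      (fderiv ℝ (fun p : ℝ × (Fin N → Space d) => ∑ i, ν (φ (T - p.1) p.2 i)) (t, X))
      (t + 0, φ 0 X) := by
    rwa [add_zero, hφ0]
  have h3 := h1'.comp_hasDerivAt (f := fun τ : ℝ => (t + τ, φ τ X)) (0 : ℝ) h2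
  refine h3.unique ((hasDerivAt_const (0 : ℝ) (∑ i, ν (φ (T - t) X i))).congr_of_eventuallyEq
    (Eventually.of_forall fun τ => ?_))
  simp only [Function.comp_apply]
  rw [← hadd]
  ring_nf

/-- The vector field of the system of the particles and a test particle. -/
def testParticleField (w : Space d → Space d) (p : (Fin N → Space d) × Space d) :
    (Fin N → Space d) × Space d :=
  (particleField w p.1, particleVelocity w p.1 p.2)

/-- The characteristics of the velocity field of the particles. `κ (s, y)` is the position at time
`s` of the characteristic through `y` at time `T`, and `π (t, x)` the position at time `T` of the
characteristic through `x` at time `t`. -/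
theorem exists_characteristics (hw : IsAdmissibleKernel w) (X₀ : Fin N → Space d) (T : ℝ) :
    ∃ (X : ℝ → Fin N → Space d) (κ π : ℝ × Space d → Space d),
      ContDiff ℝ 2 X ∧ X 0 = X₀ ∧ (∀ t, HasDerivAt X (particleField w (X t)) t) ∧
      ContDiff ℝ 2 κ ∧ ContDiff ℝ 2 π ∧
      (∀ s y, HasDerivAt (fun s => κ (s, y)) (particleVelocity w (X s) (κ (s, y))) s) ∧
      (∀ s y, π (s, κ (s, y)) = y) ∧ (∀ t x, κ (t, π (t, x)) = x) ∧ ∀ x, π (T, x) = x := by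
  obtain ⟨K, C, hC0, hK, hC⟩ := exists_lipschitz_bound hw.mem_kernelVariations
  have hF2 : ContDiff ℝ 2 (testParticleField (N := N) w) :=
    ((contDiff_particleField hw.contDiff).comp contDiff_fst).prodMk
      (contDiff_particleVelocity hw.contDiff)
  have hlip : LipschitzWith (K * 2) (testParticleField (N := N) w) := by
    refine LipschitzWith.of_dist_le_mul fun p q => max_le ?_ ?_
    · exact ((lipschitzWith_particleField hK).dist_le_mul _ _).trans
        (mul_le_mul_of_nonneg_left (le_max_left _ _) (by positivity))
    · refine (dist_particleVelocity_le hK p.1 q.1 p.2 q.2).trans ?_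
      have h1 : dist p.2 q.2 ≤ dist p q := le_max_right _ _
      have h2 : dist p.1 q.1 ≤ dist p q := le_max_left _ _
      have h3 := mul_le_mul_of_nonneg_left (add_le_add h1 h2) K.coe_nonneg
      rw [NNReal.coe_mul, NNReal.coe_ofNat]
      linarith
  have hbd : ∀ p, ‖testParticleField (N := N) w p‖ ≤ C := fun p =>
    max_le (norm_particleField_le hC _) (norm_particleVelocity_le hC _ _)
  obtain ⟨Φ, hΦ, hΦ0, hadd, hΦ'⟩ := exists_contDiff_flow (n := 2) two_ne_zero hF2 hlip hbd
  have hΦ2 : ContDiff ℝ 2 (Function.uncurry Φ) := hΦ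
  have hΦ1 : ∀ s p, HasDerivAt (fun s => (Φ s p).1) (particleField w (Φ s p).1) s := fun s p => by
    have h := (hasFDerivAt_fst (p := Φ s p) (𝕜 := ℝ)).comp_hasDerivAt s (hΦ' s p)
    exact h
  set X : ℝ → Fin N → Space d := fun t => (Φ t (X₀, 0)).1
  have hX' : ∀ t, HasDerivAt X (particleField w (X t)) t := fun t => hΦ1 t (X₀, 0)
  have hX2 : ContDiff ℝ 2 X :=
    contDiff_fst.comp (hΦ2.comp (contDiff_id.prodMk contDiff_const))
  -- The test particle exerts no force, so the particle component of the flow does not depend on it.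
  -- Hence the autonomous flow of the enlarged system yields the characteristics of the
  -- time-dependent velocity.
  have hfst : ∀ s t x, (Φ s (X t, x)).1 = X (s + t) := fun s t x => by
    have h := ODE_solution_unique_univ (v := fun _ => particleField w) (s := fun _ => univ)
      (t₀ := 0) (f := fun s => (Φ s (X t, x)).1) (g := fun s => X (s + t))
      (fun _ => (lipschitzWith_particleField hK).lipschitzOnWith)
      (fun s => ⟨hΦ1 s (X t, x), trivial⟩)
      (fun s => ⟨(hX' (s + t)).comp_add_const s t, trivial⟩) (by simp [hΦ0])
    exact congrFun h s
  refine ⟨X, fun p => (Φ (p.1 - T) (X T, p.2)).2, fun p => (Φ (T - p.1) (X p.1, p.2)).2, hX2,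
    by simp [X, hΦ0], hX', ?_, ?_, fun s y => ?_, fun s y => ?_, fun t x => ?_, fun x => ?_⟩
  · exact contDiff_snd.comp (hΦ2.comp ((contDiff_fst.sub contDiff_const).prodMk
      (contDiff_const.prodMk contDiff_snd)))
  · exact contDiff_snd.comp (hΦ2.comp ((contDiff_const.sub contDiff_fst).prodMk
      ((hX2.comp contDiff_fst).prodMk contDiff_snd)))
  · have h1 := (hΦ' (s - T) (X T, y)).comp_sub_const s T
    have h2 := (hasFDerivAt_snd (p := Φ (s - T) (X T, y))).comp_hasDerivAt s h1
    have h3 := hfst (s - T) T y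
    rw [sub_add_cancel] at h3
    have h4 : (testParticleField w (Φ (s - T) (X T, y))).2 =
        particleVelocity w (X s) (Φ (s - T) (X T, y)).2 := by
      rw [testParticleField, h3]
    exact h4 ▸ h2
  · have h3 := hfst (s - T) T y
    rw [sub_add_cancel] at h3
    have h4 : (X s, (Φ (s - T) (X T, y)).2) = Φ (s - T) (X T, y) := Prod.ext h3.symm rfl
    simp only
    rw [h4, ← hadd, sub_add_sub_cancel, sub_self, hΦ0]
  · have h3 := hfst (T - t) t x
    rw [sub_add_cancel] at h3
    have h4 : (X T, (Φ (T - t) (X t, x)).2) = Φ (T - t) (X t, x) := Prod.ext h3.symm rfl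
    simp only
    rw [h4, ← hadd, sub_add_sub_cancel, sub_self, hΦ0]
  · simp [hΦ0]

end

/-! ### The Riesz map and the transposed Jacobian -/

/-- The vector that represents a linear functional. -/
def rieszVector (d : ℕ) : (Space d →L[ℝ] ℝ) →L[ℝ] Space d :=
  LinearMap.toContinuousLinearMap
    { toFun := (InnerProductSpace.toDual ℝ (Space d)).symm
      map_add' := fun _ _ => map_add _ _ _
      map_smul' := fun c ℓ => by simp }

theorem inner_rieszVector {d : ℕ} (ℓ : Space d →L[ℝ] ℝ) (η : Space d) :
    ⟪rieszVector d ℓ, η⟫ = ℓ η :=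
  InnerProductSpace.toDual_symm_apply

theorem gradient_eq_rieszVector {d : ℕ} (f : Space d → ℝ) (x : Space d) :
    ∇ f x = rieszVector d (fderiv ℝ f x) := rfl

theorem inner_gradKernel {d : ℕ} (w : Space d → Space d) (r u η : Space d) :
    ⟪gradKernel w r u, η⟫ = ⟪u, fderiv ℝ w r η⟫ :=
  ContinuousLinearMap.adjoint_inner_left _ _ _

/-- This parity is the only use of the oddness of `w`. It makes the particle adjoint depend on the
differences `Y_j - Y_i` alone. -/
theorem IsAdmissibleKernel.fderiv_neg {d : ℕ} {w : Space d → Space d} (hw : IsAdmissibleKernel w)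
    (r : Space d) : fderiv ℝ w (-r) = fderiv ℝ w r := by
  have h : w = fun r => -w (-r) := funext fun r => by rw [hw.odd, neg_neg]
  have hd : HasFDerivAt w (fderiv ℝ w (-r)) (-r) :=
    (hw.contDiff.differentiable two_ne_zero (-r)).hasFDerivAt
  have h2 := (hd.comp r (hasFDerivAt_id r).neg).neg
  have h3 : HasFDerivAt (fun r => -w (-r)) (fderiv ℝ w (-r)) r :=
    h2.congr_fderiv (by ext η; simp)
  rw [← h] at h3
  exact h3.fderiv.symm

theorem IsAdmissibleKernel.gradKernel_sub_comm {d : ℕ} {w : Space d → Space d}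
    (hw : IsAdmissibleKernel w) (x y u : Space d) :
    gradKernel w (x - y) u = gradKernel w (y - x) u := by
  rw [gradKernel, gradKernel, ← neg_sub y x, hw.fderiv_neg]

theorem IsAdmissibleKernel.exists_gradKernel_bound {d : ℕ} {w : Space d → Space d}
    (hw : IsAdmissibleKernel w) : ∃ C : ℝ≥0, ∀ r u, ‖gradKernel w r u‖ ≤ C * ‖u‖ := by
  obtain ⟨C, hC⟩ := hw.bounded
  refine ⟨C.toNNReal, fun r u => ?_⟩
  refine (ContinuousLinearMap.le_opNorm _ _).trans
    (mul_le_mul_of_nonneg_right ?_ (norm_nonneg _))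
  rw [LinearIsometryEquiv.norm_map]
  exact (hC r).2.1.trans (Real.le_coe_toNNReal C)

theorem gradKernel_sub_right {d : ℕ} (w : Space d → Space d) (r u u' : Space d) :
    gradKernel w r (u - u') = gradKernel w r u - gradKernel w r u' :=
  map_sub _ _ _

/-! ### Existence for the adjoint problems -/

/-- The vector that represents the composition of a functional with `J`. -/
def rieszComp {d : ℕ} {P : Type*} [NormedAddCommGroup P] [NormedSpace ℝ P]
    (J : Space d →L[ℝ] P) : (P →L[ℝ] ℝ) →L[ℝ] Space d :=
  rieszVector d ∘L (ContinuousLinearMap.compL ℝ (Space d) P ℝ).flip J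

theorem inner_rieszComp {d : ℕ} {P : Type*} [NormedAddCommGroup P] [NormedSpace ℝ P]
    (J : Space d →L[ℝ] P) (ℓ : P →L[ℝ] ℝ) (η : Space d) : ⟪rieszComp J ℓ, η⟫ = ℓ (J η) :=
  inner_rieszVector _ _

theorem gradient_curry {d : ℕ} {g : ℝ × Space d → ℝ} (hg : Differentiable ℝ g) (t : ℝ)
    (x : Space d) :
    ∇ (fun x => g (t, x)) x = rieszComp (.inr ℝ ℝ (Space d)) (fderiv ℝ g (t, x)) := by
  have h : HasFDerivAt (Function.uncurry fun t x => g (t, x)) (fderiv ℝ g (t, x)) (t, x) :=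
    (hg (t, x)).hasFDerivAt
  rw [gradient_eq_rieszVector, h.curry_snd.fderiv]
  rfl

section
variable {d N : ℕ} {w : Space d → Space d}

/-- The right-hand side of the particle adjoint system. -/
def adjointField (w : Space d → Space d) (X Y : Fin N → Space d) (i : Fin N) : Space d :=
  (N : ℝ)⁻¹ • ∑ j, (gradKernel w (X j - X i) (Y j) - gradKernel w (X i - X j) (Y i))

/-- The two diagonal terms cancel each other, whatever the value of `∇w(0)`. -/
theorem isParticleAdjoint_iff {T : ℝ} {ν : Space d → ℝ} {X Y : ℝ → Fin N → Space d} :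
    IsParticleAdjoint T w ν X Y ↔ (∀ i, Y T i = ∇ ν (X T i)) ∧
      ∀ t ∈ Icc 0 T, ∀ i,
        HasDerivWithinAt (fun s => Y s i) (adjointField w (X t) (Y t) i) (Icc 0 T) t := by
  refine and_congr Iff.rfl (forall₃_congr fun t _ i => ?_)
  rw [adjointField, ← sum_erase_interaction (a := fun i j => gradKernel w (X t j - X t i) (Y t j) -
    gradKernel w (X t i - X t j) (Y t i)) i (sub_self _), Finset.sum_sub_distrib, smul_sub]

theorem fderiv_particleField_apply (hw : ContDiff ℝ 1 w) (X η : Fin N → Space d) (i : Fin N) :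
    fderiv ℝ (particleField w) X η i =
      (N : ℝ)⁻¹ • ∑ j, fderiv ℝ w (X i - X j) (η i - η j) := by
  have h : ∀ i, HasFDerivAt (fun X : Fin N → Space d => particleField w X i)
      ((N : ℝ)⁻¹ • ∑ j, fderiv ℝ w (X i - X j) ∘L
        (ContinuousLinearMap.proj (R := ℝ) (φ := fun _ : Fin N => Space d) i -
          ContinuousLinearMap.proj j)) X := fun i => by
    refine HasFDerivAt.fun_const_smul (HasFDerivAt.fun_sum fun j _ => ?_) _
    exact HasFDerivAt.comp (g := w) (f := fun X : Fin N → Space d => X i - X j) X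
      (hw.differentiable one_ne_zero _).hasFDerivAt
      ((hasFDerivAt_apply i X).sub (hasFDerivAt_apply j X))
  rw [(hasFDerivAt_pi.2 h).fderiv]
  simp

/-- The adjoint field is minus the transposed Jacobian of the particle field, so the particle
adjoint system is the adjoint of the linearised dynamics. -/
theorem sum_inner_fderiv_particleField (hw : ContDiff ℝ 1 w) (X Y η : Fin N → Space d) :
    ∑ i, ⟪Y i, fderiv ℝ (particleField w) X η i⟫ = -∑ i, ⟪adjointField w X Y i, η i⟫ := by
  simp_rw [fderiv_particleField_apply hw, adjointField, inner_smul_right, inner_smul_left,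
    inner_sum, sum_inner, map_sub, inner_sub_left, inner_sub_right, ← inner_gradKernel]
  simp only [conj_trivial, ← Finset.mul_sum, Finset.sum_sub_distrib]
  rw [Finset.sum_comm (f := fun i j => ⟪gradKernel w (X i - X j) (Y i), η j⟫)]
  ring

/-- `Y_i` is the `i`-th partial gradient of the value function along the trajectory. Its equation is
the `X`-derivative of `DG(1, F) = 0`, in which `D²G` appears in the direction of the trajectory and
`DF` is transposed. -/
theorem exists_particleAdjoint (hw : ContDiff ℝ 1 w) {ν : Space d → ℝ} (hν : ContDiff ℝ 1 ν)
    {T : ℝ} {G : ℝ × (Fin N → Space d) → ℝ} (hG : ContDiff ℝ 2 G)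
    (hGT : ∀ X, G (T, X) = ∑ i, ν (X i))
    (hG' : ∀ t X, fderiv ℝ G (t, X) (1, particleField w X) = 0)
    {X : ℝ → Fin N → Space d} (hX : ∀ t, HasDerivAt X (particleField w (X t)) t) :
    ∃ Y : ℝ → Fin N → Space d, ContDiff ℝ 1 Y ∧
      (∀ t η, fderiv ℝ G (t, X t) (0, η) = ∑ i, ⟪Y t i, η i⟫) ∧
      (∀ i, Y T i = ∇ ν (X T i)) ∧
      ∀ t i, HasDerivAt (fun s => Y s i) (adjointField w (X t) (Y t) i) t := by
  have hX1 : ContDiff ℝ 1 X := by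
    refine contDiff_one_iff_deriv.2 ⟨fun t => (hX t).differentiableAt, ?_⟩
    rw [funext fun t => (hX t).deriv]
    exact (contDiff_particleField hw).continuous.comp
      (continuous_iff_continuousAt.2 fun t => (hX t).continuousAt)
  have hDG : ContDiff ℝ 1 (fderiv ℝ G) := hG.fderiv_right (by norm_num)
  let J : Fin N → Space d →L[ℝ] ℝ × (Fin N → Space d) := fun i =>
    .inr ℝ ℝ (Fin N → Space d) ∘L ContinuousLinearMap.single ℝ (fun _ => Space d) i
  have hJ : ∀ i η, J i η = (0, Pi.single i η) := fun i η => rfl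
  set Y : ℝ → Fin N → Space d := fun t i => rieszComp (J i) (fderiv ℝ G (t, X t))
  have hYη : ∀ t η, fderiv ℝ G (t, X t) (0, η) = ∑ i, ⟪Y t i, η i⟫ := by
    intro t η
    simp_rw [Y, inner_rieszComp, hJ, ← map_sum]
    congr 1
    rw [Prod.ext_iff, Prod.fst_sum, Prod.snd_sum]
    simp [Finset.univ_sum_single]
  refine ⟨Y, contDiff_pi.2 fun i => (rieszComp (J i)).contDiff.comp
    (hDG.comp (contDiff_id.prodMk hX1)), hYη, fun i => ?_, fun t i => ?_⟩
  · refine ext_inner_right ℝ fun η => ?_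
    rw [inner_rieszComp, inner_gradient_left]
    have h1 : HasFDerivAt (fun X => G (T, X)) (fderiv ℝ G (T, X T) ∘L .inr ℝ ℝ _) (X T) :=
      HasFDerivAt.curry_snd (ψ := fun t X => G (t, X))
        (hG.differentiable two_ne_zero (T, X T)).hasFDerivAt
    have h2 : HasFDerivAt (fun X : Fin N → Space d => ∑ i, ν (X i))
        (∑ i, fderiv ℝ ν (X T i) ∘L ContinuousLinearMap.proj (R := ℝ)
          (φ := fun _ : Fin N => Space d) i) (X T) :=
      HasFDerivAt.fun_sum fun i _ => HasFDerivAt.comp (g := ν)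
        (f := fun X : Fin N → Space d => X i) (X T)
        (hν.differentiable one_ne_zero _).hasFDerivAt (hasFDerivAt_apply i (X T))
    rw [funext hGT] at h1
    have h3 := DFunLike.congr_fun (h1.unique h2) (Pi.single i η)
    refine Eq.trans h3 ?_
    simp only [sum_apply, ContinuousLinearMap.comp_apply,
      ContinuousLinearMap.proj_apply]
    rw [Finset.sum_eq_single i (fun j _ hj => by simp [Pi.single_eq_of_ne hj]) (by simp)]
    simp
  · have h1 : HasDerivAt (fun t => fderiv ℝ G (t, X t))
        (fderiv ℝ (fderiv ℝ G) (t, X t) (1, particleField w (X t))) t :=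
      HasFDerivAt.comp_hasDerivAt (f := fun t => (t, X t)) t
        (hDG.differentiable one_ne_zero (t, X t)).hasFDerivAt ((hasDerivAt_id t).prodMk (hX t))
    have h2 := (rieszComp (J i)).hasFDerivAt.comp_hasDerivAt t h1
    have h3 : rieszComp (J i) (fderiv ℝ (fderiv ℝ G) (t, X t) (1, particleField w (X t))) =
        adjointField w (X t) (Y t) i := by
      refine ext_inner_right ℝ fun η => ?_
      have h4 := fderiv_fderiv_of_transport (S := fun _ => 0)
        (u := fun p : ℝ × (Fin N → Space d) => particleField w p.2) hG (t := t) (x := X t)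
        (fun y => hG' t y) (hasFDerivAt_const (0 : ℝ) (X t))
        ((contDiff_particleField hw).differentiable one_ne_zero (X t)).hasFDerivAt
        (Pi.single i η)
      rw [inner_rieszComp, hJ]
      refine h4.trans ?_
      rw [hYη, sum_inner_fderiv_particleField hw,
        Finset.sum_eq_single i (fun j _ hj => by simp [Pi.single_eq_of_ne hj]) (by simp)]
      simp
    exact h3 ▸ h2

/-- The source term `(1/N) ∑ j, w (x - X j) · Y j`. -/
def adjointSource (w : Space d → Space d) (X Y : Fin N → Space d) (x : Space d) : ℝ :=
  (N : ℝ)⁻¹ * ∑ j, ⟪w (x - X j), Y j⟫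

/-- In the coordinate `y = π(t, x)`, constant along characteristics, the transport operator is
`∂_t`. Thus `g` is `ν(y)` minus the integral over `[t, T]` of the source along the characteristic.
-/
theorem exists_transport_solution (hw : ContDiff ℝ 2 w) {ν : Space d → ℝ} (hν : ContDiff ℝ 2 ν)
    {T : ℝ} {X Y : ℝ → Fin N → Space d} {κ π : ℝ × Space d → Space d} (hX : ContDiff ℝ 2 X)
    (hY : ContDiff ℝ 1 Y) (hκ : ContDiff ℝ 2 κ) (hπ : ContDiff ℝ 2 π)
    (hκ' : ∀ s y, HasDerivAt (fun s => κ (s, y)) (particleVelocity w (X s) (κ (s, y))) s)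
    (hπκ : ∀ s y, π (s, κ (s, y)) = y) (hκπ : ∀ t x, κ (t, π (t, x)) = x)
    (hπT : ∀ x, π (T, x) = x) :
    ∃ g : ℝ × Space d → ℝ, ContDiff ℝ 2 g ∧ (∀ x, g (T, x) = ν x) ∧
      ∀ t x, fderiv ℝ g (t, x) (1, particleVelocity w (X t) x) =
        adjointSource w (X t) (Y t) x := by
  have hXi : ∀ i, ContDiff ℝ 2 fun t => X t i := contDiff_pi.1 hX
  have hYi : ∀ i, ContDiff ℝ 1 fun t => Y t i := contDiff_pi.1 hY
  set W : Fin N → ℝ × Space d → Space d := fun j p => w (κ p - X p.1 j)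
  have hW : ∀ j, ContDiff ℝ 2 (W j) := fun j =>
    hw.comp (hκ.sub ((hXi j).comp contDiff_fst))
  set q : ℝ × Space d → ℝ := fun p => (N : ℝ)⁻¹ * ∑ j, ⟪W j p, Y p.1 j⟫
  have hq : ContDiff ℝ 1 q := contDiff_const.mul (ContDiff.sum fun j _ =>
    ((hW j).of_le one_le_two).inner ℝ ((hYi j).comp contDiff_fst))
  -- A space derivative falls on `w` and `κ`, which are `C²`, and never on `Y`, which is only `C¹`
  -- in time. This is what makes the primitive `Q` of class `C²`.
  have hq' : ContDiff ℝ 1 fun p => fderiv ℝ q p ∘L .inr ℝ ℝ (Space d) := by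
    have heq : (fun p => fderiv ℝ q p ∘L .inr ℝ ℝ (Space d)) = fun p => (N : ℝ)⁻¹ • ∑ j,
        innerSL ℝ (Y p.1 j) ∘L (fderiv ℝ (W j) p ∘L .inr ℝ ℝ (Space d)) := by
      funext p
      have h1 : HasFDerivAt (fun x => q (p.1, x)) (fderiv ℝ q p ∘L .inr ℝ ℝ (Space d)) p.2 :=
        HasFDerivAt.curry_snd (ψ := fun t x => q (t, x))
          (hq.differentiable one_ne_zero p).hasFDerivAt
      have h2 : HasFDerivAt (fun x => (N : ℝ)⁻¹ • ∑ j, innerSL ℝ (Y p.1 j) (W j (p.1, x)))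
          ((N : ℝ)⁻¹ • ∑ j, innerSL ℝ (Y p.1 j) ∘L (fderiv ℝ (W j) p ∘L .inr ℝ ℝ (Space d)))
          p.2 := by
        refine HasFDerivAt.fun_const_smul (HasFDerivAt.fun_sum fun j _ => ?_) _
        have h3 : HasFDerivAt (fun x => W j (p.1, x)) (fderiv ℝ (W j) p ∘L .inr ℝ ℝ (Space d))
            p.2 := HasFDerivAt.curry_snd (ψ := fun t x => W j (t, x))
          ((hW j).differentiable two_ne_zero p).hasFDerivAt
        exact (innerSL ℝ (Y p.1 j)).hasFDerivAt.comp p.2 h3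
      refine h1.unique ?_
      simpa [q, real_inner_comm] using h2
    rw [heq]
    refine ContDiff.const_smul _ (ContDiff.sum fun j _ => ?_)
    exact ((innerSL ℝ).contDiff.comp ((hYi j).comp contDiff_fst)).clm_comp
      (((hW j).fderiv_right (by norm_num)).clm_comp contDiff_const)
  set Q : ℝ × Space d → ℝ := fun p => ∫ s in (0 : ℝ)..p.1, q (s, p.2)
  have hQ : ContDiff ℝ 2 Q := contDiff_two_parametricPrimitive hq hq'
  set k : ℝ × Space d → ℝ := fun p => ν p.2 - (Q (T, p.2) - Q p)
  have hk : ContDiff ℝ 2 k :=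
    (hν.comp contDiff_snd).sub ((hQ.comp (contDiff_const.prodMk contDiff_snd)).sub hQ)
  have hg : ContDiff ℝ 2 fun p : ℝ × Space d => k (p.1, π p) :=
    hk.comp (contDiff_fst.prodMk hπ)
  refine ⟨_, hg, fun x => by simp [k, hπT], fun t x => ?_⟩
  set y := π (t, x)
  have hxy : κ (t, y) = x := hκπ t x
  have h1 : HasDerivAt (fun s => k (s, π (s, κ (s, y)))) (q (t, y)) t := by
    simp_rw [hπκ]
    have hc : Continuous fun s : ℝ => q (s, y) := hq.continuous.comp (by fun_prop)
    have h := ((hc.integral_hasStrictDerivAt 0 t).hasDerivAt.const_sub (Q (T, y))).const_sub (ν y)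
    simpa [k, Q] using h
  have h2 : HasDerivAt (fun s => (s, κ (s, y))) (1, particleVelocity w (X t) x) t := by
    have h := (hasDerivAt_id t).prodMk (hκ' t y)
    rwa [hxy] at h
  have h3 : HasFDerivAt (fun p : ℝ × Space d => k (p.1, π p))
      (fderiv ℝ (fun p : ℝ × Space d => k (p.1, π p)) (t, x)) (t, κ (t, y)) := by
    rw [hxy]
    exact (hg.differentiable two_ne_zero (t, x)).hasFDerivAt
  have h4 := (h3.comp_hasDerivAt (f := fun s => (s, κ (s, y))) t h2).unique h1
  rw [h4]
  simp [q, W, adjointSource, hxy]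

/-- The equation for the gradient of a solution of the transport equation. -/
theorem rieszComp_fderiv_fderiv (hw : ContDiff ℝ 2 w)
    {X Y : ℝ → Fin N → Space d} {g : ℝ × Space d → ℝ} (hg : ContDiff ℝ 2 g)
    (hg' : ∀ t x, fderiv ℝ g (t, x) (1, particleVelocity w (X t) x) =
      adjointSource w (X t) (Y t) x) (t : ℝ) (x : Space d) :
    rieszComp (.inr ℝ ℝ (Space d))
        (fderiv ℝ (fderiv ℝ g) (t, x) (1, particleVelocity w (X t) x)) =
      (N : ℝ)⁻¹ • ∑ j, gradKernel w (x - X t j)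
        (Y t j - rieszComp (.inr ℝ ℝ (Space d)) (fderiv ℝ g (t, x))) := by
  have hwj : ∀ j, HasFDerivAt (fun x => w (x - X t j)) (fderiv ℝ w (x - X t j)) x := fun j => by
    have h := HasFDerivAt.comp (g := w) (f := fun x => x - X t j) x
      (hw.differentiable two_ne_zero _).hasFDerivAt ((hasFDerivAt_id x).sub_const (X t j))
    exact h
  have hu : HasFDerivAt (fun x => particleVelocity w (X t) x)
      ((N : ℝ)⁻¹ • ∑ j, fderiv ℝ w (x - X t j)) x :=
    HasFDerivAt.fun_const_smul (HasFDerivAt.fun_sum fun j _ => hwj j) _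
  have hS : HasFDerivAt (fun x => adjointSource w (X t) (Y t) x)
      ((N : ℝ)⁻¹ • ∑ j, innerSL ℝ (Y t j) ∘L fderiv ℝ w (x - X t j)) x := by
    have h : HasFDerivAt (fun x => (N : ℝ)⁻¹ • ∑ j, innerSL ℝ (Y t j) (w (x - X t j)))
        ((N : ℝ)⁻¹ • ∑ j, innerSL ℝ (Y t j) ∘L fderiv ℝ w (x - X t j)) x :=
      HasFDerivAt.fun_const_smul (HasFDerivAt.fun_sum fun j _ =>
        (innerSL ℝ (Y t j)).hasFDerivAt.comp x (hwj j)) _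
    simpa [adjointSource, real_inner_comm] using h
  refine ext_inner_right ℝ fun η => ?_
  rw [inner_rieszComp]
  refine (fderiv_fderiv_of_transport (S := fun p => adjointSource w (X p.1) (Y p.1) p.2)
    (u := fun p => particleVelocity w (X p.1) p.2) hg (hg' t) hS hu η).trans ?_
  have h5 : ∀ ξ, fderiv ℝ g (t, x) (0, ξ) =
      ⟪rieszComp (.inr ℝ ℝ (Space d)) (fderiv ℝ g (t, x)), ξ⟫ := fun ξ => by
    rw [inner_rieszComp, ContinuousLinearMap.inr_apply]
  rw [h5]
  simp only [smul_apply, sum_apply,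
    ContinuousLinearMap.comp_apply, innerSL_apply_apply, inner_smul_left, inner_smul_right,
    inner_sum, sum_inner, gradKernel_sub_right, inner_sub_left, inner_gradKernel,
    Finset.sum_sub_distrib, conj_trivial, smul_eq_mul]
  ring

end

/-! ### Derivatives along trajectories -/

section
variable {E F : Type*} [NormedAddCommGroup E] [NormedSpace ℝ E] [NormedAddCommGroup F]
  [NormedSpace ℝ F] {T : ℝ} {q : ℝ → E → F}

/-- Derivatives in time may be one-sided, but each time slice is a whole space inside the strip, so
the space derivative is a full one. -/
theorem hasFDerivAt_of_contDiffOn_strip (hq : ContDiffOn ℝ 1 (Function.uncurry q) (Icc 0 T ×ˢ univ))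
    {s : ℝ} (hs : s ∈ Icc 0 T) (x : E) :
    HasFDerivAt (q s) (fderivWithin ℝ (Function.uncurry q) (Icc 0 T ×ˢ univ) (s, x) ∘L
      .inr ℝ ℝ E) x := by
  have hD := (hq.differentiableOn one_ne_zero (s, x) ⟨hs, trivial⟩).hasFDerivWithinAt
  have h := HasFDerivWithinAt.comp (f := fun y : E => (s, y)) (s := univ) x hD
    (hasFDerivAt_prodMk_right s x).hasFDerivWithinAt fun y _ => ⟨hs, trivial⟩
  exact hasFDerivWithinAt_univ.1 h

theorem continuousOn_fderiv_of_contDiffOn_strip (hT : 0 < T)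
    (hq : ContDiffOn ℝ 1 (Function.uncurry q) (Icc 0 T ×ˢ univ)) {z : ℝ → E}
    (hz : ContinuousOn z (Icc 0 T)) :
    ContinuousOn (fun s => fderiv ℝ (q s) (z s)) (Icc 0 T) := by
  have h1 : ContinuousOn (fun s => fderivWithin ℝ (Function.uncurry q) (Icc 0 T ×ˢ univ) (s, z s)
      ∘L .inr ℝ ℝ E) (Icc 0 T) :=
    ((hq.continuousOn_fderivWithin ((uniqueDiffOn_Icc hT).prod uniqueDiffOn_univ)
      le_rfl).comp (continuousOn_id.prodMk hz) fun s hs => ⟨hs, trivial⟩).clm_comp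
      continuousOn_const
  exact h1.congr fun s hs => (hasFDerivAt_of_contDiffOn_strip hq hs (z s)).fderiv

/-- The chain rule for a time-dependent function along a trajectory. -/
theorem hasDerivWithinAt_comp_trajectory (hT : 0 < T)
    (hq : ContDiffOn ℝ 1 (Function.uncurry q) (Icc 0 T ×ˢ univ)) {s : ℝ} (hs : s ∈ Icc 0 T)
    {z : ℝ → E} {a : F} {b : E} (ha : HasDerivWithinAt (fun r => q r (z s)) a (Icc 0 T) s)
    (hz : HasDerivWithinAt z b (Icc 0 T) s) :
    HasDerivWithinAt (fun r => q r (z r)) (a + fderiv ℝ (q s) (z s) b) (Icc 0 T) s := by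
  have hD := (hq.differentiableOn one_ne_zero (s, z s) ⟨hs, trivial⟩).hasFDerivWithinAt
  have h1 := HasFDerivWithinAt.comp_hasDerivWithinAt (f := fun r => (r, z r)) s hD
    ((hasDerivWithinAt_id s _).prodMk hz) fun r hr => ⟨hr, trivial⟩
  have h2 := HasFDerivWithinAt.comp_hasDerivWithinAt (f := fun r => (r, z s)) s hD
    ((hasDerivWithinAt_id s _).prodMk (hasDerivWithinAt_const s _ (z s))) fun r hr => ⟨hr, trivial⟩
  -- The given time derivative is the time component of the full derivative on the strip;
  -- derivatives within `[0, T]` are unique because `0 < T`.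
  have h3 := (uniqueDiffOn_Icc hT s hs).eq_deriv _ ha h2
  rw [h3, (hasFDerivAt_of_contDiffOn_strip hq hs (z s)).fderiv, ContinuousLinearMap.comp_apply,
    ContinuousLinearMap.inr_apply, ← map_add, Prod.mk_add_mk, add_zero, zero_add]
  exact h1

end

/-! ### Uniqueness for the adjoint problems -/

section
variable {d N : ℕ} {T : ℝ} {w : Space d → Space d} {X Y : ℝ → Fin N → Space d}

theorem exists_characteristic_through {v : Space d → Space d} (hv : v ∈ kernelVariations d)
    (hX : ContinuousOn X (Icc 0 T)) {t : ℝ} (ht : t ∈ Icc 0 T) (x : Space d) :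
    ∃ z : ℝ → Space d, z t = x ∧
      ∀ s ∈ Icc 0 T, HasDerivWithinAt z (particleVelocity v (X s) (z s)) (Icc 0 T) s := by
  obtain ⟨K, C, -, hK, hC⟩ := exists_lipschitz_bound hv
  have hc : ∀ y, ContinuousOn (fun s => particleVelocity v (X s) y) (Icc 0 T) := fun y =>
    ContinuousOn.fun_const_smul (continuousOn_finsetSum _ fun j _ =>
      hK.continuous.comp_continuousOn (continuousOn_const.sub (continuousOn_pi.1 hX j))) _
  exact exists_solution_of_bounded_lipschitz (v := fun s => particleVelocity v (X s)) ht
    (fun s _ => lipschitzWith_particleVelocity hK (X s)) hc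
    (fun s _ => norm_particleVelocity_le hC (X s)) x

theorem adjointField_eq (hw : IsAdmissibleKernel w) (X Y : Fin N → Space d) (i : Fin N) :
    adjointField w X Y i = (N : ℝ)⁻¹ • ∑ j, gradKernel w (X i - X j) (Y j - Y i) := by
  simp_rw [adjointField, gradKernel_sub_right, hw.gradKernel_sub_comm (X i)]

theorem adjointField_eqOn (hw : IsAdmissibleKernel w) {Y' : ℝ → Fin N → Space d} (hT : 0 ≤ T)
    (hY : ∀ t ∈ Icc 0 T, ∀ i,
      HasDerivWithinAt (fun s => Y s i) (adjointField w (X t) (Y t) i) (Icc 0 T) t)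
    (hY' : ∀ t ∈ Icc 0 T, ∀ i,
      HasDerivWithinAt (fun s => Y' s i) (adjointField w (X t) (Y' t) i) (Icc 0 T) t)
    (h : Y T = Y' T) : EqOn Y Y' (Icc 0 T) := by
  obtain ⟨C, hC⟩ := hw.exists_gradKernel_bound
  refine solution_unique (v := fun t Y => adjointField w (X t) Y) (K := C * 2)
    (right_mem_Icc.2 hT) (fun t _ => LipschitzWith.of_dist_le_mul fun U U' => ?_)
    (fun t ht => hasDerivWithinAt_pi.2 (hY t ht)) (fun t ht => hasDerivWithinAt_pi.2 (hY' t ht)) h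
  refine (dist_pi_le_iff (by positivity)).2 fun i => ?_
  rw [dist_eq_norm, adjointField_eq hw, adjointField_eq hw, ← smul_sub, ← Finset.sum_sub_distrib]
  refine norm_average_le (Fintype.card_fin N) (by positivity) fun j => ?_
  rw [← gradKernel_sub_right]
  refine (hC _ _).trans ?_
  rw [NNReal.coe_mul, NNReal.coe_ofNat, mul_assoc]
  refine mul_le_mul_of_nonneg_left ?_ C.coe_nonneg
  rw [sub_sub_sub_comm]
  refine (norm_sub_le _ _).trans ?_
  rw [← dist_eq_norm, ← dist_eq_norm, two_mul]
  exact add_le_add (dist_le_pi_dist U U' j) (dist_le_pi_dist U U' i)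

/-- The common linear equation of a gradient carried along a characteristic `z` with `Y` prescribed:
`∇g` and `h` satisfy it along `z`, and `Y_i` satisfies it for `z = X_i`. -/
theorem testAdjoint_eqOn (hw : IsAdmissibleKernel w) {z p p' : ℝ → Space d} (hT : 0 ≤ T)
    (hp : ∀ t ∈ Icc 0 T, HasDerivWithinAt p
      ((N : ℝ)⁻¹ • ∑ j, gradKernel w (z t - X t j) (Y t j - p t)) (Icc 0 T) t)
    (hp' : ∀ t ∈ Icc 0 T, HasDerivWithinAt p'
      ((N : ℝ)⁻¹ • ∑ j, gradKernel w (z t - X t j) (Y t j - p' t)) (Icc 0 T) t)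
    (h : p T = p' T) : EqOn p p' (Icc 0 T) := by
  obtain ⟨C, hC⟩ := hw.exists_gradKernel_bound
  refine solution_unique (K := C)
    (v := fun t u => (N : ℝ)⁻¹ • ∑ j, gradKernel w (z t - X t j) (Y t j - u))
    (right_mem_Icc.2 hT) (fun t _ => LipschitzWith.of_dist_le_mul fun u u' => ?_) hp hp' h
  rw [dist_eq_norm, ← smul_sub, ← Finset.sum_sub_distrib]
  refine norm_average_le (Fintype.card_fin N) (by positivity) fun j => ?_
  rw [← gradKernel_sub_right, sub_sub_sub_cancel_left, dist_comm, dist_eq_norm]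
  exact hC _ _

theorem adjointSource_sub (X Y Y' : Fin N → Space d) (x : Space d) :
    adjointSource w X Y x - adjointSource w X Y' x = adjointSource w X (Y - Y') x := by
  simp_rw [adjointSource, ← mul_sub, ← Finset.sum_sub_distrib, ← inner_sub_right, Pi.sub_apply]

theorem abs_adjointSource_sub_le {K : ℝ≥0} (hK : LipschitzWith K w) (X Y : Fin N → Space d)
    (x x' : Space d) :
    |adjointSource w X Y x - adjointSource w X Y x'| ≤ K * dist x x' * ‖Y‖ := by
  rw [adjointSource, adjointSource, ← mul_sub, ← Finset.sum_sub_distrib, ← smul_eq_mul,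
    ← Real.norm_eq_abs]
  refine norm_average_le (Fintype.card_fin N) (by positivity) fun j => ?_
  rw [← inner_sub_left]
  refine (norm_inner_le_norm _ _).trans ?_
  rw [← dist_eq_norm]
  refine mul_le_mul ((hK.dist_le_mul _ _).trans_eq ?_) (norm_le_pi_norm Y j) (norm_nonneg _)
    (by positivity)
  rw [dist_sub_right]

theorem continuousOn_adjointSource {K : ℝ≥0} (hK : LipschitzWith K w)
    (hX : ContinuousOn X (Icc 0 T)) (hY : ContinuousOn Y (Icc 0 T)) {z : ℝ → Space d}
    (hz : ContinuousOn z (Icc 0 T)) :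
    ContinuousOn (fun s => adjointSource w (X s) (Y s) (z s)) (Icc 0 T) := by
  refine continuousOn_const.mul (continuousOn_finsetSum _ fun j _ => ?_)
  exact (hK.continuous.comp_continuousOn (hz.sub (continuousOn_pi.1 hX j))).inner
    (continuousOn_pi.1 hY j)

variable [NeZero N] {ν : Space d → ℝ}

theorem IsMeanFieldGradAdjoint.hasDerivWithinAt_comp {h : ℝ → Space d → Space d} (hT : 0 < T)
    (hh : IsMeanFieldGradAdjoint T w ν (fun t => empiricalMeasure (X t)) h)
    {z : ℝ → Space d} {s : ℝ} (hs : s ∈ Icc 0 T)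
    (hz : HasDerivWithinAt z (particleVelocity w (X s) (z s)) (Icc 0 T) s) :
    HasDerivWithinAt (fun r => h r (z r))
      ((N : ℝ)⁻¹ • ∑ j, gradKernel w (z s - X s j) (h s (X s j) - h s (z s))) (Icc 0 T) s := by
  have h1 := hasDerivWithinAt_comp_trajectory hT hh.1 hs (hh.2.2 s hs (z s)) hz
  simp only [meanFieldVelocity_empiricalMeasure, integral_empiricalMeasure] at h1
  refine h1.congr_deriv ?_
  simp_rw [gradKernel_sub_right, Finset.sum_sub_distrib, smul_sub]
  abel

/-- On the particles the nonlocal term involves only values of `h` on the particles, so the equation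
closes and is the particle adjoint system. -/
theorem IsMeanFieldGradAdjoint.comp_particles_eqOn {h : ℝ → Space d → Space d} (hT : 0 < T)
    (hw : IsAdmissibleKernel w)
    (hX : ∀ t ∈ Icc 0 T, HasDerivWithinAt X (particleField w (X t)) (Icc 0 T) t)
    (hY : IsParticleAdjoint T w ν X Y)
    (hh : IsMeanFieldGradAdjoint T w ν (fun t => empiricalMeasure (X t)) h) :
    EqOn (fun t i => h t (X t i)) Y (Icc 0 T) := by
  rw [isParticleAdjoint_iff] at hY
  refine adjointField_eqOn hw hT.le (fun t ht i => ?_) hY.2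
    (funext fun i => by rw [hh.2.1, hY.1])
  rw [adjointField_eq hw]
  exact hh.hasDerivWithinAt_comp hT ht (hasDerivWithinAt_pi.1 (hX t ht) i)

/-- The values on the particles are already determined, so along every other characteristic a linear
equation with a known source remains. -/
theorem IsMeanFieldGradAdjoint.eqOn {h h' : ℝ → Space d → Space d} (hT : 0 < T)
    (hw : IsAdmissibleKernel w)
    (hX : ∀ t ∈ Icc 0 T, HasDerivWithinAt X (particleField w (X t)) (Icc 0 T) t)
    (hY : IsParticleAdjoint T w ν X Y)
    (hh : IsMeanFieldGradAdjoint T w ν (fun t => empiricalMeasure (X t)) h)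
    (hh' : IsMeanFieldGradAdjoint T w ν (fun t => empiricalMeasure (X t)) h') :
    EqOn h' h (Icc 0 T) := by
  intro t ht
  funext x
  obtain ⟨z, hzt, hz⟩ := exists_characteristic_through hw.mem_kernelVariations
    (fun s hs => (hX s hs).continuousWithinAt) ht x
  have key : ∀ k, IsMeanFieldGradAdjoint T w ν (fun t => empiricalMeasure (X t)) k →
      ∀ s ∈ Icc 0 T, HasDerivWithinAt (fun r => k r (z r))
        ((N : ℝ)⁻¹ • ∑ j, gradKernel w (z s - X s j) (Y s j - k s (z s))) (Icc 0 T) s := by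
    intro k hk s hs
    rw [← hk.comp_particles_eqOn hT hw hX hY hs]
    exact hk.hasDerivWithinAt_comp hT hs (hz s hs)
  have h1 := testAdjoint_eqOn hw hT.le (key h' hh') (key h hh) (by rw [hh.2.1, hh'.2.1]) ht
  simpa [hzt] using h1

theorem IsMeanFieldAdjoint.hasDerivWithinAt_comp {g : ℝ → Space d → ℝ} (hT : 0 < T)
    (hg : IsMeanFieldAdjoint T w ν (fun t => empiricalMeasure (X t)) g)
    {z : ℝ → Space d} {s : ℝ} (hs : s ∈ Icc 0 T)
    (hz : HasDerivWithinAt z (particleVelocity w (X s) (z s)) (Icc 0 T) s) :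
    HasDerivWithinAt (fun r => g r (z r))
      (adjointSource w (X s) (fun j => ∇ (g s) (X s j)) (z s)) (Icc 0 T) s := by
  have h1 := hasDerivWithinAt_comp_trajectory hT hg.1 hs (hg.2.2 s hs (z s)) hz
  have h2 : fderiv ℝ (g s) (z s) (particleVelocity w (X s) (z s)) =
      ⟪particleVelocity w (X s) (z s), ∇ (g s) (z s)⟫ := by
    rw [inner_gradient_right, conj_trivial]
  rw [h2] at h1
  simpa [meanFieldVelocity_empiricalMeasure, integral_empiricalMeasure, adjointSource] using h1

/-- A solution is only `C¹`, so its gradient cannot be differentiated along the particles. Instead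
the gradient of the difference is bounded by a Lipschitz constant, which is in turn controlled by
the later gradients at the particles; Grönwall backwards in time concludes. -/
theorem IsMeanFieldAdjoint.eqOn {g g' : ℝ → Space d → ℝ} (hT : 0 < T)
    (hw : IsAdmissibleKernel w)
    (hX : ∀ t ∈ Icc 0 T, HasDerivWithinAt X (particleField w (X t)) (Icc 0 T) t)
    (hg : IsMeanFieldAdjoint T w ν (fun t => empiricalMeasure (X t)) g)
    (hg' : IsMeanFieldAdjoint T w ν (fun t => empiricalMeasure (X t)) g') :
    EqOn g' g (Icc 0 T) := by
  obtain ⟨K, C, -, hK, hC⟩ := exists_lipschitz_bound hw.mem_kernelVariations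
  have hXc : ContinuousOn X (Icc 0 T) := fun s hs => (hX s hs).continuousWithinAt
  set P : ℝ → Fin N → Space d := fun s j => ∇ (g' s) (X s j) - ∇ (g s) (X s j)
  have hgrad : ∀ k, IsMeanFieldAdjoint T w ν (fun t => empiricalMeasure (X t)) k → ∀ j,
      ContinuousOn (fun s => ∇ (k s) (X s j)) (Icc 0 T) := fun k hk j =>
    (rieszVector d).continuous.comp_continuousOn
      (continuousOn_fderiv_of_contDiffOn_strip hT hk.1 (continuousOn_pi.1 hXc j))
  have hP : ContinuousOn P (Icc 0 T) :=
    continuousOn_pi.2 fun j => (hgrad g' hg' j).sub (hgrad g hg j)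
  have hdiff : ∀ k, IsMeanFieldAdjoint T w ν (fun t => empiricalMeasure (X t)) k →
      ∀ s ∈ Icc 0 T, Differentiable ℝ (k s) := fun k hk s hs x =>
    (hasFDerivAt_of_contDiffOn_strip hk.1 hs x).differentiableAt
  have hcomp : ∀ z : ℝ → Space d, (∀ s ∈ Icc 0 T,
      HasDerivWithinAt z (particleVelocity w (X s) (z s)) (Icc 0 T) s) → ∀ s ∈ Icc 0 T,
      HasDerivWithinAt (fun r => g' r (z r) - g r (z r)) (adjointSource w (X s) (P s) (z s))
        (Icc 0 T) s := by
    intro z hz s hs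
    have h := (hg'.hasDerivWithinAt_comp hT hs (hz s hs)).fun_sub
      (hg.hasDerivWithinAt_comp hT hs (hz s hs))
    rwa [adjointSource_sub] at h
  -- The difference of the solutions is Lipschitz in space.
  set D : ℝ := K * Real.exp (K * T)
  have hlip : ∀ t ∈ Icc 0 T, ∀ x x', |(g' t x - g t x) - (g' t x' - g t x')| ≤
      D * (∫ s in t..T, ‖P s‖) * ‖x - x'‖ := by
    intro t ht x x'
    have htT : Icc t T ⊆ Icc 0 T := Icc_subset_Icc_left ht.1
    obtain ⟨z, hzt, hz⟩ := exists_characteristic_through hw.mem_kernelVariations hXc ht x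
    obtain ⟨z', hzt', hz'⟩ := exists_characteristic_through hw.mem_kernelVariations hXc ht x'
    have hzc : ContinuousOn z (Icc 0 T) := fun s hs => (hz s hs).continuousWithinAt
    have hzc' : ContinuousOn z' (Icc 0 T) := fun s hs => (hz' s hs).continuousWithinAt
    have hright : ∀ y : ℝ → Space d, (∀ s ∈ Icc 0 T,
        HasDerivWithinAt y (particleVelocity w (X s) (y s)) (Icc 0 T) s) → ∀ s ∈ Ico t T,
        HasDerivWithinAt y (particleVelocity w (X s) (y s)) (Ici s) s := fun y hy s hs =>
      (hy s ⟨ht.1.trans hs.1, hs.2.le⟩).mono_of_mem_nhdsWithin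
        (mem_of_superset (Icc_mem_nhdsGE hs.2) (Icc_subset_Icc_left (ht.1.trans hs.1)))
    have hdist : ∀ s ∈ Icc t T, dist (z s) (z' s) ≤ dist x x' * Real.exp (K * T) := by
      intro s hs
      refine (dist_le_of_trajectories_ODE (v := fun s => particleVelocity w (X s))
        (fun s => lipschitzWith_particleVelocity hK (X s)) (hzc.mono htT) (hright z hz)
        (hzc'.mono htT) (hright z' hz') (by rw [hzt, hzt']) s hs).trans ?_
      refine mul_le_mul_of_nonneg_left (Real.exp_le_exp.2 ?_) dist_nonneg
      exact mul_le_mul_of_nonneg_left (by linarith [hs.2, ht.1]) K.coe_nonneg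
    have hcont := (continuousOn_adjointSource hK hXc hP hzc).sub
      (continuousOn_adjointSource hK hXc hP hzc')
    have hF : ∀ s ∈ Icc 0 T, HasDerivWithinAt
        (fun r => (g' r (z r) - g r (z r)) - (g' r (z' r) - g r (z' r)))
        (adjointSource w (X s) (P s) (z s) - adjointSource w (X s) (P s) (z' s)) (Icc 0 T) s :=
      fun s hs => (hcomp z hz s hs).fun_sub (hcomp z' hz' s hs)
    have hint := intervalIntegral.integral_eq_sub_of_hasDerivAt_of_le ht.2
      (fun s hs => ((hF s (htT hs)).continuousWithinAt).mono htT)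
      (fun s hs => (hF s (htT (Ioo_subset_Icc_self hs))).hasDerivAt
        (Icc_mem_nhds (ht.1.trans_lt hs.1) hs.2))
      ((hcont.mono htT).intervalIntegrable_of_Icc ht.2)
    rw [hg.2.1, hg'.2.1, hzt, hzt', sub_self, sub_self, sub_self, zero_sub] at hint
    rw [← abs_neg, ← hint, ← Real.norm_eq_abs]
    have hPn : IntervalIntegrable (fun s => D * ‖x - x'‖ * ‖P s‖) volume t T :=
      ((continuousOn_const.mul hP.norm).mono htT).intervalIntegrable_of_Icc ht.2
    refine (intervalIntegral.norm_integral_le_of_norm_le ht.2 (Eventually.of_forall fun s hs => ?_)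
      hPn).trans_eq ?_
    · refine (abs_adjointSource_sub_le hK _ _ _ _).trans
        (mul_le_mul_of_nonneg_right ?_ (norm_nonneg _))
      have h := mul_le_mul_of_nonneg_left (hdist s (Ioc_subset_Icc_self hs)) K.coe_nonneg
      rw [dist_eq_norm x x'] at h
      simp only [D]
      linarith
    · rw [intervalIntegral.integral_const_mul]
      ring
  have hD : 0 ≤ D := by positivity
  have hPle : ∀ t ∈ Icc 0 T, ‖P t‖ ≤ D * ∫ s in t..T, ‖P s‖ := by
    intro t ht
    have h0 : 0 ≤ D * ∫ s in t..T, ‖P s‖ :=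
      mul_nonneg hD (intervalIntegral.integral_nonneg ht.2 fun s _ => norm_nonneg _)
    refine (pi_norm_le_iff_of_nonneg h0).2 fun j => ?_
    have h1 : P t j = ∇ (fun x => g' t x - g t x) (X t j) := by
      simp only [P, gradient_eq_rieszVector]
      rw [fderiv_fun_sub (hdiff g' hg' t ht _) (hdiff g hg t ht _), map_sub]
    rw [h1, gradient, LinearIsometryEquiv.norm_map]
    exact norm_fderiv_le_of_lip' ℝ h0 (Eventually.of_forall fun x => hlip t ht x _)
  -- Time is reversed, so that the bound by the integral over `[t, T]` becomes one by a primitive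
  -- from `0`.
  have hmaps : MapsTo (fun s => T - s) (Icc 0 T) (Icc 0 T) := fun s hs =>
    ⟨sub_nonneg.2 hs.2, sub_le_self T hs.1⟩
  have hP0 : ∀ t ∈ Icc 0 T, P t = 0 := by
    intro t ht
    have h := eq_zero_of_le_mul_primitive (a := fun s => ‖P (T - s)‖) (C := D) hT.le
      (hP.norm.comp (by fun_prop) hmaps) (fun s _ => norm_nonneg _) (fun s hs => by
        rw [intervalIntegral.integral_comp_sub_left (fun s => ‖P s‖), sub_zero]
        exact hPle _ (hmaps hs)) (T - t) (hmaps ht)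
    simpa using h
  intro t ht
  funext x
  -- With `P = 0` the source vanishes, so the difference is constant along characteristics and zero
  -- at time `T`.
  obtain ⟨z, hzt, hz⟩ := exists_characteristic_through hw.mem_kernelVariations hXc ht x
  have h := solution_unique (v := fun _ _ => (0 : ℝ)) (K := 0) (right_mem_Icc.2 hT.le)
    (fun s _ => LipschitzWith.const 0) (f := fun r => g' r (z r) - g r (z r)) (g := fun _ => 0)
    (fun s hs => by
      have h := hcomp z hz s hs
      rw [hP0 s hs] at h
      simpa [adjointSource] using h)
    (fun s _ => hasDerivWithinAt_const s _ 0) (by simp [hg.2.1, hg'.2.1]) ht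
  simpa [hzt, sub_eq_zero] using h

end

/-! ### Existence for the mean-field adjoint problems -/

section
variable {d N : ℕ} {T : ℝ} {w : Space d → Space d} {ν : Space d → ℝ} {X Y : ℝ → Fin N → Space d}
  {g : ℝ × Space d → ℝ}

/-- Consistency of the construction: `g` was obtained from the source given by `Y`, and its gradient
at the particles gives `Y` back. The prescribed source is therefore the nonlocal term of the
mean-field adjoint. -/
theorem gradient_transport_solution_eqOn (hw : IsAdmissibleKernel w) (hT : 0 < T)
    (hX : ∀ t, HasDerivAt X (particleField w (X t)) t)
    (hYT : ∀ i, Y T i = ∇ ν (X T i))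
    (hY : ∀ t i, HasDerivAt (fun s => Y s i) (adjointField w (X t) (Y t) i) t)
    (hg : ContDiff ℝ 2 g) (hgT : ∀ x, g (T, x) = ν x)
    (hg' : ∀ t x, fderiv ℝ g (t, x) (1, particleVelocity w (X t) x) =
      adjointSource w (X t) (Y t) x) (i : Fin N) :
    EqOn (fun t => ∇ (fun x => g (t, x)) (X t i)) (fun t => Y t i) (Icc 0 T) := by
  have hd := hg.differentiable two_ne_zero
  have hDg : ContDiff ℝ 1 (fderiv ℝ g) := hg.fderiv_right (by norm_num)
  refine testAdjoint_eqOn (X := X) (Y := Y) (z := fun t => X t i) hw hT.le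
    (fun t _ => HasDerivAt.hasDerivWithinAt ?_) (fun t _ => HasDerivAt.hasDerivWithinAt ?_) ?_
  · simp_rw [gradient_curry hd]
    have h1 : HasDerivAt (fun t => fderiv ℝ g (t, X t i))
        (fderiv ℝ (fderiv ℝ g) (t, X t i) (1, particleVelocity w (X t) (X t i))) t :=
      HasFDerivAt.comp_hasDerivAt (f := fun t => (t, X t i)) t
        (hDg.differentiable one_ne_zero (t, X t i)).hasFDerivAt
        ((hasDerivAt_id t).prodMk (hasDerivAt_pi.1 (hX t) i))
    rw [← rieszComp_fderiv_fderiv hw.contDiff hg hg']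
    exact (rieszComp (.inr ℝ ℝ (Space d))).hasFDerivAt.comp_hasDerivAt t h1
  · rw [← adjointField_eq hw]
    exact hY t i
  · simp [hgT, hYT]

variable [NeZero N]

theorem isMeanFieldAdjoint_of_transport (hg : ContDiff ℝ 2 g) (hgT : ∀ x, g (T, x) = ν x)
    (hg' : ∀ t x, fderiv ℝ g (t, x) (1, particleVelocity w (X t) x) =
      adjointSource w (X t) (Y t) x)
    (hgY : ∀ i, EqOn (fun t => ∇ (fun x => g (t, x)) (X t i)) (fun t => Y t i) (Icc 0 T)) :
    IsMeanFieldAdjoint T w ν (fun t => empiricalMeasure (X t)) (fun t x => g (t, x)) := by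
  refine ⟨(hg.of_le one_le_two).contDiffOn, funext hgT, fun t ht x => ?_⟩
  have h1 : HasFDerivAt (Function.uncurry fun t x => g (t, x)) (fderiv ℝ g (t, x)) (t, x) :=
    (hg.differentiable two_ne_zero (t, x)).hasFDerivAt
  refine (h1.curry_fst.hasDerivAt.hasDerivWithinAt (s := Icc 0 T)).congr_deriv ?_
  have h2 : ⟪particleVelocity w (X t) x, ∇ (fun x => g (t, x)) x⟫ =
      fderiv ℝ g (t, x) (0, particleVelocity w (X t) x) := by
    rw [inner_gradient_right, conj_trivial, h1.curry_snd.fderiv]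
    rfl
  rw [meanFieldVelocity_empiricalMeasure, integral_empiricalMeasure, h2]
  have h3 : (N : ℝ)⁻¹ • ∑ j, ⟪w (x - X t j), ∇ (fun x => g (t, x)) (X t j)⟫ =
      adjointSource w (X t) (Y t) x := by
    rw [adjointSource, smul_eq_mul]
    exact congrArg _ (Finset.sum_congr rfl fun j _ => congrArg _ (hgY j ht))
  rw [h3, ← hg', ← map_sub]
  simp

theorem isMeanFieldGradAdjoint_of_transport (hw : IsAdmissibleKernel w) (hg : ContDiff ℝ 2 g)
    (hgT : ∀ x, g (T, x) = ν x)
    (hg' : ∀ t x, fderiv ℝ g (t, x) (1, particleVelocity w (X t) x) =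
      adjointSource w (X t) (Y t) x)
    (hgY : ∀ i, EqOn (fun t => ∇ (fun x => g (t, x)) (X t i)) (fun t => Y t i) (Icc 0 T)) :
    IsMeanFieldGradAdjoint T w ν (fun t => empiricalMeasure (X t))
      (fun t x => ∇ (fun x => g (t, x)) x) := by
  have hd := hg.differentiable two_ne_zero
  have hDg : ContDiff ℝ 1 (fderiv ℝ g) := hg.fderiv_right (by norm_num)
  set R := rieszComp (.inr ℝ ℝ (Space d)) with hRdef
  have hR : ContDiff ℝ 1 fun p : ℝ × Space d => R (fderiv ℝ g p) := R.contDiff.comp hDg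
  have heq : ∀ t, (fun x => ∇ (fun x => g (t, x)) x) = fun x => R (fderiv ℝ g (t, x)) :=
    fun t => funext fun x => gradient_curry hd t x
  refine ⟨?_, fun x => by simp [hgT], fun t ht x => ?_⟩
  · simp_rw [heq]
    exact hR.contDiffOn
  · have hY : ∀ j, R (fderiv ℝ g (t, X t j)) = Y t j := fun j => by
      rw [← gradient_curry hd]
      exact hgY j ht
    simp_rw [meanFieldVelocity_empiricalMeasure, integral_empiricalMeasure, gradient_curry hd]
    have h1 : HasFDerivAt (Function.uncurry fun t x => R (fderiv ℝ g (t, x)))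
        (R ∘L fderiv ℝ (fderiv ℝ g) (t, x)) (t, x) :=
      R.hasFDerivAt.comp (t, x) (hDg.differentiable one_ne_zero (t, x)).hasFDerivAt
    refine (h1.curry_fst.hasDerivAt.hasDerivWithinAt (s := Icc 0 T)).congr_deriv ?_
    have h2 := rieszComp_fderiv_fderiv hw.contDiff hg hg' t x
    simp_rw [gradKernel_sub_right, Finset.sum_sub_distrib, smul_sub] at h2
    change R (fderiv ℝ (fderiv ℝ g) (t, x) (1, 0)) = _
    rw [h1.curry_snd.fderiv]
    simp only [← hRdef, hY] at h2 ⊢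
    rw [sub_right_comm, ← h2, ContinuousLinearMap.comp_apply, ContinuousLinearMap.comp_apply,
      ← map_sub, ← map_sub]
    simp

end

/-! ### The objectives along a perturbation of the kernel -/

section
variable {d N : ℕ} {T : ℝ} {v w : Space d → Space d} {X₀ : Fin N → Space d}

/-- Uniqueness makes the value independent of the chosen solution. -/
theorem particleObjective_eq (hv : v ∈ kernelVariations d) (hT : 0 ≤ T) (ν : Space d → ℝ)
    {X : ℝ → Fin N → Space d} (hX : IsParticleSolution T v X₀ X) :
    particleObjective T ν X₀ v = (N : ℝ)⁻¹ * ∑ i, ν (X T i) := by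
  have h : ∃ X, IsParticleSolution T v X₀ X := ⟨X, hX⟩
  rw [particleObjective, dif_pos h, hX.eqOn hv hT h.choose_spec (right_mem_Icc.2 hT)]

theorem pdeObjective_eq [NeZero N] (hv : v ∈ kernelVariations d) (hT : 0 ≤ T) (ν : Space d → ℝ)
    {X : ℝ → Fin N → Space d} (hX : IsParticleSolution T v X₀ X) :
    pdeObjective T ν (empiricalMeasure X₀) v = (N : ℝ)⁻¹ * ∑ i, ν (X T i) := by
  have h : ∃ f, IsMeanFieldSolution T v (empiricalMeasure X₀) f := ⟨_, hX.isMeanFieldSolution hv⟩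
  rw [pdeObjective, dif_pos h,
    IsMeanFieldSolution.eq_empiricalMeasure hv hT h.choose_spec hX T (right_mem_Icc.2 hT),
    integral_empiricalMeasure, smul_eq_mul]

theorem particleField_add_smul (w φ : Space d → Space d) (ε : ℝ) (X : Fin N → Space d) :
    particleField (w + ε • φ) X = particleField w X + ε • particleField φ X := by
  funext i
  simp only [particleField, particleVelocity, Pi.add_apply, Pi.smul_apply, Finset.sum_add_distrib,
    smul_add, ← Finset.smul_sum, smul_comm ε]

theorem gronwallBound_zero_mul (K c x : ℝ) :
    gronwallBound 0 K c x = c * gronwallBound 0 K 1 x := by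
  unfold gronwallBound
  split_ifs <;> ring

/-- Trajectories depend Lipschitz continuously on the size of the perturbation of the kernel. -/
theorem exists_dist_perturbed_le (hw : w ∈ kernelVariations d) {φ : Space d → Space d}
    (hφ : φ ∈ kernelVariations d) (hT : 0 ≤ T) (X₀ : Fin N → Space d) :
    ∃ B, 0 ≤ B ∧ ∀ (ε : ℝ) (X X' : ℝ → Fin N → Space d), IsParticleSolution T w X₀ X →
      IsParticleSolution T (w + ε • φ) X₀ X' → ∀ t ∈ Icc 0 T, dist (X' t) (X t) ≤ |ε| * B := by
  obtain ⟨K, -, -, hK, -⟩ := exists_lipschitz_bound hw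
  obtain ⟨-, C, hC0, -, hC⟩ := exists_lipschitz_bound hφ
  obtain ⟨B, hB⟩ := (isCompact_Icc (a := 0) (b := T)).exists_bound_of_continuousOn
    (f := gronwallBound 0 (K * 2 : ℝ≥0) 1)
    (fun t _ => (hasDerivAt_gronwallBound 0 _ 1 t).continuousAt.continuousWithinAt)
  have hB0 : 0 ≤ B := (norm_nonneg _).trans (hB 0 (left_mem_Icc.2 hT))
  refine ⟨C * B, by positivity, fun ε X X' hX hX' t ht => ?_⟩
  have hv := add_mem hw (Submodule.smul_mem _ ε hφ)
  have hXc := hX.continuousOn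
  have hXc' := hX'.continuousOn
  rw [isParticleSolution_iff hw.2.2] at hX
  rw [isParticleSolution_iff hv.2.2] at hX'
  have hnhds : ∀ s ∈ Ico 0 T, Icc 0 T ∈ 𝓝[≥] s := fun s hs =>
    mem_of_superset (Icc_mem_nhdsGE hs.2) (Icc_subset_Icc_left hs.1)
  -- The perturbed trajectory solves the unperturbed system up to an error `|ε| C`. Grönwall's bound
  -- is linear in this error, so `|ε|` factors out.
  have h := dist_le_of_approx_trajectories_ODE (v := fun _ => particleField w) (δ := 0)
    (εf := |ε| * C) (εg := 0)
    (fun _ => lipschitzWith_particleField hK) hXc'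
    (fun s hs => (hX'.2 s (Ico_subset_Icc_self hs)).mono_of_mem_nhdsWithin (hnhds s hs))
    (fun s _ => by
      rw [particleField_add_smul, dist_eq_norm, add_sub_cancel_left, norm_smul, Real.norm_eq_abs]
      exact mul_le_mul_of_nonneg_left (norm_particleField_le hC _) (abs_nonneg _))
    hXc (fun s hs => (hX.2 s (Ico_subset_Icc_self hs)).mono_of_mem_nhdsWithin (hnhds s hs))
    (fun s _ => (dist_self _).le) (by rw [hX.1, hX'.1, dist_self]) t ht
  rw [add_zero, sub_zero, gronwallBound_zero_mul] at h
  refine h.trans ?_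
  rw [mul_assoc]
  exact mul_le_mul_of_nonneg_left (mul_le_mul_of_nonneg_left ((le_abs_self _).trans (hB t ht)) hC0)
    (abs_nonneg _)

/-- Because `G` is invariant under the unperturbed flow, its increment along the perturbed
trajectory has an explicit factor `ε`. Convergence of the trajectories then suffices; they need not
be differentiable in `ε`. -/
theorem hasDerivAt_terminalValue (hw : w ∈ kernelVariations d) {φ : Space d → Space d}
    (hφ : φ ∈ kernelVariations d) (hT : 0 ≤ T) {X : ℝ → Fin N → Space d}
    {Xε : ℝ → ℝ → Fin N → Space d} (hX : IsParticleSolution T w X₀ X)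
    (hXε : ∀ ε : ℝ, IsParticleSolution T (w + ε • φ) X₀ (Xε ε))
    {G : ℝ × (Fin N → Space d) → ℝ} (hG : ContDiff ℝ 2 G)
    (hG' : ∀ t X, fderiv ℝ G (t, X) (1, particleField w X) = 0) :
    HasDerivAt (fun ε => G (T, Xε ε T))
      (∫ t in (0 : ℝ)..T, fderiv ℝ G (t, X t) (0, particleField φ (X t))) 0 := by
  obtain ⟨B, hB0, hB⟩ := exists_dist_perturbed_le hw hφ hT X₀
  set Ψ : ℝ × (Fin N → Space d) → ℝ := fun p => fderiv ℝ G p (0, particleField φ p.2)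
  have hΨ : Continuous Ψ := (hG.continuous_fderiv two_ne_zero).clm_apply
    (continuous_const.prodMk ((contDiff_particleField hφ.1).continuous.comp continuous_snd))
  have hΨc : ∀ ε, ContinuousOn (fun t => Ψ (t, Xε ε t)) (Icc 0 T) := fun ε =>
    hΨ.comp_continuousOn (continuousOn_id.prodMk (hXε ε).continuousOn)
  have hFTC : ∀ ε, G (T, Xε ε T) - G (0, X₀) = ε * ∫ t in (0 : ℝ)..T, Ψ (t, Xε ε t) := by
    intro ε
    have hv := add_mem hw (Submodule.smul_mem _ ε hφ)
    have hX' := (isParticleSolution_iff hv.2.2).1 (hXε ε)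
    rw [← intervalIntegral.integral_const_mul, ← hX'.1]
    refine (intervalIntegral.integral_eq_sub_of_hasDerivAt_of_le (f := fun t => G (t, Xε ε t)) hT
      (hG.continuous.comp_continuousOn (continuousOn_id.prodMk (hXε ε).continuousOn))
      (fun s hs => ?_)
      ((continuousOn_const.mul (hΨc ε)).intervalIntegrable_of_Icc hT)).symm
    have h1 := (hX'.2 s (Ioo_subset_Icc_self hs)).hasDerivAt (Icc_mem_nhds hs.1 hs.2)
    have h2 := HasFDerivAt.comp_hasDerivAt (f := fun t => (t, Xε ε t)) s
      (hG.differentiable two_ne_zero (s, Xε ε s)).hasFDerivAt ((hasDerivAt_id s).prodMk h1)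
    have h3 : fderiv ℝ G (s, Xε ε s) (1, particleField (w + ε • φ) (Xε ε s)) =
        ε * Ψ (s, Xε ε s) := by
      have h4 : ((1 : ℝ), particleField (w + ε • φ) (Xε ε s)) =
          (1, particleField w (Xε ε s)) + ε • (0, particleField φ (Xε ε s)) := by
        simp [particleField_add_smul]
      rw [h4, map_add, hG', map_smul, zero_add, smul_eq_mul]
    exact h2.congr_deriv h3
  have hlim : Tendsto (fun ε => ∫ t in (0 : ℝ)..T, Ψ (t, Xε ε t)) (𝓝 0)
      (𝓝 (∫ t in (0 : ℝ)..T, Ψ (t, X t))) := by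
    obtain ⟨M, hM⟩ := (isCompact_Icc (a := 0) (b := T)).exists_bound_of_continuousOn
      hX.continuousOn
    -- For `|ε| < 1` all trajectories stay in the ball of radius `B + M`, where the integrand is
    -- bounded.
    obtain ⟨M', hM'⟩ := ((isCompact_Icc (a := 0) (b := T)).prod
      (isCompact_closedBall (0 : Fin N → Space d) (B + M))).exists_bound_of_continuousOn
      hΨ.continuousOn
    refine intervalIntegral.tendsto_integral_filter_of_dominated_convergence (fun _ => M')
      (Eventually.of_forall fun ε => ?_) ?_ intervalIntegrable_const
      (Eventually.of_forall fun t ht => ?_)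
    · rw [uIoc_of_le hT]
      exact ((hΨc ε).mono Ioc_subset_Icc_self).aestronglyMeasurable measurableSet_Ioc
    · filter_upwards [Metric.ball_mem_nhds (0 : ℝ) one_pos] with ε hε
      refine Eventually.of_forall fun t ht => ?_
      rw [uIoc_of_le hT] at ht
      have ht' := Ioc_subset_Icc_self ht
      refine hM' _ ⟨ht', ?_⟩
      rw [mem_ball_zero_iff, Real.norm_eq_abs] at hε
      rw [mem_closedBall_zero_iff]
      have h1 := hB ε X (Xε ε) hX (hXε ε) t ht'
      have h2 := norm_le_norm_add_norm_sub' (Xε ε t) (X t)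
      rw [← dist_eq_norm] at h2
      have h3 := mul_le_of_le_one_left hB0 hε.le
      linarith [hM t ht']
    · rw [uIoc_of_le hT] at ht
      have ht' := Ioc_subset_Icc_self ht
      have h1 : Tendsto (fun ε => Xε ε t) (𝓝 0) (𝓝 (X t)) := by
        rw [tendsto_iff_dist_tendsto_zero]
        refine squeeze_zero (fun _ => dist_nonneg)
          (fun ε => hB ε X (Xε ε) hX (hXε ε) t ht') ?_
        have h : Continuous fun ε : ℝ => |ε| * B := by fun_prop
        simpa using h.tendsto 0
      exact (hΨ.tendsto (t, X t)).comp (tendsto_const_nhds.prodMk_nhds h1)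
  rw [hasDerivAt_iff_tendsto_slope_zero]
  refine (hlim.mono_left nhdsWithin_le_nhds).congr' ?_
  filter_upwards [self_mem_nhdsWithin] with ε hε
  -- At `ε = 0` the identity says that the value at `ε = 0` is `G(0, X₀)`, so the difference
  -- quotient is the integral itself.
  have h0 := hFTC 0
  rw [zero_mul, sub_eq_zero] at h0
  rw [zero_add, h0, hFTC, smul_eq_mul, inv_mul_cancel_left₀ hε]

end

/-! ### The first variation -/

section
variable {d N : ℕ} {T : ℝ} {w : Space d → Space d} {X Y : ℝ → Fin N → Space d}

theorem continuous_inner_particleField {φ : Space d → Space d} (hφ : φ ∈ kernelVariations d)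
    (hX : Continuous X) (hY : Continuous Y) :
    Continuous fun t => (N : ℝ)⁻¹ * ∑ i, ⟪particleField φ (X t) i, Y t i⟫ := by
  refine continuous_const.mul (continuous_finsetSum _ fun i _ => Continuous.inner ?_
    (continuous_pi_iff.1 hY i))
  exact continuous_pi_iff.1 ((contDiff_particleField hφ.1).continuous.comp hX) i

/-- The linear functional `φ ↦ (1/N) ∑ i, ∫ (1/N) ∑ j, φ (X i - X j) · Y i`. -/
def variationFunctional (T : ℝ) (hX : Continuous X) (hY : Continuous Y) :
    kernelVariations d →ₗ[ℝ] ℝ where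
  toFun φ := ∫ t in (0 : ℝ)..T, (N : ℝ)⁻¹ * ∑ i, ⟪particleField (φ : Space d → Space d) (X t) i, Y t i⟫
  map_add' φ ψ := by
    rw [← intervalIntegral.integral_add
      ((continuous_inner_particleField φ.2 hX hY).intervalIntegrable _ _)
      ((continuous_inner_particleField ψ.2 hX hY).intervalIntegrable _ _)]
    refine intervalIntegral.integral_congr fun t _ => ?_
    have h := particleField_add_smul (φ : Space d → Space d) ψ 1 (X t)
    rw [one_smul, one_smul] at h
    simp only [Submodule.coe_add, h, Pi.add_apply, inner_add_left, Finset.sum_add_distrib, mul_add]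
  map_smul' c φ := by
    rw [RingHom.id_apply, smul_eq_mul, ← intervalIntegral.integral_const_mul]
    refine intervalIntegral.integral_congr fun t _ => ?_
    have h := particleField_add_smul (0 : Space d → Space d) (φ : Space d → Space d) c (X t)
    have h0 : particleField (0 : Space d → Space d) (X t) = 0 := by
      funext i
      simp [particleField, particleVelocity]
    rw [zero_add, h0, zero_add] at h
    simp only [Submodule.coe_smul, h, Pi.smul_apply, inner_smul_left, ← Finset.mul_sum,
      conj_trivial]
    ring

theorem variationFunctional_eq_sum (T : ℝ) (hX : Continuous X) (hY : Continuous Y)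
    (φ : kernelVariations d) :
    variationFunctional T hX hY φ = ((N : ℝ) ^ 2)⁻¹ *
      ∑ i, ∑ j ∈ Finset.univ.erase i, ∫ t in (0 : ℝ)..T,
        ⟪(φ : Space d → Space d) (X t i - X t j), Y t i⟫ := by
  have hc : ∀ i j, Continuous fun t => ⟪(φ : Space d → Space d) (X t i - X t j), Y t i⟫ :=
    fun i j => (φ.2.1.continuous.comp ((continuous_pi_iff.1 hX i).sub
      (continuous_pi_iff.1 hX j))).inner (continuous_pi_iff.1 hY i)
  have hi : ∀ i, ∑ j ∈ Finset.univ.erase i, ∫ t in (0 : ℝ)..T,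
      ⟪(φ : Space d → Space d) (X t i - X t j), Y t i⟫ =
      ∫ t in (0 : ℝ)..T, ∑ j, ⟪(φ : Space d → Space d) (X t i - X t j), Y t i⟫ := fun i => by
    rw [intervalIntegral.integral_finsetSum fun j _ => (hc i j).intervalIntegrable _ _]
    exact Finset.sum_erase _ (by simp [φ.2.2.2])
  simp_rw [hi]
  rw [← intervalIntegral.integral_finsetSum fun i _ =>
    (continuous_finsetSum _ fun j _ => hc i j).intervalIntegrable _ _,
    ← intervalIntegral.integral_const_mul]
  refine intervalIntegral.integral_congr fun t _ => ?_
  simp only [particleField, particleVelocity, inner_smul_left, sum_inner, conj_trivial,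
    ← Finset.mul_sum]
  ring

theorem variationFunctional_eq_integral [NeZero N] (hT : 0 ≤ T) (hX : Continuous X)
    (hY : Continuous Y) {g : ℝ → Space d → ℝ}
    (hgY : ∀ i, EqOn (fun t => ∇ (g t) (X t i)) (fun t => Y t i) (Icc 0 T))
    (φ : kernelVariations d) :
    variationFunctional T hX hY φ = ∫ t in (0 : ℝ)..T,
      ∫ x, ∫ y, ⟪(φ : Space d → Space d) (x - y), ∇ (g t) x⟫
        ∂(empiricalMeasure (X t) : Measure (Space d))
        ∂(empiricalMeasure (X t) : Measure (Space d)) := by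
  refine intervalIntegral.integral_congr fun t ht => ?_
  rw [uIcc_of_le hT] at ht
  have h : ∀ i, ∇ (g t) (X t i) = Y t i := fun i => hgY i ht
  simp only [integral_empiricalMeasure, h, particleField, particleVelocity, inner_smul_left,
    sum_inner, conj_trivial, smul_eq_mul]

theorem hasDerivAt_average_terminalCost (hw : w ∈ kernelVariations d) (hT : 0 ≤ T) {ν : Space d → ℝ}
    (hX : Continuous X) (hY : Continuous Y)
    {G : ℝ × (Fin N → Space d) → ℝ} (hG : ContDiff ℝ 2 G)
    (hGT : ∀ X, G (T, X) = ∑ i, ν (X i))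
    (hG' : ∀ t X, fderiv ℝ G (t, X) (1, particleField w X) = 0)
    (hGY : ∀ t η, fderiv ℝ G (t, X t) (0, η) = ∑ i, ⟪Y t i, η i⟫)
    {X₀ : Fin N → Space d} (hXsol : IsParticleSolution T w X₀ X) (φ : kernelVariations d)
    {Xε : ℝ → ℝ → Fin N → Space d}
    (hXε : ∀ ε : ℝ, IsParticleSolution T (w + ε • (φ : Space d → Space d)) X₀ (Xε ε)) :
    HasDerivAt (fun ε => (N : ℝ)⁻¹ * ∑ i, ν (Xε ε T i)) (variationFunctional T hX hY φ) 0 := by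
  have h := (hasDerivAt_terminalValue hw φ.2 hT hXsol hXε hG hG').const_mul (N : ℝ)⁻¹
  simp_rw [hGT, hGY] at h
  refine h.congr_deriv ?_
  rw [← intervalIntegral.integral_const_mul]
  refine intervalIntegral.integral_congr fun t _ => ?_
  simp only [real_inner_comm]

end

end ParticleMeanField

theorem mainTheorem2 {d N : ℕ} [NeZero N] {T : ℝ} (hT : 0 < T)
    {ν : Space d → ℝ} (hν : ContDiff ℝ 2 ν)
    {w : Space d → Space d} (hw : IsAdmissibleKernel w) (X₀ : Fin N → Space d) :
    -- Both forward problems are uniquely solvable at `w` and at each perturbation of `w`,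
    -- and the solution of the mean-field equation is the empirical measure of the particles.
    (∀ φ ∈ kernelVariations d, ∃ X : ℝ → Fin N → Space d,
      IsParticleSolution T (w + φ) X₀ X ∧
      (∀ X', IsParticleSolution T (w + φ) X₀ X' → ∀ t ∈ Icc 0 T, X' t = X t) ∧
      IsMeanFieldSolution T (w + φ) (empiricalMeasure X₀) (fun t => empiricalMeasure (X t)) ∧
      (∀ f, IsMeanFieldSolution T (w + φ) (empiricalMeasure X₀) f →
        ∀ t ∈ Icc 0 T, f t = empiricalMeasure (X t))) ∧
    -- At `w`, with `f_N` the empirical measure of the particles `X`, the adjoint problems are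
    -- uniquely solvable, `h = ∇g`, and `Y_i(t) = h(t, X_i(t))`.
    ∃ (X Y : ℝ → Fin N → Space d) (g : ℝ → Space d → ℝ) (h : ℝ → Space d → Space d),
      IsParticleSolution T w X₀ X ∧
      IsParticleAdjoint T w ν X Y ∧
      (∀ Y', IsParticleAdjoint T w ν X Y' → ∀ t ∈ Icc 0 T, Y' t = Y t) ∧
      IsMeanFieldAdjoint T w ν (fun t => empiricalMeasure (X t)) g ∧
      (∀ g', IsMeanFieldAdjoint T w ν (fun t => empiricalMeasure (X t)) g' →
        ∀ t ∈ Icc 0 T, g' t = g t) ∧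
      IsMeanFieldGradAdjoint T w ν (fun t => empiricalMeasure (X t)) h ∧
      (∀ h', IsMeanFieldGradAdjoint T w ν (fun t => empiricalMeasure (X t)) h' →
        ∀ t ∈ Icc 0 T, h' t = h t) ∧
      (∀ t ∈ Icc 0 T, ∀ x, h t x = ∇ (g t) x) ∧
      (∀ t ∈ Icc 0 T, ∀ i, Y t i = h t (X t i)) ∧
      -- The two objectives have the same first variation `L` at `w`, given by either adjoint.
      ∃ L : kernelVariations d →ₗ[ℝ] ℝ,
        HasFirstVariation (pdeObjective T ν (empiricalMeasure X₀)) w L ∧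
        HasFirstVariation (particleObjective T ν X₀) w L ∧
        (∀ φ : kernelVariations d, L φ = ∫ t in (0 : ℝ)..T,
          ∫ x, ∫ y, ⟪(φ : Space d → Space d) (x - y), ∇ (g t) x⟫
            ∂(empiricalMeasure (X t) : Measure (Space d))
            ∂(empiricalMeasure (X t) : Measure (Space d))) ∧
        (∀ φ : kernelVariations d, L φ = ((N : ℝ) ^ 2)⁻¹ *
          ∑ i, ∑ j ∈ Finset.univ.erase i, ∫ t in (0 : ℝ)..T,
            ⟪(φ : Space d → Space d) (X t i - X t j), Y t i⟫) := by
  have hw' := hw.mem_kernelVariations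
  refine ⟨fun φ hφ => ?_, ?_⟩
  · have hv := add_mem hw' hφ
    obtain ⟨X, hX⟩ := exists_isParticleSolution hv hT.le X₀
    exact ⟨X, hX, fun X' hX' => hX.eqOn hv hT.le hX', hX.isMeanFieldSolution hv,
      fun f hf => hf.eq_empiricalMeasure hv hT.le hX⟩
  obtain ⟨X, κ, π, hX2, hX0, hX, hκ, hπ, hκ', hπκ, hκπ, hπT⟩ := exists_characteristics hw X₀ T
  obtain ⟨G, hG, hGT, hG'⟩ := exists_valueFunction (N := N) hw hν T
  obtain ⟨Y, hY1, hGY, hYT, hY⟩ := exists_particleAdjoint (hw.contDiff.of_le one_le_two)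
    (hν.of_le one_le_two) hG hGT hG' hX
  obtain ⟨g, hg, hgT, hg'⟩ := exists_transport_solution hw.contDiff hν hX2 hY1 hκ hπ hκ' hπκ hκπ hπT
  have hgY := gradient_transport_solution_eqOn hw hT hX hYT hY hg hgT hg'
  have hXI : ∀ t ∈ Icc 0 T, HasDerivWithinAt X (particleField w (X t)) (Icc 0 T) t :=
    fun t _ => (hX t).hasDerivWithinAt
  have hXsol : IsParticleSolution T w X₀ X := (isParticleSolution_iff hw.map_zero).2 ⟨hX0, hXI⟩
  have hYadj : IsParticleAdjoint T w ν X Y :=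
    isParticleAdjoint_iff.2 ⟨hYT, fun t _ i => (hY t i).hasDerivWithinAt⟩
  have hgadj := isMeanFieldAdjoint_of_transport hg hgT hg' hgY
  have hhadj := isMeanFieldGradAdjoint_of_transport hw hg hgT hg' hgY
  refine ⟨X, Y, fun t x => g (t, x), fun t x => ∇ (fun x => g (t, x)) x, hXsol, hYadj,
    fun Y' hY' => ?_, hgadj, fun g' hg' => hgadj.eqOn hT hw hXI hg', hhadj,
    fun h' hh' => hhadj.eqOn hT hw hXI hYadj hh', fun _ _ _ => rfl, fun t ht i => (hgY i ht).symm,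
    variationFunctional T hX2.continuous hY1.continuous, ?_, ?_,
    variationFunctional_eq_integral hT.le _ _ hgY, variationFunctional_eq_sum T _ _⟩
  · rw [isParticleAdjoint_iff] at hYadj hY'
    exact adjointField_eqOn hw hT.le hY'.2 hYadj.2 (funext fun i => (hY'.1 i).trans (hYT i).symm)
  -- Both objectives are equal, for every `ε`, to the average of `ν` over the same perturbed
  -- particles, so a single derivative serves both.
  all_goals
    intro φ
    have hv : ∀ ε : ℝ, w + ε • (φ : Space d → Space d) ∈ kernelVariations d := fun ε =>
      add_mem hw' (Submodule.smul_mem _ ε φ.2)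
    choose Xε hXε using fun ε => exists_isParticleSolution (hv ε) hT.le X₀
    have h := hasDerivAt_average_terminalCost hw' hT.le hX2.continuous hY1.continuous hG hGT hG' hGY
      hXsol φ hXε
  · exact h.congr_of_eventuallyEq
      (Filter.Eventually.of_forall fun ε => pdeObjective_eq (hv ε) hT.le ν (hXε ε))
  · exact h.congr_of_eventuallyEq
      (Filter.Eventually.of_forall fun ε => particleObjective_eq (hv ε) hT.le ν (hXε ε))
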